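/- Let $n\ge 1$, $m\in\mathbf R$ and $0\le\varrho\le 1$. The class $L^\infty S^m_\varrho$ consists of the functions $a:\mathbf R^n\times\mathbf R^n\to\mathbf C$, $a=a(x,\xi)$, that are smooth in $\xi$, measurable in $x$, and satisfy for every multi-index $\alpha$ $$\sup_{\xi\in\mathbf R^n}\langle\xi\rangle^{-m+\varrho|\alpha|}\,\|\partial_\xi^\alpha a(\cdot,\xi)\|_{L^\infty(\mathbf R^n)}<\infty ,\qquad \langle\xi\rangle=(1+|\xi|^2)^{1/2}.$$ The class $L^\infty\Phi^2$ consists of the real-valued functions $\varphi(x,\xi)$, $x\in\mathbf R^n$, $\xi\in\mathbf R^n\setminus 0$, that are positively homogeneous of degree $1$ and smooth in $\xi\ne 0$, measurable in $x$, and satisfy for every multi-index $\alpha$ with $|\alpha|\ge 2$ $$\sup_{\xi\ne 0}|\xi|^{-1+|\alpha|}\,\|\partial_\xi^\alpha\varphi(\cdot,\xi)\|_{L^\infty(\mathbf R^n)}<\infty .$$ Such a $\varphi$ satisfies the rough non-degeneracy condition if there is a constant $c>0$ such that $$|\nabla_\xi\varphi(x,\xi)-\nabla_\xi\varphi(y,\xi)|\ge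 c\,|x-y|\qquad\text{for all }x,y\in\mathbf R^n,\ \xi\in\mathbf R^n\setminus 0 .$$ Theorem. Let $a\in L^\infty S^m_\varrho$ with $m<-\frac{n-1}{2}+n(\varrho-1)$, and let $\varphi\in L^\infty\Phi^2$ satisfy the rough non-degeneracy condition. If $n=1$, assume in addition that $\varphi(\cdot,\xi)+\varphi(\cdot,-\xi)\in L^\infty(\mathbf R)$ for $|\xi|=1$ (for $n\ge 2$ this is automatic, uniformly in $\xi$). For a Schwartz function $u$ put $$Tu(x)=(2\pi)^{-n}\int_{\mathbf R^n}e^{i\varphi(x,\xi)}\,a(x,\xi)\,\widehat u(\xi)\,d\xi,\qquad \widehat u(\xi)=\int_{\mathbf R^n}e^{-i\langle y,\xi\rangle}u(y)\,dy .$$ Then there is a constant $C>0$ such that for every $u\in\mathscr S(\mathbf R^n)$ the integral defining $Tu(x)$ converges absolutely for almost every $x$, $Tu\in L^1(\mathbf R^n)$, and $$\|Tu\|_{L^1(\mathbf R^n)}\le C\,\|u\|_{L^1(\mathbf R^n)} .$$ -/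

import Mathlib

open MeasureTheory
open scoped ContDiff SchwartzMap

noncomputable section

/-- The Japanese bracket `⟨ξ⟩ = (1 + |ξ|²)^{1/2}`. -/
def japaneseBracket {n : ℕ} (ξ : EuclideanSpace ℝ (Fin n)) : ℝ :=
  Real.sqrt (1 + ‖ξ‖ ^ 2)

/-- The amplitude class `L^∞ S^m_ρ` on `ℝⁿ × ℝⁿ`: `a (x, ξ)` is smooth in `ξ`, (Lebesgue) measurable
in `x`, and for every order `k`,
`sup_ξ ⟨ξ⟩^{-m + ρ k} ‖∂_ξ^k a(·, ξ)‖_{L^∞} < ∞`.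
The `k`-th Fréchet derivative in `ξ` collects all `∂_ξ^α a` with `|α| = k`; a bound on its norm is a
bound on all of these partial derivatives. The `L^∞`-norm in `x` is an essential supremum. -/
structure IsRoughAmplitude {n : ℕ} (m ρ : ℝ)
    (a : EuclideanSpace ℝ (Fin n) → EuclideanSpace ℝ (Fin n) → ℂ) : Prop where
  contDiff : ∀ x, ContDiff ℝ ∞ (a x)
  aemeasurable : ∀ ξ, AEMeasurable (fun x => a x ξ) volume
  bound : ∀ k : ℕ, ∃ C : ℝ, ∀ ξ, ∀ᵐ x ∂(volume : Measure (EuclideanSpace ℝ (Fin n))),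
    japaneseBracket ξ ^ (-m + ρ * k) * ‖iteratedFDeriv ℝ k (a x) ξ‖ ≤ C

/-- The phase class `L^∞ Φ^k` on `ℝⁿ × (ℝⁿ \ 0)`: `φ (x, ξ)` is real valued, positively homogeneous of
degree `1` and smooth in `ξ ≠ 0`, (Lebesgue) measurable in `x`, and for every order `j ≥ k`,
`sup_{ξ ≠ 0} |ξ|^{-1 + j} ‖∂_ξ^j φ(·, ξ)‖_{L^∞} < ∞`.
Values at `ξ = 0` are irrelevant. -/
structure IsRoughPhase {n : ℕ} (k : ℕ)
    (φ : EuclideanSpace ℝ (Fin n) → EuclideanSpace ℝ (Fin n) → ℝ) : Prop where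
  homogeneous : ∀ x ξ, ξ ≠ 0 → ∀ t : ℝ, 0 < t → φ x (t • ξ) = t * φ x ξ
  contDiffOn : ∀ x, ContDiffOn ℝ ∞ (φ x) {0}ᶜ
  aemeasurable : ∀ ξ, ξ ≠ 0 → AEMeasurable (fun x => φ x ξ) volume
  bound : ∀ j : ℕ, k ≤ j → ∃ C : ℝ, ∀ ξ, ξ ≠ 0 →
    ∀ᵐ x ∂(volume : Measure (EuclideanSpace ℝ (Fin n))),
      ‖ξ‖ ^ (-1 + (j : ℤ)) * ‖iteratedFDeriv ℝ j (φ x) ξ‖ ≤ C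

/-- The rough non-degeneracy condition: `φ` is `C¹` in `ξ ≠ 0`, (Lebesgue) measurable in `x`, and
`|∂_ξ φ(x, ξ) - ∂_ξ φ(y, ξ)| ≥ c |x - y|` for all `x, y` and all `ξ ≠ 0`, with some `c > 0`. -/
structure RoughNondegenerate {n : ℕ}
    (φ : EuclideanSpace ℝ (Fin n) → EuclideanSpace ℝ (Fin n) → ℝ) : Prop where
  contDiffOn : ∀ x, ContDiffOn ℝ 1 (φ x) {0}ᶜ
  aemeasurable : ∀ ξ, ξ ≠ 0 → AEMeasurable (fun x => φ x ξ) volume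
  lower_bound : ∃ c : ℝ, 0 < c ∧ ∀ x y ξ, ξ ≠ 0 →
    c * ‖x - y‖ ≤ ‖gradient (φ x) ξ - gradient (φ y) ξ‖

/-- The Fourier transform in the normalisation `û(ξ) = ∫ e^{-i⟨y, ξ⟩} u(y) dy`. -/
def fourierHat {n : ℕ} (u : EuclideanSpace ℝ (Fin n) → ℂ) (ξ : EuclideanSpace ℝ (Fin n)) : ℂ :=
  ∫ y, Complex.exp (-(Complex.I * ((inner ℝ y ξ : ℝ) : ℂ))) * u y

/-- The integrand `e^{i φ(x, ξ)} a(x, ξ) û(ξ)` of a Fourier integral operator. -/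
def fioIntegrand {n : ℕ} (a : EuclideanSpace ℝ (Fin n) → EuclideanSpace ℝ (Fin n) → ℂ)
    (φ : EuclideanSpace ℝ (Fin n) → EuclideanSpace ℝ (Fin n) → ℝ)
    (u : EuclideanSpace ℝ (Fin n) → ℂ) (x ξ : EuclideanSpace ℝ (Fin n)) : ℂ :=
  Complex.exp (Complex.I * (φ x ξ : ℂ)) * a x ξ * fourierHat u ξ

/-- The Fourier integral operator
`T_{a,φ} u (x) = (2π)^{-n} ∫ e^{i φ(x, ξ)} a(x, ξ) û(ξ) dξ`. -/
def fourierIntegralOperator {n : ℕ}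
    (a : EuclideanSpace ℝ (Fin n) → EuclideanSpace ℝ (Fin n) → ℂ)
    (φ : EuclideanSpace ℝ (Fin n) → EuclideanSpace ℝ (Fin n) → ℝ)
    (u : EuclideanSpace ℝ (Fin n) → ℂ) (x : EuclideanSpace ℝ (Fin n)) : ℂ :=
  (((2 * Real.pi) ^ n : ℝ) : ℂ)⁻¹ * ∫ ξ, fioIntegrand a φ u x ξ

end

/-! The kernel of `T` is estimated frequency by frequency. No regularity in `x` is available or
needed: after linearising the phase at a direction `ζ`, a piece of the operator is bounded pointwise
by `∫ |u(y)| H(p(x) - y) dy` with `p(x) = ∇_ξ φ(x, ζ)` and an explicit integrable `H`. The map `p`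
expands distances, so it pushes Lebesgue measure forward to at most a multiple of Lebesgue measure
(`exists_lintegral_comp_le_of_expanding`), and the `L¹` norm of the piece is at most a constant
times `‖H‖₁ ‖u‖₁`.

High frequencies, `|ξ| ~ l ≥ 1`: as in the decomposition of Seeger, Sogge and Stein, directions are
localised to aperture `δ = l^{-1/2}`, here with a continuous average over `ζ` in a shell around the
sphere (`enorm_integral_le_of_direction_partition`). In coordinates of length `l` along `ζ` and `lδ`
across it, the phase minus its linearisation has bounded derivatives: by homogeneity and Taylor
expansion to second order it has size `l δ² = 1`, and only derivatives of `φ` of order at least two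
enter. Each derivative of the amplitude costs `l^{1-ρ}` (`exists_derivBound_highSymbol`), so `n + 1`
integrations by parts give `‖H‖₁ ≲ l^{m + n(1-ρ)}`. The average over directions costs `δ^{-n}`, and
the shell has volume `~ δ`, which leaves `l^{(n-1)/2}`. The total exponent is negative by the
hypothesis on `m`, so the dyadic sum converges (`exists_high_piece_bound`).

Low frequencies: one fixed direction `ζ` suffices. The linearised operator with symbol `aΨ` is a
single packet. The error carries `e^{iθ} - 1`, where `θ` is homogeneous of degree one with bounded
gradient, so at `|ξ| ~ l ≤ 1` it is of size `l` (`exists_derivBound_lowSymbol`), again summable.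
This needs `∇φ(x, ξ) - ∇φ(x, ζ)` bounded: for `n ≥ 2` by integrating the Hessian along paths off the
origin (`HomogeneousPhase.norm_fderiv_sub_le`), for `n = 1` by the extra hypothesis. -/

/-! ### Uniform derivative bounds on open sets -/

/-- `f` is `C^N` on `U` and `‖D^k f‖ ≤ C μ^k` there for all `k ≤ N`. -/
def DerivBound {E F : Type*} [NormedAddCommGroup E] [NormedSpace ℝ E] [NormedAddCommGroup F]
    [NormedSpace ℝ F] (N : ℕ) (U : Set E) (C μ : ℝ) (f : E → F) : Prop :=
  ContDiffOn ℝ N f U ∧ ∀ k ≤ N, ∀ s ∈ U, ‖iteratedFDerivWithin ℝ k f U s‖ ≤ C * μ ^ k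

namespace DerivBound

section

variable {E F G : Type*} [NormedAddCommGroup E] [NormedSpace ℝ E] [NormedAddCommGroup F]
  [NormedSpace ℝ F] [NormedAddCommGroup G] [NormedSpace ℝ G] {N : ℕ} {U : Set E} {C C' μ μ' : ℝ}
  {f g : E → F}

theorem norm_le (h : DerivBound N U C μ f) {s : E} (hs : s ∈ U) : ‖f s‖ ≤ C := by
  simpa using h.2 0 (Nat.zero_le _) s hs

theorem mono_const (h : DerivBound N U C μ f) (hμ : 0 ≤ μ) (hC : C ≤ C') :
    DerivBound N U C' μ f :=
  ⟨h.1, fun k hk s hs => (h.2 k hk s hs).trans (by gcongr)⟩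

theorem mono_scale (h : DerivBound N U C μ f) (hC : 0 ≤ C) (hμ : 0 ≤ μ) (hμ' : μ ≤ μ') :
    DerivBound N U C μ' f :=
  ⟨h.1, fun k hk s hs => (h.2 k hk s hs).trans (by gcongr)⟩

theorem congr (h : DerivBound N U C μ f) (hfg : Set.EqOn g f U) : DerivBound N U C μ g :=
  ⟨h.1.congr hfg, fun k hk s hs => by
    rw [iteratedFDerivWithin_congr hfg hs]; exact h.2 k hk s hs⟩

theorem mono_set {V : Set E} (h : DerivBound N U C μ f) (hU : IsOpen U) (hV : IsOpen V)
    (hVU : V ⊆ U) : DerivBound N V C μ f :=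
  ⟨h.1.mono hVU, fun k hk s hs => by
    have := h.2 k hk s (hVU hs)
    rwa [iteratedFDerivWithin_of_isOpen k hU (hVU hs),
      ← iteratedFDerivWithin_of_isOpen k hV hs] at this⟩

theorem of_contDiffOn (hU : IsOpen U) (hf : ContDiffOn ℝ N f U)
    (h : ∀ k ≤ N, ∀ s ∈ U, ‖iteratedFDeriv ℝ k f s‖ ≤ C * μ ^ k) : DerivBound N U C μ f :=
  ⟨hf, fun k hk s hs => by rw [iteratedFDerivWithin_of_isOpen k hU hs]; exact h k hk s hs⟩

theorem norm_iteratedFDeriv_le (h : DerivBound N U C μ f) (hU : IsOpen U) {k : ℕ} (hk : k ≤ N)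
    {s : E} (hs : s ∈ U) : ‖iteratedFDeriv ℝ k f s‖ ≤ C * μ ^ k := by
  rw [← iteratedFDerivWithin_of_isOpen k hU hs]; exact h.2 k hk s hs

/-- With geometric bounds `C μ ^ k` the Leibniz sum is exactly the binomial expansion of `(μ + μ') ^
k`: constants multiply and scales add, with no loss. -/
theorem smul {φ : E → ℝ} (hφ : DerivBound N U C μ φ) (hf : DerivBound N U C' μ' f)
    (hU : IsOpen U) :
    DerivBound N U (C * C') (μ + μ') (fun s => φ s • f s) := by
  refine ⟨hφ.1.smul hf.1, fun k hk s hs => ?_⟩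
  refine (norm_iteratedFDerivWithin_smul_le (N := N) hφ.1 hf.1 hU.uniqueDiffOn hs
    (by exact_mod_cast hk)).trans ?_
  rw [add_pow, Finset.mul_sum]
  refine Finset.sum_le_sum fun i hi => ?_
  have hi' : i ≤ k := Nat.lt_succ_iff.mp (Finset.mem_range.mp hi)
  have h1 := hφ.2 i (hi'.trans hk) s hs
  have h2 := hf.2 (k - i) ((Nat.sub_le _ _).trans hk) s hs
  have h3 := mul_le_mul h1 h2 (norm_nonneg _) ((norm_nonneg _).trans h1)
  calc _ = (k.choose i : ℝ) * (‖iteratedFDerivWithin ℝ i φ U s‖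
          * ‖iteratedFDerivWithin ℝ (k - i) f U s‖) := by ring
    _ ≤ (k.choose i : ℝ) * (C * μ ^ i * (C' * μ' ^ (k - i))) := by gcongr
    _ = _ := by ring

theorem mul {A : Type*} [NormedRing A] [NormedAlgebra ℝ A] {f g : E → A}
    (hf : DerivBound N U C μ f) (hg : DerivBound N U C' μ' g) (hU : IsOpen U) :
    DerivBound N U (C * C') (μ + μ') (fun s => f s * g s) := by
  refine ⟨hf.1.mul hg.1, fun k hk s hs => ?_⟩
  refine (norm_iteratedFDerivWithin_mul_le (N := N) hf.1 hg.1 hU.uniqueDiffOn hs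
    (by exact_mod_cast hk)).trans ?_
  rw [add_pow, Finset.mul_sum]
  refine Finset.sum_le_sum fun i hi => ?_
  have hi' : i ≤ k := Nat.lt_succ_iff.mp (Finset.mem_range.mp hi)
  have h1 := hf.2 i (hi'.trans hk) s hs
  have h2 := hg.2 (k - i) ((Nat.sub_le _ _).trans hk) s hs
  have h3 := mul_le_mul h1 h2 (norm_nonneg _) ((norm_nonneg _).trans h1)
  calc _ = (k.choose i : ℝ) * (‖iteratedFDerivWithin ℝ i f U s‖
          * ‖iteratedFDerivWithin ℝ (k - i) g U s‖) := by ring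
    _ ≤ (k.choose i : ℝ) * (C * μ ^ i * (C' * μ' ^ (k - i))) := by gcongr
    _ = _ := by ring

/-- Composition: the inner function only needs bounds on derivatives of positive order. -/
theorem comp_of_pos {g : F → G} {V : Set F} {D : ℝ} (hg : DerivBound N V C 1 g)
    (hV : IsOpen V) (hU : IsOpen U) (hf : ContDiffOn ℝ N f U)
    (hD : ∀ k, 1 ≤ k → k ≤ N → ∀ s ∈ U, ‖iteratedFDerivWithin ℝ k f U s‖ ≤ D ^ k)
    (hC : 0 ≤ C) (hD0 : 0 ≤ D) (hm : Set.MapsTo f U V) :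
    DerivBound N U (N.factorial * C) D (fun s => g (f s)) := by
  refine ⟨hg.1.comp hf hm, fun k hk s hs => ?_⟩
  have h := norm_iteratedFDerivWithin_comp_le (N := N) (n := k) hg.1 hf (by exact_mod_cast hk)
    hV.uniqueDiffOn hU.uniqueDiffOn hm hs (C := C) (D := D)
    (fun i hi => by simpa using hg.2 i (hi.trans hk) _ (hm hs))
    (fun i hi1 hi => hD i hi1 (hi.trans hk) s hs)
  refine h.trans ?_
  gcongr

/-- The bound for compositions allows no prefactor on the inner derivatives. Since `C' ≤ (max 1 C')
^ k` for `k ≥ 1`, the prefactor is absorbed into the scale. -/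
theorem comp {g : F → G} {V : Set F} (hg : DerivBound N V C 1 g)
    (hV : IsOpen V) (hU : IsOpen U) (hf : DerivBound N U C' μ f) (hμ : 0 ≤ μ)
    (hC : 0 ≤ C) (hm : Set.MapsTo f U V) :
    DerivBound N U (N.factorial * C) (max 1 C' * μ) (fun s => g (f s)) := by
  refine hg.comp_of_pos hV hU hf.1 (fun k hk1 hk s hs => ?_) hC (by positivity) hm
  refine (hf.2 k hk s hs).trans ?_
  rw [mul_pow]
  gcongr
  exact (le_max_right 1 C').trans (le_self_pow₀ (le_max_left _ _) (by omega))

theorem const (c : F) (hμ : 0 ≤ μ) (hU : IsOpen U) : DerivBound N U ‖c‖ μ (fun _ : E => c) := by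
  refine of_contDiffOn hU contDiffOn_const fun k hk s hs => ?_
  rcases Nat.eq_zero_or_pos k with rfl | h
  · simp
  · rw [iteratedFDeriv_const_of_ne h.ne']
    simp only [Pi.zero_apply, norm_zero]; positivity

/-- A continuous linear map composed with a smooth function on the right. -/
theorem comp_clm {g : F → G} {V : Set F} (hg : DerivBound N V C μ g) (hV : IsOpen V)
    (hU : IsOpen U) (L : E →L[ℝ] F) (hm : Set.MapsTo L U V) {K : ℝ} (hK : ‖L‖ ≤ K) (hμ : 0 ≤ μ)
    (hC : 0 ≤ C) :
    DerivBound N U C (μ * K) (fun s => g (L s)) := by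
  have hK0 : 0 ≤ K := (norm_nonneg _).trans hK
  refine ⟨hg.1.comp L.contDiff.contDiffOn hm, fun k hk s hs => ?_⟩
  have hpre : IsOpen (L ⁻¹' V) := hV.preimage L.continuous
  have h := L.iteratedFDerivWithin_comp_right (i := k) hg.1 hV.uniqueDiffOn hpre.uniqueDiffOn
    (hm hs) (by exact_mod_cast hk)
  have h2 : iteratedFDerivWithin ℝ k (fun s => g (L s)) U s
      = iteratedFDerivWithin ℝ k (g ∘ L) (L ⁻¹' V) s := by
    rw [iteratedFDerivWithin_of_isOpen k hU hs, iteratedFDerivWithin_of_isOpen k hpre (hm hs)]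
    rfl
  rw [h2, h]
  refine (ContinuousMultilinearMap.norm_compContinuousLinearMap_le _ _).trans ?_
  simp only [Finset.prod_const, Finset.card_univ, Fintype.card_fin]
  calc _ ≤ C * μ ^ k * K ^ k := by
        gcongr
        exact hg.2 k hk _ (hm hs)
    _ = _ := by ring

/-- A linear map is bounded with its derivatives on a bounded set. -/
theorem clm (L : E →L[ℝ] F) (hU : IsOpen U) (hL : ‖L‖ ≤ C) (hC : ∀ s ∈ U, ‖L s‖ ≤ C) :
    DerivBound N U C 1 (fun s => L s) := by
  refine of_contDiffOn hU L.contDiff.contDiffOn fun k hk s hs => ?_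
  have h0 : 0 ≤ C := (norm_nonneg _).trans hL
  match k with
  | 0 => simpa using hC s hs
  | 1 =>
    rw [norm_iteratedFDeriv_one, one_pow, mul_one]
    simpa using hL
  | k + 2 =>
    rw [← norm_iteratedFDeriv_fderiv, ← norm_iteratedFDeriv_fderiv]
    have : fderiv ℝ (fderiv ℝ fun s => L s) = fun _ => 0 := by
      have h1 : (fderiv ℝ fun s => L s) = fun _ => L := by ext1 s; exact L.fderiv
      rw [h1]; ext1 s; simp
    rw [this]
    rw [iteratedFDeriv_fun_zero]
    simp only [Pi.zero_apply, norm_zero]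
    positivity

/-- A smooth function has bounded derivatives on a relatively compact open subset. -/
theorem of_compact {O K : Set E} (hO : IsOpen O) (hf : ContDiffOn ℝ N f O) (hK : IsCompact K)
    (hKO : K ⊆ O) : ∃ C, 0 ≤ C ∧ ∀ U : Set E, IsOpen U → U ⊆ K → DerivBound N U C 1 f := by
  have h : ∀ k : ℕ, ∃ C, 0 ≤ C ∧ (k ≤ N → ∀ s ∈ K, ‖iteratedFDeriv ℝ k f s‖ ≤ C) := by
    intro k
    by_cases hk : k ≤ N
    · have hc : ContinuousOn (iteratedFDeriv ℝ k f) O :=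
        (hf.continuousOn_iteratedFDerivWithin (m := k) (by exact_mod_cast hk)
          hO.uniqueDiffOn).congr fun s hs => (iteratedFDerivWithin_of_isOpen k hO hs).symm
      obtain ⟨C, hC⟩ := hK.exists_bound_of_continuousOn (hc.mono hKO)
      exact ⟨max C 0, le_max_right _ _, fun _ s hs => (hC s hs).trans (le_max_left _ _)⟩
    · exact ⟨0, le_rfl, fun h => absurd h hk⟩
  choose C hC0 hC using h
  refine ⟨∑ k ∈ Finset.range (N + 1), C k, Finset.sum_nonneg fun i _ => hC0 i,
    fun U hU hUK => of_contDiffOn hU (hf.mono (hUK.trans hKO)) fun k hk s hs => ?_⟩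
  rw [one_pow, mul_one]
  refine (hC k hk s (hUK hs)).trans ?_
  exact Finset.single_le_sum (f := C) (fun i _ => hC0 i) (Finset.mem_range.mpr (by omega))

/-- A smooth compactly supported function has bounded derivatives. -/
theorem of_hasCompactSupport (hf : ContDiff ℝ N f) (hs : HasCompactSupport f) :
    ∃ C, 0 ≤ C ∧ DerivBound N Set.univ C 1 f := by
  have h : ∀ k : ℕ, ∃ C, 0 ≤ C ∧ (k ≤ N → ∀ s, ‖iteratedFDeriv ℝ k f s‖ ≤ C) := by
    intro k
    by_cases hk : k ≤ N
    · obtain ⟨C, hC⟩ := (hf.continuous_iteratedFDeriv (m := k)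
        (by exact_mod_cast hk)).bounded_above_of_compact_support (hs.iteratedFDeriv k)
      exact ⟨max C 0, le_max_right _ _, fun _ s => (hC s).trans (le_max_left _ _)⟩
    · exact ⟨0, le_rfl, fun h => absurd h hk⟩
  choose C hC0 hC using h
  refine ⟨∑ k ∈ Finset.range (N + 1), C k, Finset.sum_nonneg fun i _ => hC0 i,
    of_contDiffOn isOpen_univ hf.contDiffOn fun k hk s _ => ?_⟩
  rw [one_pow, mul_one]
  refine (hC k hk s).trans ?_
  exact Finset.single_le_sum (f := C) (fun i _ => hC0 i) (Finset.mem_range.mpr (by omega))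

/-- Extension by zero. -/
theorem extend (h : DerivBound N U C μ f) (hU : IsOpen U) {K : Set E} (hK : IsClosed K)
    (hKU : K ⊆ U) (h0 : ∀ s ∉ K, f s = 0) (hC : 0 ≤ C) (hμ : 0 ≤ μ) :
    DerivBound N Set.univ C μ f := by
  have hz : ∀ s ∉ U, f =ᶠ[nhds s] fun _ => 0 := fun s hs =>
    Filter.eventually_of_mem (hK.isOpen_compl.mem_nhds fun h => hs (hKU h)) h0
  refine of_contDiffOn isOpen_univ (contDiff_iff_contDiffAt.mpr fun s => ?_).contDiffOn
    fun k hk s _ => ?_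
  · by_cases hs : s ∈ U
    · exact (h.1 s hs).contDiffAt (hU.mem_nhds hs)
    · exact contDiffAt_const.congr_of_eventuallyEq (hz s hs)
  · by_cases hs : s ∈ U
    · exact h.norm_iteratedFDeriv_le hU hk hs
    · rw [((hz s hs).iteratedFDeriv ℝ k).self_of_nhds]
      have := (const (N := N) (μ := μ) (0 : F) hμ
        (isOpen_univ (X := E))).norm_iteratedFDeriv_le isOpen_univ hk (Set.mem_univ s)
      rw [norm_zero, zero_mul] at this
      exact this.trans (by positivity)

/-- Used for the phase with its linear part removed, whose gradient is the quantity that can be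
estimated. -/
theorem succ_of_fderiv (hU : IsOpen U) (hf : ContDiffOn ℝ ((N : ℕ) + 1 : ℕ) f U)
    (h0 : ∀ s ∈ U, ‖f s‖ ≤ C) (h1 : DerivBound N U C 1 (fderiv ℝ f)) :
    DerivBound (N + 1) U C 1 f := by
  refine of_contDiffOn hU hf fun k hk s hs => ?_
  match k with
  | 0 => simpa using h0 s hs
  | k + 1 =>
    rw [← norm_iteratedFDeriv_fderiv]
    simpa using h1.norm_iteratedFDeriv_le hU (by omega) hs

/-- Rescaled increments of a function whose derivatives of positive order are bounded. -/
theorem rescaled_increment {h : E → F} {Ω V : Set E} {A R δ : ℝ} {ζ : E} (hΩ : IsOpen Ω)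
    (hconv : Convex ℝ Ω) (hh : ContDiffOn ℝ N h Ω) (hN : 1 ≤ N)
    (hA : ∀ k, 1 ≤ k → k ≤ N → ∀ v ∈ Ω, ‖iteratedFDeriv ℝ k h v‖ ≤ A) (hA0 : 0 ≤ A)
    (hδ : 0 < δ) (hδ1 : δ ≤ 1) (hζ : ζ ∈ Ω) (hV : IsOpen V)
    (hVΩ : ∀ w ∈ V, ζ + δ • w ∈ Ω) (hVR : ∀ w ∈ V, ‖w‖ ≤ R) (hR : 1 ≤ R) :
    DerivBound N V (N.factorial * (A * R)) 1 (fun w => δ⁻¹ • (h (ζ + δ • w) - h ζ)) := by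
  have hdiff : DifferentiableOn ℝ h Ω := hh.differentiableOn (by exact_mod_cast (by omega : N ≠ 0))
  -- Order zero gains its factor `δ` from the mean value inequality, which is where convexity of `Ω`
  -- enters. For positive orders the chain rule gives `δ ^ k ≤ δ`. Either gain pays for the
  -- prefactor `δ⁻¹`.
  have hmv : ∀ v ∈ Ω, ‖h v - h ζ‖ ≤ A * ‖v - ζ‖ := fun v hv =>
    hconv.norm_image_sub_le_of_norm_fderiv_le
      (fun x hx => (hdiff x hx).differentiableAt (hΩ.mem_nhds hx))
      (fun x hx => by rw [← norm_iteratedFDeriv_one]; exact hA 1 le_rfl hN x hx) hζ hv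
  have hnorm : ∀ w ∈ V, ‖h (ζ + δ • w) - h ζ‖ ≤ δ * (A * R) := fun w hw => by
    refine (hmv _ (hVΩ w hw)).trans ?_
    rw [add_sub_cancel_left, norm_smul, Real.norm_of_nonneg hδ.le]
    have := hVR w hw
    calc _ = δ * (A * ‖w‖) := by ring
      _ ≤ _ := by gcongr
  have hAR : 0 ≤ A * R := by positivity
  have hAAR : A ≤ A * R := le_mul_of_one_le_right hA0 hR
  have hfac : (1 : ℝ) ≤ N.factorial := by exact_mod_cast N.factorial_pos
  have hcd : ContDiffOn ℝ N (fun w => δ⁻¹ • (h (ζ + δ • w) - h ζ)) V := by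
    refine ContDiffOn.const_smul _ (ContDiffOn.sub (hh.comp ?_ hVΩ) contDiffOn_const)
    fun_prop
  refine ⟨hcd, fun k hk w hw => ?_⟩
  rw [one_pow, mul_one]
  rcases Nat.eq_zero_or_pos k with rfl | hk1
  · simp only [norm_iteratedFDerivWithin_zero]
    rw [norm_smul, norm_inv, Real.norm_of_nonneg hδ.le, inv_mul_le_iff₀ hδ]
    refine (hnorm w hw).trans ?_
    exact mul_le_mul_of_nonneg_left (le_mul_of_one_le_left hAR hfac) hδ.le
  · have hin : ∀ i, 1 ≤ i → i ≤ k →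
        ‖iteratedFDerivWithin ℝ i (fun w : E => ζ + δ • w) V w‖ ≤ δ ^ i := by
      intro i hi1 hik
      rw [iteratedFDerivWithin_of_isOpen i hV hw]
      match i with
      | i + 1 =>
        rw [← norm_iteratedFDeriv_fderiv]
        have hfd : fderiv ℝ (fun w : E => ζ + δ • w) = fun _ => δ • ContinuousLinearMap.id ℝ E := by
          ext1 v
          have : HasFDerivAt (fun w : E => ζ + δ • w) (δ • ContinuousLinearMap.id ℝ E) v :=
            ((hasFDerivAt_id v).const_smul δ).const_add ζ
          exact this.fderiv
        rw [hfd]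
        rcases Nat.eq_zero_or_pos i with rfl | hi
        · rw [norm_iteratedFDeriv_zero, zero_add, pow_one, norm_smul, Real.norm_of_nonneg hδ.le]
          exact mul_le_of_le_one_right hδ.le ContinuousLinearMap.norm_id_le
        · rw [iteratedFDeriv_const_of_ne hi.ne']
          simp only [Pi.zero_apply, norm_zero]; positivity
    -- Subtracting `h ζ` makes order zero small near `ζ`, although `h` itself is not assumed
    -- bounded; positive orders do not see the constant.
    have hout : ∀ i, i ≤ k →
        ‖iteratedFDerivWithin ℝ i (fun v => h v - h ζ) Ω (ζ + δ • w)‖ ≤ A * R := by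
      intro i hik
      rcases Nat.eq_zero_or_pos i with rfl | hi
      · rw [norm_iteratedFDerivWithin_zero]
        exact (hnorm w hw).trans (mul_le_of_le_one_left hAR hδ1)
      · have hmem := hVΩ w hw
        have hci : ContDiffAt ℝ i h (ζ + δ • w) :=
          ((hh _ hmem).contDiffAt (hΩ.mem_nhds hmem)).of_le (by exact_mod_cast hik.trans hk)
        rw [iteratedFDerivWithin_of_isOpen i hΩ hmem]
        have h1 := fun_iteratedFDeriv_sub_apply (i := i) hci (contDiffAt_const (c := h ζ))
        rw [h1, iteratedFDeriv_const_of_ne hi.ne']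
        simp only [Pi.zero_apply, sub_zero]
        exact (hA i hi (hik.trans hk) _ hmem).trans hAAR
    have hcomp := norm_iteratedFDerivWithin_comp_le (N := N) (n := k) (g := fun v => h v - h ζ)
      (f := fun w : E => ζ + δ • w) (s := V) (t := Ω) (hh.sub contDiffOn_const)
      (by fun_prop) (by exact_mod_cast hk) hΩ.uniqueDiffOn hV.uniqueDiffOn hVΩ hw hout hin
    have h2 : iteratedFDerivWithin ℝ k (fun w => δ⁻¹ • (h (ζ + δ • w) - h ζ)) V w
        = δ⁻¹ • iteratedFDerivWithin ℝ k ((fun v => h v - h ζ) ∘ fun w : E => ζ + δ • w) V w := by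
      have hc : ContDiffOn ℝ N (fun w : E => ζ + δ • w) V := by fun_prop
      have hc2 : ContDiffWithinAt ℝ k ((fun v => h v - h ζ) ∘ fun w : E => ζ + δ • w) V w :=
        (((hh.comp hc hVΩ).sub contDiffOn_const) w hw).of_le (by exact_mod_cast hk)
      exact iteratedFDerivWithin_const_smul_apply (a := δ⁻¹) hc2 hV.uniqueDiffOn hw
    rw [h2, norm_smul, norm_inv, Real.norm_of_nonneg hδ.le, inv_mul_le_iff₀ hδ]
    refine hcomp.trans ?_
    have hδk : δ ^ k ≤ δ := pow_le_of_le_one hδ.le hδ1 (by omega)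
    have hfk : (k.factorial : ℝ) ≤ N.factorial := by exact_mod_cast Nat.factorial_le hk
    calc (k.factorial : ℝ) * (A * R) * δ ^ k ≤ N.factorial * (A * R) * δ := by gcongr
      _ = _ := by ring

end

end DerivBound

/-! ### Wave packets: Fourier decay and kernel estimates -/

section

open scoped FourierTransform

variable {V : Type*} [NormedAddCommGroup V] [InnerProductSpace ℝ V] [FiniteDimensional ℝ V]
  [MeasurableSpace V] [BorelSpace V]

theorem one_add_pow_le_two_pow_mul (N : ℕ) {t : ℝ} (ht : 0 ≤ t) :
    (1 + t) ^ N ≤ 2 ^ N * (1 + t ^ N) := by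
  rcases le_total t 1 with h | h
  · calc (1 + t) ^ N ≤ 2 ^ N := by gcongr; linarith
      _ ≤ 2 ^ N * (1 + t ^ N) := le_mul_of_one_le_right (by positivity) (by
          have := pow_nonneg ht N; linarith)
  · calc (1 + t) ^ N ≤ (2 * t) ^ N := by gcongr; linarith
      _ = 2 ^ N * t ^ N := mul_pow _ _ _
      _ ≤ _ := by gcongr; linarith

theorem DerivBound.integral_norm_le {N : ℕ} {M μ R : ℝ} {B : V → ℂ}
    (hB : DerivBound N Set.univ M μ B)
    (hsupp : ∀ s ∉ Metric.closedBall (0 : V) R, B s = 0) {k : ℕ} (hk : k ≤ N) :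
    Integrable (fun s => ‖iteratedFDeriv ℝ k B s‖) ∧
      ∫ s, ‖iteratedFDeriv ℝ k B s‖ ≤
        M * μ ^ k * volume.real (Metric.closedBall (0 : V) R) := by
  have hcd : ContDiff ℝ N B := contDiffOn_univ.mp hB.1
  have hcs : HasCompactSupport B :=
    HasCompactSupport.intro (isCompact_closedBall (0 : V) R) hsupp
  have hcont := hcd.continuous_iteratedFDeriv (m := k) (by exact_mod_cast hk)
  have hint : Integrable (fun s => ‖iteratedFDeriv ℝ k B s‖) :=
    hcont.norm.integrable_of_hasCompactSupport (hcs.iteratedFDeriv k).norm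
  refine ⟨hint, ?_⟩
  have hz : ∀ s ∉ Metric.closedBall (0 : V) R, ‖iteratedFDeriv ℝ k B s‖ = 0 := by
    intro s hs
    have h1 : B =ᶠ[nhds s] fun _ => 0 :=
      Filter.eventually_of_mem (Metric.isClosed_closedBall.isOpen_compl.mem_nhds hs) hsupp
    rw [(h1.iteratedFDeriv ℝ k).self_of_nhds, iteratedFDeriv_fun_zero]
    simp
  rw [← setIntegral_eq_integral_of_forall_compl_eq_zero hz]
  have := norm_setIntegral_le_of_norm_le_const (μ := volume) (s := Metric.closedBall (0 : V) R)
    (f := fun s => ‖iteratedFDeriv ℝ k B s‖) (C := M * μ ^ k) measure_closedBall_lt_top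
    (fun s _ => by
      rw [norm_norm]; exact hB.norm_iteratedFDeriv_le isOpen_univ hk (Set.mem_univ s))
  exact (Real.le_norm_self _).trans this

/-- Integration by parts `N` times, uniformly over all `B` with the same support ball. A derivative
costs `μ`, so decay is measured in `‖w‖ / μ`. -/
theorem exists_fourier_decay (V : Type*) [NormedAddCommGroup V] [InnerProductSpace ℝ V]
    [FiniteDimensional ℝ V] [MeasurableSpace V] [BorelSpace V] (N : ℕ) (R : ℝ) :
    ∃ C : ℝ, 0 ≤ C ∧ ∀ (B : V → ℂ) (M μ : ℝ), 0 ≤ M → 1 ≤ μ →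
      DerivBound N Set.univ M μ B → (∀ s ∉ Metric.closedBall (0 : V) R, B s = 0) → ∀ w : V,
      ‖∫ s, Complex.exp (Complex.I * ((inner ℝ w s : ℝ) : ℂ)) * B s‖ * (1 + ‖w‖ / μ) ^ N
        ≤ C * M := by
  set v := volume.real (Metric.closedBall (0 : V) R) with hv
  have hv0 : 0 ≤ v := measureReal_nonneg
  -- A factor `(2π)^N` comes from `‖w‖ = 2π‖w'‖`; `2^N (N + 1)` comes from the Fourier estimate,
  -- whose `N + 1` derivative orders are each bounded by `M μ ^ N v` because `μ ≥ 1`.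
  set c : ℝ := (4 * Real.pi) ^ N * ((N + 1) * v) with hc
  have hc0 : 0 ≤ c := by positivity
  refine ⟨2 ^ N * (v + c), by positivity, fun B M μ hM hμ hB hsupp w => ?_⟩
  have hμ0 : 0 < μ := by linarith
  have hcd : ContDiff ℝ N B := contDiffOn_univ.mp hB.1
  set w' : V := (-(2 * Real.pi)⁻¹ : ℝ) • w with hw'
  have hF : ∫ s, Complex.exp (Complex.I * ((inner ℝ w s : ℝ) : ℂ)) * B s = 𝓕 B w' := by
    rw [Real.fourier_eq']
    congr 1 with s
    rw [smul_eq_mul]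
    congr 2
    rw [hw', inner_smul_right, real_inner_comm]
    have : -2 * Real.pi * (-(2 * Real.pi)⁻¹ * inner ℝ s w) = inner ℝ s w := by
      field_simp
    rw [this, mul_comm]
  rw [hF]
  -- `K := 0` because the Fourier transform itself is not differentiated, so no moments of `B` are
  -- needed.
  have hkey := fun (k : ℕ) (hk : k ≤ N) => Real.pow_mul_norm_iteratedFDeriv_fourier_le
    (K := 0) (N := N) (f := B) (by exact_mod_cast hcd) (fun i j hi hj => by
      have hi0 : i = 0 := by simpa using hi
      subst hi0
      simpa using (hB.integral_norm_le hsupp (by exact_mod_cast hj)).1)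
    (k := 0) (n := k) le_rfl (by exact_mod_cast hk) w'
  have h0 : ‖𝓕 B w'‖ ≤ M * v := by
    have := hkey 0 (Nat.zero_le _)
    simp at this
    refine this.trans ?_
    simpa using (hB.integral_norm_le hsupp (Nat.zero_le _)).2
  have hN : ‖w'‖ ^ N * ‖𝓕 B w'‖ ≤ 2 ^ N * ((N + 1) * (M * μ ^ N * v)) := by
    have h1 := hkey N le_rfl
    rw [norm_iteratedFDeriv_zero] at h1
    refine h1.trans ?_
    rw [pow_zero, one_mul, Nat.cast_zero, mul_zero, zero_add]
    gcongr
    have hcard : ((Finset.range (0 + 1) ×ˢ Finset.range (N + 1)).card : ℝ) = N + 1 := by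
      simp
    rw [← hcard, ← nsmul_eq_mul]
    refine Finset.sum_le_card_nsmul _ _ _ fun p hp => ?_
    rw [Finset.mem_product, Finset.mem_range, Finset.mem_range] at hp
    have hp1 : p.1 = 0 := by omega
    have hp2 : p.2 ≤ N := by omega
    rw [hp1]
    simp only [pow_zero, one_mul]
    refine (hB.integral_norm_le hsupp hp2).2.trans ?_
    gcongr
  have hwn : ‖w‖ = 2 * Real.pi * ‖w'‖ := by
    rw [hw', norm_smul, norm_neg, norm_inv, Real.norm_of_nonneg (by positivity)]
    field_simp
  calc ‖𝓕 B w'‖ * (1 + ‖w‖ / μ) ^ N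
      ≤ ‖𝓕 B w'‖ * (2 ^ N * (1 + (‖w‖ / μ) ^ N)) := by
        gcongr
        exact one_add_pow_le_two_pow_mul N (by positivity)
    _ = 2 ^ N * (‖𝓕 B w'‖ + (2 * Real.pi) ^ N * (‖w'‖ ^ N * ‖𝓕 B w'‖) / μ ^ N) := by
        rw [hwn, div_pow, mul_pow]; ring
    _ ≤ 2 ^ N * (M * v + (2 * Real.pi) ^ N * (2 ^ N * ((N + 1) * (M * μ ^ N * v))) / μ ^ N) := by
        gcongr
    _ = 2 ^ N * (v + c) * M := by
        rw [hc, show (4 * Real.pi : ℝ) = 2 * Real.pi * 2 by ring, mul_pow (2 * Real.pi)]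
        field_simp

/-! ### Linear changes of variables and integrability of packet kernels -/

theorem integral_comp_linearMap {L : V →ₗ[ℝ] V} (hL : LinearMap.det L ≠ 0) (f : V → ℂ) :
    ∫ ξ, f ξ = (|LinearMap.det L| : ℝ) • ∫ s, f (L s) := by
  have he : MeasurableEmbedding L := by
    have := (LinearMap.equivOfDetNeZero L hL).toContinuousLinearEquiv.toHomeomorph.measurableEmbedding
    exact this
  have h1 := he.integral_map (μ := volume) f
  rw [Measure.map_linearMap_addHaar_eq_smul_addHaar volume hL, integral_smul_measure] at h1
  rw [← h1, ENNReal.toReal_ofReal (abs_nonneg _), smul_smul, abs_inv,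
    mul_inv_cancel₀ (abs_ne_zero.mpr hL), one_smul]

theorem lintegral_comp_linearMap {L : V →ₗ[ℝ] V} (hL : LinearMap.det L ≠ 0) (f : V → ENNReal) :
    ENNReal.ofReal |LinearMap.det L| * ∫⁻ z, f (L z) = ∫⁻ z, f z := by
  have he : MeasurableEmbedding L := by
    have := (LinearMap.equivOfDetNeZero L hL).toContinuousLinearEquiv.toHomeomorph.measurableEmbedding
    exact this
  have h1 := he.lintegral_map (μ := volume) f
  rw [Measure.map_linearMap_addHaar_eq_smul_addHaar volume hL, lintegral_smul_measure] at h1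
  rw [← h1, smul_eq_mul, ← mul_assoc, ← ENNReal.ofReal_mul (abs_nonneg _), abs_inv,
    mul_inv_cancel₀ (abs_ne_zero.mpr hL), ENNReal.ofReal_one, one_mul]

/-- The size of the kernel of a wave packet. -/
noncomputable def packetKernel (L : V →ₗ[ℝ] V) (N : ℕ) (K μ : ℝ) (z : V) : ENNReal :=
  ENNReal.ofReal (|LinearMap.det L| * K * ((1 + ‖L z‖ / μ) ^ N)⁻¹)

theorem measurable_packetKernel (L : V →ₗ[ℝ] V) (N : ℕ) (K μ : ℝ) :
    Measurable (packetKernel L N K μ) := by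
  have : Measurable L := L.continuous_of_finiteDimensional.measurable
  unfold packetKernel
  fun_prop

/-- The substitution `z ↦ μ⁻¹ L z` absorbs the determinant and leaves `K μ ^ dim` times the integral
of `(1 + ‖z‖) ^ (-(dim + 1))`. The bound does not depend on `L`, so the anisotropy of a packet costs
nothing in `L¹`. -/
theorem exists_lintegral_packetKernel_le (V : Type*) [NormedAddCommGroup V]
    [InnerProductSpace ℝ V] [FiniteDimensional ℝ V] [MeasurableSpace V] [BorelSpace V] :
    ∃ J : ℝ, 0 ≤ J ∧ ∀ (L : V →ₗ[ℝ] V) (K μ : ℝ), LinearMap.det L ≠ 0 → 0 ≤ K → 0 < μ →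
      ∫⁻ z, packetKernel L (Module.finrank ℝ V + 1) K μ z
        ≤ ENNReal.ofReal (J * (K * μ ^ Module.finrank ℝ V)) := by
  set N := Module.finrank ℝ V + 1 with hN
  have hint : Integrable (fun z : V => ((1 + ‖z‖) ^ N)⁻¹) := by
    have := integrable_one_add_norm (E := V) (μ := volume) (r := N) (by rw [hN]; push_cast; linarith)
    refine this.congr (Filter.Eventually.of_forall fun z => ?_)
    simp only
    rw [Real.rpow_neg (by positivity), Real.rpow_natCast]
  refine ⟨∫ z : V, ((1 + ‖z‖) ^ N)⁻¹, integral_nonneg fun z => by positivity,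
    fun L K μ hL hK hμ => ?_⟩
  set L' : V →ₗ[ℝ] V := μ⁻¹ • L with hL'
  have hdet : LinearMap.det L' = (μ⁻¹) ^ Module.finrank ℝ V * LinearMap.det L := by
    rw [hL', LinearMap.det_smul]
  have hdet0 : LinearMap.det L' ≠ 0 := by
    rw [hdet]; positivity
  have habs : |LinearMap.det L| = |LinearMap.det L'| * μ ^ Module.finrank ℝ V := by
    rw [hdet, abs_mul, abs_of_pos (a := μ⁻¹ ^ _) (by positivity), inv_pow]
    field_simp
  have h1 : ∀ z, packetKernel L N K μ z = ENNReal.ofReal (K * μ ^ Module.finrank ℝ V) *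
      (ENNReal.ofReal |LinearMap.det L'| * ENNReal.ofReal (((1 + ‖L' z‖) ^ N)⁻¹)) := by
    intro z
    rw [packetKernel, ← ENNReal.ofReal_mul (abs_nonneg _), ← ENNReal.ofReal_mul (by positivity),
      habs]
    congr 1
    have : ‖L' z‖ = ‖L z‖ / μ := by
      rw [hL', LinearMap.smul_apply, norm_smul, norm_inv, Real.norm_of_nonneg hμ.le]
      ring
    rw [this]; ring
  simp_rw [h1]
  rw [lintegral_const_mul' _ _ ENNReal.ofReal_ne_top, lintegral_const_mul' _ _ ENNReal.ofReal_ne_top,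
    lintegral_comp_linearMap hdet0 (fun z => ENNReal.ofReal (((1 + ‖z‖) ^ N)⁻¹)),
    ← ofReal_integral_eq_lintegral_ofReal hint (Filter.Eventually.of_forall fun z => by
      simp only [Pi.zero_apply]; positivity), ← ENNReal.ofReal_mul (by positivity)]
  exact ENNReal.ofReal_le_ofReal (by rw [mul_comm])

/-- Pointwise bound for a wave packet applied to `u`. -/
theorem enorm_packet_le {L : V →ₗ[ℝ] V} (hL : LinearMap.det L ≠ 0)
    (hsymm : ∀ x y, inner ℝ (L x) y = inner ℝ x (L y)) {N : ℕ} {K μ : ℝ} (hμ : 0 < μ)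
    {b : V → ℂ} (hb : Integrable b)
    (hK : ∀ w : V, ‖∫ s, Complex.exp (Complex.I * ((inner ℝ w s : ℝ) : ℂ)) * b (L s)‖
      * (1 + ‖w‖ / μ) ^ N ≤ K) {u : V → ℂ} (hu : Integrable u) (p : V) :
    ‖∫ ξ, Complex.exp (Complex.I * ((inner ℝ p ξ : ℝ) : ℂ)) * b ξ *
        ∫ y, Complex.exp (-(Complex.I * ((inner ℝ y ξ : ℝ) : ℂ))) * u y‖ₑ
      ≤ ∫⁻ y, ‖u y‖ₑ * packetKernel L N K μ (p - y) := by
  have hexp : ∀ t : ℝ, ‖Complex.exp (Complex.I * (t : ℂ))‖ = 1 := fun t => by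
    rw [mul_comm]; exact Complex.norm_exp_ofReal_mul_I t
  have h1 : ∀ ξ, Complex.exp (Complex.I * ((inner ℝ p ξ : ℝ) : ℂ)) * b ξ *
        ∫ y, Complex.exp (-(Complex.I * ((inner ℝ y ξ : ℝ) : ℂ))) * u y
      = ∫ y, Complex.exp (Complex.I * ((inner ℝ (p - y) ξ : ℝ) : ℂ)) * (b ξ * u y) := by
    intro ξ
    rw [← integral_const_mul]
    congr 1 with y
    rw [inner_sub_left]
    have : Complex.exp (Complex.I * ((inner ℝ p ξ - inner ℝ y ξ : ℝ) : ℂ))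
        = Complex.exp (Complex.I * ((inner ℝ p ξ : ℝ) : ℂ)) *
          Complex.exp (-(Complex.I * ((inner ℝ y ξ : ℝ) : ℂ))) := by
      rw [← Complex.exp_add]; congr 1; push_cast; ring
    rw [this]; ring
  simp_rw [h1]
  rw [integral_integral_swap]
  swap
  · refine (hb.mul_prod hu).bdd_mul (c := 1) ?_ ?_
    · refine Continuous.aestronglyMeasurable ?_
      fun_prop
    · exact Filter.Eventually.of_forall fun z => (hexp _).le
  refine (enorm_integral_le_lintegral_enorm _).trans (lintegral_mono fun y => ?_)
  -- After `ξ = L s`, self-adjointness moves `L` onto `p - y`, and the integral is the one in `hK`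
  -- at `w = L (p - y)`.
  have h2 : ∫ ξ, Complex.exp (Complex.I * ((inner ℝ (p - y) ξ : ℝ) : ℂ)) * (b ξ * u y)
      = ((|LinearMap.det L| : ℝ) • ∫ s, Complex.exp (Complex.I * ((inner ℝ (L (p - y)) s : ℝ) : ℂ)) *
        b (L s)) * u y := by
    simp_rw [← mul_assoc]
    rw [integral_mul_const, integral_comp_linearMap hL]
    simp_rw [hsymm]
  rw [h2, enorm_mul, mul_comm]
  gcongr
  rw [packetKernel, ← ofReal_norm]
  refine ENNReal.ofReal_le_ofReal ?_
  rw [norm_smul, Real.norm_of_nonneg (abs_nonneg _), mul_assoc]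
  gcongr
  rw [← div_eq_mul_inv, le_div_iff₀ (by positivity)]
  exact hK _

end

/-- Change of variables for maps that expand distances. -/
theorem exists_lintegral_comp_le_of_expanding (n : ℕ) (c : ℝ) (hc : 0 < c) :
    ∃ A : NNReal, ∀ p : EuclideanSpace ℝ (Fin n) → EuclideanSpace ℝ (Fin n), AEMeasurable p volume →
      (∀ x y, c * ‖x - y‖ ≤ ‖p x - p y‖) → ∀ f : EuclideanSpace ℝ (Fin n) → ENNReal, Measurable f →
      ∫⁻ x, f (p x) ≤ A * ∫⁻ z, f z := by
  -- Volume is a multiple of `n`-dimensional Hausdorff measure, by uniqueness of Haar measure.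
  -- Preimages under an antilipschitz map enlarge Hausdorff measure by at most `k ^ n`, so neither
  -- differentiability nor surjectivity of `p` is required.
  obtain ⟨κ, hκ⟩ : ∃ κ : NNReal, (volume : Measure (EuclideanSpace ℝ (Fin n))) =
      κ • μH[(n : ℝ)] :=
    ⟨_, Measure.isAddLeftInvariant_eq_smul volume μH[(n : ℝ)]⟩
  set k : NNReal := ⟨c⁻¹, by positivity⟩ with hk
  refine ⟨k ^ (n : ℝ), fun p hp hpc f hf => ?_⟩
  have hanti : AntilipschitzWith k p := AntilipschitzWith.of_le_mul_dist fun x y => by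
    rw [dist_eq_norm, dist_eq_norm, hk]
    have := hpc x y
    change _ ≤ c⁻¹ * _
    rw [inv_mul_eq_div, le_div_iff₀ hc]; linarith
  have hmap : Measure.map p volume ≤
      ((k ^ (n : ℝ) : NNReal) : ENNReal) • (volume : Measure (EuclideanSpace ℝ (Fin n))) := by
    refine Measure.le_iff.mpr fun s hs => ?_
    rw [Measure.map_apply_of_aemeasurable hp hs, Measure.smul_apply, smul_eq_mul]
    have h := hanti.hausdorffMeasure_preimage_le (d := (n : ℝ)) (by positivity) s
    rw [hκ]
    simp only [Measure.smul_apply]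
    rw [ENNReal.smul_def, ENNReal.smul_def, smul_eq_mul, smul_eq_mul, mul_left_comm]
    gcongr
    rw [ENNReal.coe_rpow_of_nonneg _ (by positivity)]
    exact h
  rw [← lintegral_map' hf.aemeasurable hp]
  calc _ ≤ ∫⁻ z, f z ∂(((k ^ (n : ℝ) : NNReal) : ENNReal) • volume) := lintegral_mono' hmap le_rfl
    _ = _ := by rw [lintegral_smul_measure, smul_eq_mul]

theorem lintegral_lintegral_conv_le {V : Type*} [NormedAddCommGroup V] [InnerProductSpace ℝ V]
    [FiniteDimensional ℝ V] [MeasurableSpace V] [BorelSpace V] {g H : V → ENNReal}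
    (hg : Measurable g) (hH : Measurable H) :
    ∫⁻ z, ∫⁻ y, g y * H (z - y) = (∫⁻ z, H z) * ∫⁻ y, g y := by
  rw [lintegral_lintegral_swap]
  · have : ∀ y, ∫⁻ z, g y * H (z - y) = g y * ∫⁻ z, H z := fun y => by
      rw [lintegral_const_mul _ (by fun_prop), lintegral_sub_right_eq_self (fun z => H z) y]
    simp_rw [this]
    rw [lintegral_mul_const _ hg, mul_comm]
  · refine Measurable.aemeasurable ?_
    simp only [Function.uncurry_def]
    fun_prop

/-! ### Families that are measurable in one variable and continuous in the other -/

section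

variable {X V : Type*} [MeasurableSpace X] {P : Measure X} [TopologicalSpace V]
  [SecondCountableTopology V]

/-- The exceptional null set in the hypothesis depends on `ξ`. Taking the union over a countable
dense set and using continuity makes it independent of `ξ`. -/
theorem ae_forall_le_of_continuousOn {O : Set V} {h : X → V → ℝ} {C : ℝ}
    (hc : ∀ x, ContinuousOn (h x) O) (hb : ∀ ξ ∈ O, ∀ᵐ x ∂P, h x ξ ≤ C) :
    ∀ᵐ x ∂P, ∀ ξ ∈ O, h x ξ ≤ C := by
  obtain ⟨D, hDc, hDd⟩ := TopologicalSpace.exists_countable_dense O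
  have h1 : ∀ᵐ x ∂P, ∀ ξ ∈ D, h x (ξ : V) ≤ C :=
    (ae_ball_iff hDc).mpr fun ξ _ => hb ξ ξ.2
  filter_upwards [h1] with x hx ξ hξ
  have hcl : IsClosed {ξ : O | h x ξ ≤ C} :=
    isClosed_le (continuousOn_iff_continuous_domRestrict.mp (hc x)) continuous_const
  exact hcl.closure_subset_iff.mpr (fun η hη => hx η hη) (hDd ⟨ξ, hξ⟩)

/-- A function measurable in one variable and continuous in the other is jointly measurable.
Measurability holds only almost everywhere here, so the function is corrected off one null set that
serves a countable dense set of `ξ`. -/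
theorem exists_measurable_version {V : Type*} [TopologicalSpace V] [SecondCountableTopology V]
    [TopologicalSpace.MetrizableSpace V] [MeasurableSpace V] [OpensMeasurableSpace V]
    {W : Type*} [NormedAddCommGroup W] [MeasurableSpace W] [BorelSpace W]
    [SecondCountableTopology W] {O : Set V} (hO : IsOpen O) {F : X → V → W}
    (hc : ∀ x, ContinuousOn (F x) O) (hm : ∀ ξ ∈ O, AEMeasurable (fun x => F x ξ) P) :
    ∃ F' : V × X → W, Measurable F' ∧ ∀ᵐ x ∂P, ∀ ξ ∈ O, F' (ξ, x) = F x ξ := by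
  obtain ⟨D, hDc, hDd⟩ := TopologicalSpace.exists_countable_dense O
  have h1 : ∀ᵐ x ∂P, ∀ ξ, ∀ h : ξ ∈ D, F x (ξ : V) = (hm ξ ξ.2).mk _ x :=
    (ae_ball_iff hDc).mpr fun ξ _ => (hm ξ ξ.2).ae_eq_mk
  obtain ⟨t, ht1, ht2, ht3⟩ := exists_measurable_superset_of_null (ae_iff.mp h1)
  set G := tᶜ with hGdef
  have hGm : MeasurableSet G := ht2.compl
  have hG0 : ∀ᵐ x ∂P, x ∈ G := by
    rw [ae_iff]; simpa [hGdef] using ht3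
  have hGsub : ∀ x ∈ G, ∀ ξ, ∀ h : ξ ∈ D, F x (ξ : V) = (hm ξ ξ.2).mk _ x := fun x hx => by
    by_contra hxv
    exact hx (ht1 hxv)
  -- Vanishing off `G` for every `ξ` at once keeps continuity in `ξ` while making the sections over
  -- `D` measurable.
  set u : O → X → W := fun ξ => G.indicator fun x => F x ξ with hu
  have hucont : ∀ x, Continuous fun ξ => u ξ x := fun x => by
    by_cases hx : x ∈ G
    · simp only [hu, Set.indicator_of_mem hx]
      exact continuousOn_iff_continuous_domRestrict.mp (hc x)
    · simp only [hu, Set.indicator_of_notMem hx]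
      exact continuous_const
  have huD : ∀ ξ ∈ D, Measurable (u ξ) := fun ξ hξ => by
    have : u ξ = G.indicator ((hm ξ ξ.2).mk _) :=
      Set.indicator_congr fun x hx => hGsub x hx ξ hξ
    rw [this]
    exact (hm ξ ξ.2).measurable_mk.indicator hGm
  have hum : ∀ ξ, StronglyMeasurable (u ξ) := fun ξ => by
    refine Measurable.stronglyMeasurable ?_
    obtain ⟨s, hs, hlim⟩ := mem_closure_iff_seq_limit.mp (hDd ξ)
    exact measurable_of_tendsto_metrizable (fun k => huD (s k) (hs k))
      (tendsto_pi_nhds.mpr fun x => ((hucont x).tendsto ξ).comp hlim)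
  have hj := stronglyMeasurable_uncurry_of_continuous_of_stronglyMeasurable hucont hum
  have hemb : MeasurableEmbedding (Prod.map (Subtype.val : O → V) (id : X → X)) :=
    (MeasurableEmbedding.subtype_coe hO.measurableSet).prodMap MeasurableEmbedding.id
  obtain ⟨F', hF'm, hF'⟩ := hemb.exists_measurable_extend hj.measurable (fun _ => ⟨0⟩)
  refine ⟨F', hF'm, ?_⟩
  filter_upwards [hG0] with x hx ξ hξ
  have := congrFun hF' (⟨ξ, hξ⟩, x)
  simp only [Function.comp_apply, Prod.map_apply, id_eq, Function.uncurry_apply_pair] at this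
  rw [this, hu]
  simp only [Set.indicator_of_mem hx]

end

/-! ### Phases -/

section

variable {n : ℕ} {φ : EuclideanSpace ℝ (Fin n) → EuclideanSpace ℝ (Fin n) → ℝ}

theorem inner_gradient_eq_fderiv {V : Type*} [NormedAddCommGroup V] [InnerProductSpace ℝ V]
    [CompleteSpace V] (f : V → ℝ) (ξ v : V) :
    inner ℝ (gradient f ξ) v = fderiv ℝ f ξ v := by
  rw [gradient, InnerProductSpace.toDual_symm_apply]

/-- Directional derivatives are sequential limits of difference quotients, and the gradient is
recovered from an orthonormal basis. -/
theorem aemeasurable_gradient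
    (hd : ∀ x, ∀ ξ, ξ ≠ 0 → DifferentiableAt ℝ (φ x) ξ)
    (hm : ∀ ξ, ξ ≠ 0 → AEMeasurable (fun x => φ x ξ) volume)
    {ζ : EuclideanSpace ℝ (Fin n)} (hζ : ζ ≠ 0) :
    AEMeasurable (fun x => gradient (φ x) ζ) volume := by
  have hdir : ∀ v : EuclideanSpace ℝ (Fin n),
      AEMeasurable (fun x => fderiv ℝ (φ x) ζ v) volume := by
    intro v
    have hlim : ∀ x, Filter.Tendsto (fun k : ℕ => (((k : ℝ) + 1)⁻¹)⁻¹ •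
        (φ x (ζ + ((k : ℝ) + 1)⁻¹ • v) - φ x ζ)) Filter.atTop (nhds (fderiv ℝ (φ x) ζ v)) := by
      intro x
      have h1 : HasLineDerivAt ℝ (φ x) (fderiv ℝ (φ x) ζ v) ζ v :=
        (hd x ζ hζ).hasFDerivAt.hasLineDerivAt v
      have h2 := h1.tendsto_slope_zero_right
      have h3 : Filter.Tendsto (fun k : ℕ => ((k : ℝ) + 1)⁻¹) Filter.atTop
          (nhdsWithin 0 (Set.Ioi 0)) := by
        refine tendsto_nhdsWithin_iff.mpr ⟨?_, Filter.Eventually.of_forall fun k => ?_⟩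
        · simpa using tendsto_one_div_add_atTop_nhds_zero_nat (𝕜 := ℝ)
        · exact Set.mem_Ioi.mpr (by positivity)
      exact h2.comp h3
    have hev : ∀ᶠ k : ℕ in Filter.atTop, ζ + ((k : ℝ) + 1)⁻¹ • v ≠ 0 := by
      have h3 : Filter.Tendsto (fun k : ℕ => ζ + ((k : ℝ) + 1)⁻¹ • v) Filter.atTop
          (nhds ζ) := by
        have h4 : Filter.Tendsto (fun k : ℕ => ((k : ℝ) + 1)⁻¹) Filter.atTop (nhds 0) := by
          simpa using tendsto_one_div_add_atTop_nhds_zero_nat (𝕜 := ℝ)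
        simpa using tendsto_const_nhds.add (h4.smul_const v)
      exact h3.eventually_ne hζ
    -- The sequence is started at `K` to keep the evaluation points off the origin, where nothing is
    -- assumed about measurability.
    obtain ⟨K, hK⟩ := Filter.eventually_atTop.mp hev
    refine aemeasurable_of_tendsto_metrizable_ae' (f := fun k x => (((k + K : ℕ) : ℝ) + 1)⁻¹⁻¹ •
        (φ x (ζ + (((k + K : ℕ) : ℝ) + 1)⁻¹ • v) - φ x ζ)) (fun k => ?_)
      (Filter.Eventually.of_forall fun x =>
        (hlim x).comp (Filter.tendsto_add_atTop_nat K))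
    have h5 := (hm _ (hK _ (Nat.le_add_left K k))).sub (hm ζ hζ)
    exact h5.const_smul ((((k + K : ℕ) : ℝ) + 1)⁻¹⁻¹)
  have hrep : (fun x => gradient (φ x) ζ) = fun x => ∑ i,
      (fderiv ℝ (φ x) ζ (EuclideanSpace.basisFun (Fin n) ℝ i)) •
        EuclideanSpace.basisFun (Fin n) ℝ i := by
    ext1 x
    rw [← (EuclideanSpace.basisFun (Fin n) ℝ).sum_repr' (gradient (φ x) ζ)]
    refine Finset.sum_congr rfl fun i _ => ?_
    rw [real_inner_comm, inner_gradient_eq_fderiv]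
  rw [hrep]
  refine Finset.aemeasurable_fun_sum _ fun i _ => ?_
  exact (hdir _).smul_const _

end

/-! ### Homogeneous phases with bounded derivatives of order at least two -/

/-- A function homogeneous of degree one, smooth off the origin, with
`|ξ|^{j-1} ‖D^j f(ξ)‖ ≤ A` for `2 ≤ j ≤ N`. -/
structure HomogeneousPhase {V : Type*} [NormedAddCommGroup V] [NormedSpace ℝ V]
    (N : ℕ) (A : ℝ) (f : V → ℝ) : Prop where
  homogeneous : ∀ ξ, ξ ≠ 0 → ∀ t : ℝ, 0 < t → f (t • ξ) = t * f ξ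
  contDiffOn : ContDiffOn ℝ ∞ f {0}ᶜ
  bound : ∀ j : ℕ, 2 ≤ j → j ≤ N → ∀ ξ, ξ ≠ 0 →
    ‖ξ‖ ^ (-1 + (j : ℤ)) * ‖iteratedFDeriv ℝ j f ξ‖ ≤ A

namespace HomogeneousPhase

variable {V : Type*} [NormedAddCommGroup V] [NormedSpace ℝ V] {N : ℕ} {A : ℝ} {f : V → ℝ}

theorem contDiffAt (hf : HomogeneousPhase N A f) {ξ : V} (hξ : ξ ≠ 0) : ContDiffAt ℝ ∞ f ξ :=
  (hf.contDiffOn ξ hξ).contDiffAt (isOpen_compl_singleton.mem_nhds hξ)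

theorem differentiableAt (hf : HomogeneousPhase N A f) {ξ : V} (hξ : ξ ≠ 0) :
    DifferentiableAt ℝ f ξ :=
  (hf.contDiffAt hξ).differentiableAt (by simp)

theorem contDiffOn_fderiv (hf : HomogeneousPhase N A f) : ContDiffOn ℝ ∞ (fderiv ℝ f) {0}ᶜ :=
  ((contDiffOn_infty_iff_fderiv_of_isOpen isOpen_compl_singleton).mp hf.contDiffOn).2

/-- Euler's identity: the two derivatives of `t ↦ f (t • ξ)` at `t = 1` are compared. It makes the
linearisation of `f` at `ζ` exact along the ray through `ζ`. -/
theorem fderiv_self (hf : HomogeneousPhase N A f) {ξ : V} (hξ : ξ ≠ 0) :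
    fderiv ℝ f ξ ξ = f ξ := by
  have h1 : HasDerivAt (fun t : ℝ => f (t • ξ)) (fderiv ℝ f ξ ξ) 1 := by
    have h2 : HasDerivAt (fun t : ℝ => t • ξ) ξ 1 := by
      simpa using (hasDerivAt_id (1 : ℝ)).smul_const ξ
    have h3 : HasFDerivAt f (fderiv ℝ f ξ) ((1 : ℝ) • ξ) := by
      rw [one_smul]; exact (hf.differentiableAt hξ).hasFDerivAt
    exact h3.comp_hasDerivAt 1 h2
  have h4 : HasDerivAt (fun t : ℝ => f (t • ξ)) (f ξ) 1 := by
    have h5 : HasDerivAt (fun t : ℝ => t * f ξ) (f ξ) 1 := by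
      simpa using (hasDerivAt_id (1 : ℝ)).mul_const (f ξ)
    refine h5.congr_of_eventuallyEq ?_
    filter_upwards [lt_mem_nhds (zero_lt_one (α := ℝ))] with t ht
    exact hf.homogeneous ξ hξ t ht
  exact h1.unique h4

theorem fderiv_smul (hf : HomogeneousPhase N A f) {ξ : V} (hξ : ξ ≠ 0) {t : ℝ} (ht : 0 < t) :
    fderiv ℝ f (t • ξ) = fderiv ℝ f ξ := by
  have h1 : HasFDerivAt (fun η => f (t • η)) (t • fderiv ℝ f (t • ξ)) ξ := by
    have h2 : HasFDerivAt (fun η : V => t • η) (t • ContinuousLinearMap.id ℝ V) ξ :=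
      (hasFDerivAt_id ξ).const_smul t
    have h3 := (hf.differentiableAt (smul_ne_zero ht.ne' hξ)).hasFDerivAt.comp ξ h2
    refine h3.congr_fderiv ?_
    ext v; simp
  have h4 : HasFDerivAt (fun η => f (t • η)) (t • fderiv ℝ f ξ) ξ := by
    refine ((hf.differentiableAt hξ).hasFDerivAt.const_mul t).congr_of_eventuallyEq ?_
    filter_upwards [isOpen_compl_singleton.mem_nhds hξ] with η hη
    exact hf.homogeneous η hη t ht
  have := h1.unique h4
  exact smul_right_injective _ ht.ne' this

/-- Since `r ≤ 1`, the exponent `N` in place of `j - 1` gives one constant for all orders. -/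
theorem norm_iteratedFDeriv_le (hf : HomogeneousPhase N A f) {ξ : V} {r : ℝ} (hr : 0 < r)
    (hr1 : r ≤ 1) (hξ : r ≤ ‖ξ‖) {j : ℕ} (hj : 2 ≤ j) (hjN : j ≤ N) :
    ‖iteratedFDeriv ℝ j f ξ‖ ≤ A * r⁻¹ ^ N := by
  have hξ0 : ξ ≠ 0 := norm_pos_iff.mp (hr.trans_le hξ)
  have h := hf.bound j hj hjN ξ hξ0
  obtain ⟨i, rfl⟩ : ∃ i, j = i + 1 := ⟨j - 1, by omega⟩
  have he : (-1 + ((i + 1 : ℕ) : ℤ)) = (i : ℤ) := by push_cast; ring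
  rw [he, zpow_natCast] at h
  have hA : 0 ≤ A := le_trans (by positivity) h
  have h2 : r ^ i * ‖iteratedFDeriv ℝ (i + 1) f ξ‖ ≤ A := le_trans (by gcongr) h
  have h3 : ‖iteratedFDeriv ℝ (i + 1) f ξ‖ ≤ A * r⁻¹ ^ i := by
    rw [inv_pow, ← div_eq_mul_inv, le_div_iff₀ (by positivity)]; linarith
  refine h3.trans ?_
  gcongr
  · exact (one_le_inv₀ hr).mpr hr1
  · omega

end HomogeneousPhase

/-! ### Derivative bounds for the oscillating exponential and for translates -/

theorem derivBound_exp_I_mul (N : ℕ) :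
    DerivBound N Set.univ 1 1 (fun t : ℝ => Complex.exp (Complex.I * (t : ℂ))) := by
  have hd : ∀ k : ℕ, ContDiff ℝ ∞ (fun t : ℝ => Complex.exp (Complex.I * (t : ℂ))) ∧
      iteratedDeriv k (fun t : ℝ => Complex.exp (Complex.I * (t : ℂ))) =
      fun t : ℝ => Complex.I ^ k * Complex.exp (Complex.I * (t : ℂ)) := by
    intro k
    refine ⟨?_, ?_⟩
    · exact (contDiff_const.mul Complex.ofRealCLM.contDiff).cexp
    · induction k with
      | zero => simp
      | succ k ih =>
        rw [iteratedDeriv_succ, ih]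
        ext1 t
        have h1 : HasDerivAt (fun t : ℝ => Complex.exp (Complex.I * (t : ℂ)))
            (Complex.exp (Complex.I * (t : ℂ)) * (Complex.I * 1)) t :=
          (((hasDerivAt_id t).ofReal_comp).const_mul Complex.I).cexp
        rw [(h1.const_mul (Complex.I ^ k)).deriv]
        ring
  refine DerivBound.of_contDiffOn isOpen_univ ((hd 0).1.of_le (by exact_mod_cast le_top)).contDiffOn
    fun k _ t _ => ?_
  rw [norm_iteratedFDeriv_eq_norm_iteratedDeriv, (hd k).2]
  simp only [norm_mul, norm_pow, Complex.norm_I, one_pow, one_mul]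
  rw [mul_comm, Complex.norm_exp_ofReal_mul_I]

theorem DerivBound.comp_add_const {E F : Type*} [NormedAddCommGroup E] [NormedSpace ℝ E]
    [NormedAddCommGroup F] [NormedSpace ℝ F] {N : ℕ} {C μ : ℝ} {f : E → F}
    (h : DerivBound N Set.univ C μ f) (q : E) :
    DerivBound N Set.univ C μ (fun z => f (z + q)) := by
  have hc : ContDiff ℝ N f := contDiffOn_univ.mp h.1
  refine of_contDiffOn isOpen_univ (hc.comp (contDiff_id.add contDiff_const)).contDiffOn
    fun k hk s _ => ?_
  rw [iteratedFDeriv_comp_add_right]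
  exact h.norm_iteratedFDeriv_le isOpen_univ hk (Set.mem_univ _)

/-! ### Anisotropic coordinates along a direction -/

section

variable {V : Type*} [NormedAddCommGroup V] [InnerProductSpace ℝ V]

/-- The coordinate along `ζ`. -/
noncomputable def axisCoord (ζ : V) : V →L[ℝ] ℝ := (‖ζ‖ ^ 2)⁻¹ • innerSL ℝ ζ

/-- The projection to the complement of `ζ`. -/
noncomputable def axisCompl (ζ : V) : V →L[ℝ] V :=
  ContinuousLinearMap.id ℝ V - (axisCoord ζ).smulRight ζ

/-- `s ↦ s₁ ζ + δ s'` for `s = s₁ ζ + s'`, `s' ⊥ ζ`. -/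
noncomputable def axisScale (ζ : V) (δ : ℝ) : V →L[ℝ] V :=
  (axisCoord ζ).smulRight ζ + δ • axisCompl ζ

theorem axisCoord_apply (ζ s : V) : axisCoord ζ s = (‖ζ‖ ^ 2)⁻¹ * inner ℝ ζ s := rfl

theorem axisCompl_apply (ζ s : V) : axisCompl ζ s = s - axisCoord ζ s • ζ := rfl

theorem axisScale_apply (ζ : V) (δ : ℝ) (s : V) :
    axisScale ζ δ s = axisCoord ζ s • ζ + δ • axisCompl ζ s := rfl

theorem axisCoord_self {ζ : V} (hζ : ζ ≠ 0) : axisCoord ζ ζ = 1 := by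
  rw [axisCoord_apply, real_inner_self_eq_norm_sq, inv_mul_cancel₀]
  exact pow_ne_zero 2 (norm_ne_zero_iff.mpr hζ)

theorem axisCoord_axisCompl {ζ : V} (hζ : ζ ≠ 0) (s : V) : axisCoord ζ (axisCompl ζ s) = 0 := by
  rw [axisCompl_apply, map_sub, map_smul, axisCoord_self hζ, smul_eq_mul, mul_one, sub_self]

theorem inner_axisCompl {ζ : V} (hζ : ζ ≠ 0) (s : V) : inner ℝ ζ (axisCompl ζ s) = 0 := by
  have h := axisCoord_axisCompl hζ s
  rw [axisCoord_apply] at h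
  have h2 : (‖ζ‖ ^ 2)⁻¹ ≠ 0 := inv_ne_zero (pow_ne_zero 2 (norm_ne_zero_iff.mpr hζ))
  exact (mul_eq_zero.mp h).resolve_left h2

theorem axisCompl_self {ζ : V} (hζ : ζ ≠ 0) : axisCompl ζ ζ = 0 := by
  rw [axisCompl_apply, axisCoord_self hζ, one_smul, sub_self]

theorem axisCompl_axisCompl {ζ : V} (hζ : ζ ≠ 0) (s : V) :
    axisCompl ζ (axisCompl ζ s) = axisCompl ζ s := by
  rw [axisCompl_apply ζ (axisCompl ζ s), axisCoord_axisCompl hζ, zero_smul, sub_zero]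

theorem norm_axisCoord_le {ζ : V} (h7 : 7 / 8 ≤ ‖ζ‖) (s : V) : |axisCoord ζ s| ≤ 8 / 7 * ‖s‖ := by
  have hζ : 0 < ‖ζ‖ := by linarith
  rw [axisCoord_apply, abs_mul, abs_of_pos (by positivity)]
  have h := abs_real_inner_le_norm ζ s
  calc (‖ζ‖ ^ 2)⁻¹ * |inner ℝ ζ s| ≤ (‖ζ‖ ^ 2)⁻¹ * (‖ζ‖ * ‖s‖) := by gcongr
    _ = ‖ζ‖⁻¹ * ‖s‖ := by field_simp
    _ ≤ (7 / 8)⁻¹ * ‖s‖ := by gcongr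
    _ = _ := by norm_num

theorem norm_axisCompl_le {ζ : V} (hζ : ζ ≠ 0) (s : V) : ‖axisCompl ζ s‖ ≤ 2 * ‖s‖ := by
  have hζ : 0 < ‖ζ‖ := norm_pos_iff.mpr hζ
  rw [axisCompl_apply]
  refine (norm_sub_le _ _).trans ?_
  rw [norm_smul, Real.norm_eq_abs, axisCoord_apply, abs_mul, abs_of_pos (by positivity)]
  have h := abs_real_inner_le_norm ζ s
  calc ‖s‖ + (‖ζ‖ ^ 2)⁻¹ * |inner ℝ ζ s| * ‖ζ‖ ≤ ‖s‖ + (‖ζ‖ ^ 2)⁻¹ * (‖ζ‖ * ‖s‖) * ‖ζ‖ := by gcongr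
    _ = _ := by field_simp; ring

theorem axisScale_symm (ζ : V) (δ : ℝ) (x y : V) :
    inner ℝ (axisScale ζ δ x) y = inner ℝ x (axisScale ζ δ y) := by
  simp only [axisScale_apply, axisCompl_apply, axisCoord_apply, inner_add_left, inner_add_right,
    inner_sub_left, inner_sub_right, inner_smul_left, inner_smul_right, conj_trivial]
  rw [real_inner_comm x ζ]
  ring

theorem axisScale_eq {ζ : V} (δ : ℝ) (s : V) :
    axisScale ζ δ s = δ • s + ((1 - δ) * axisCoord ζ s) • ζ := by
  rw [axisScale_apply, axisCompl_apply]; module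

/-- The map is `δ` times a transvection that stretches `ζ` by `δ⁻¹`, and the latter has determinant
`1 + δ⁻¹ (1 - δ) = δ⁻¹`. The product is `δ ^ (dim - 1)`, written without natural subtraction. -/
theorem det_axisScale [FiniteDimensional ℝ V] {ζ : V} (hζ : ζ ≠ 0) {δ : ℝ} (hδ : δ ≠ 0) :
    LinearMap.det (axisScale ζ δ : V →ₗ[ℝ] V) = δ ^ Module.finrank ℝ V * δ⁻¹ := by
  have h : (axisScale ζ δ : V →ₗ[ℝ] V) = δ • LinearMap.transvection
      ((δ⁻¹ * (1 - δ)) • (axisCoord ζ : V →ₗ[ℝ] ℝ)) ζ := by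
    ext s
    simp only [ContinuousLinearMap.coe_coe, axisScale_eq, LinearMap.smul_apply,
      LinearMap.transvection.apply, smul_add, smul_smul, smul_eq_mul]
    congr 2
    field_simp
  rw [h, LinearMap.det_smul, LinearMap.transvection.det]
  simp only [LinearMap.smul_apply, ContinuousLinearMap.coe_coe, axisCoord_self hζ, smul_eq_mul]
  field_simp
  ring

end

/-! ### Symbol estimates in anisotropic coordinates -/

section

variable {V : Type*} [NormedAddCommGroup V] [InnerProductSpace ℝ V]

/-- The region of anisotropic coordinates in which the wave packets live. -/
def packetRegion (ζ : V) : Set V := {s | axisCoord ζ s ∈ Set.Ioo (1 / 4 : ℝ) 3 ∧ ‖axisCompl ζ s‖ < 1}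

theorem isOpen_packetRegion (ζ : V) : IsOpen (packetRegion ζ) :=
  (isOpen_Ioo.preimage (axisCoord ζ).continuous).inter
    (isOpen_lt (axisCompl ζ).continuous.norm continuous_const)

/-- The projective coordinate. -/
noncomputable def axisSlope (ζ s : V) : V := (axisCoord ζ s)⁻¹ • axisCompl ζ s

/-- The region containing the projective coordinates. -/
def slopeRegion (ζ : V) : Set V := {w | ‖w‖ < 4 ∧ |inner ℝ ζ w| < 1 / 4}

/-- A convex region away from the origin. -/
def coneRegion (ζ : V) : Set V := {v | 1 / 4 < inner ℝ ζ v ∧ ‖v‖ < 6}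

theorem isOpen_slopeRegion (ζ : V) : IsOpen (slopeRegion ζ) :=
  IsOpen.inter (s := {w : V | ‖w‖ < 4}) (t := {w : V | |inner ℝ ζ w| < 1 / 4})
    (isOpen_lt continuous_norm continuous_const) (isOpen_lt (by fun_prop) continuous_const)

theorem isOpen_coneRegion (ζ : V) : IsOpen (coneRegion ζ) :=
  IsOpen.inter (s := {v : V | 1 / 4 < inner ℝ ζ v}) (t := {v : V | ‖v‖ < 6})
    (isOpen_lt continuous_const (by fun_prop)) (isOpen_lt continuous_norm continuous_const)

theorem convex_coneRegion (ζ : V) : Convex ℝ (coneRegion ζ) := by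
  have h : coneRegion ζ = {v : V | 1 / 4 < inner ℝ ζ v} ∩ Metric.ball 0 6 := by
    ext; simp [coneRegion]
  rw [h]
  refine Convex.inter ?_ (convex_ball _ _)
  exact convex_halfSpace_gt (𝕜 := ℝ) (f := fun v => inner ℝ ζ v)
      ⟨fun x y => inner_add_right _ _ _, fun c x => by simp [inner_smul_right]⟩ _

theorem convex_slopeRegion (ζ : V) : Convex ℝ (slopeRegion ζ) := by
  have h : slopeRegion ζ = Metric.ball 0 4 ∩ (innerSL ℝ ζ) ⁻¹' Metric.ball (0 : ℝ) (1 / 4) := by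
    ext; simp [slopeRegion]
  rw [h]
  exact (convex_ball _ _).inter ((convex_ball _ _).linear_preimage (innerSL ℝ ζ : V →ₗ[ℝ] ℝ))

variable {ζ : V} {δ : ℝ}

/-- The mean value inequality is applied on the cone region, which is convex and stays away from the
origin. Along `ζ` the point has component at least `49/64 - 1/4 > 1/4`. -/
theorem mem_coneRegion_of_mem_slopeRegion (h7 : 7 / 8 ≤ ‖ζ‖) (h9 : ‖ζ‖ ≤ 9 / 8) (hδ : 0 < δ)
    (hδ1 : δ ≤ 1) {w : V} (hw : w ∈ slopeRegion ζ) : ζ + δ • w ∈ coneRegion ζ := by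
  obtain ⟨hw1, hw2⟩ := hw
  constructor
  · rw [inner_add_right, inner_smul_right, real_inner_self_eq_norm_sq]
    have h1 := abs_lt.mp hw2
    have h2 : -(1 / 4) ≤ δ * inner ℝ ζ w := by nlinarith
    nlinarith
  · refine (norm_add_le _ _).trans_lt ?_
    rw [norm_smul, Real.norm_of_nonneg hδ.le]
    have : δ * ‖w‖ ≤ 1 * ‖w‖ := by gcongr
    linarith

theorem self_mem_coneRegion (h7 : 7 / 8 ≤ ‖ζ‖) (h9 : ‖ζ‖ ≤ 9 / 8) : ζ ∈ coneRegion ζ := by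
  constructor
  · rw [real_inner_self_eq_norm_sq]; nlinarith
  · linarith

theorem norm_ge_of_mem_coneRegion (h9 : ‖ζ‖ ≤ 9 / 8) {v : V} (hv : v ∈ coneRegion ζ) :
    1 / 5 ≤ ‖v‖ := by
  have h1 := (hv.1).le.trans (real_inner_le_norm ζ v)
  have : ‖ζ‖ * ‖v‖ ≤ 9 / 8 * ‖v‖ := by gcongr
  linarith

theorem coneRegion_subset_compl_zero (h9 : ‖ζ‖ ≤ 9 / 8) : coneRegion ζ ⊆ {0}ᶜ := fun v hv => by
  have := norm_ge_of_mem_coneRegion h9 hv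
  exact norm_pos_iff.mp (by linarith)

/-- The slope is orthogonal to `ζ`, so the bound `1 / 4` on the inner product holds trivially; it
only thickens a hyperplane into an open set. -/
theorem axisSlope_mem_slopeRegion (hζ : ζ ≠ 0) {s : V} (hs : s ∈ packetRegion ζ) :
    axisSlope ζ s ∈ slopeRegion ζ := by
  obtain ⟨⟨h1, h2⟩, h3⟩ := hs
  constructor
  · rw [axisSlope, norm_smul, norm_inv, Real.norm_of_nonneg (by linarith),
      inv_mul_lt_iff₀ (by linarith)]
    linarith
  · rw [axisSlope, inner_smul_right, inner_axisCompl hζ]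
    norm_num

/-- Separates the radial variable from the slope, so that homogeneity of degree one can be applied
to the phase. -/
theorem axisScale_eq_smul {s : V} (hs : s ∈ packetRegion ζ) :
    axisScale ζ δ s = axisCoord ζ s • (ζ + δ • axisSlope ζ s) := by
  have h : axisCoord ζ s ≠ 0 := by have := hs.1.1; positivity
  rw [axisScale_apply, axisSlope, smul_add, smul_smul, smul_smul, mul_right_comm,
    mul_inv_cancel₀ h, one_mul]

theorem axisScale_norm_bounds (h7 : 7 / 8 ≤ ‖ζ‖) (h9 : ‖ζ‖ ≤ 9 / 8) (hδ : 0 < δ) (hδ1 : δ ≤ 1)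
    {s : V} (hs : s ∈ packetRegion ζ) :
    1 / 5 < ‖axisScale ζ δ s‖ ∧ ‖axisScale ζ δ s‖ < 5 := by
  have hζ : ζ ≠ 0 := norm_pos_iff.mp (by linarith)
  obtain ⟨⟨h1, h2⟩, h3⟩ := hs
  constructor
  · have h4 : inner ℝ ζ (axisScale ζ δ s) = axisCoord ζ s * ‖ζ‖ ^ 2 := by
      rw [axisScale_apply, inner_add_right, inner_smul_right, inner_smul_right,
        inner_axisCompl hζ, real_inner_self_eq_norm_sq]
      ring
    have h5 := real_inner_le_norm ζ (axisScale ζ δ s)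
    rw [h4] at h5
    have h6 : axisCoord ζ s * ‖ζ‖ ≤ ‖axisScale ζ δ s‖ := by
      have : 0 < ‖ζ‖ := by linarith
      nlinarith
    nlinarith
  · rw [axisScale_apply]
    refine (norm_add_le _ _).trans_lt ?_
    rw [norm_smul, norm_smul, Real.norm_of_nonneg hδ.le, Real.norm_of_nonneg (by linarith)]
    have : δ * ‖axisCompl ζ s‖ ≤ 1 * ‖axisCompl ζ s‖ := by gcongr
    nlinarith

theorem opNorm_axisCoord_le (h7 : 7 / 8 ≤ ‖ζ‖) : ‖axisCoord ζ‖ ≤ 3 := by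
  refine ContinuousLinearMap.opNorm_le_bound _ (by norm_num) fun s => ?_
  have := norm_axisCoord_le h7 s
  have h0 := norm_nonneg s
  rw [Real.norm_eq_abs]; linarith

theorem opNorm_axisCompl_le (hζ : ζ ≠ 0) : ‖axisCompl ζ‖ ≤ 2 :=
  ContinuousLinearMap.opNorm_le_bound _ (by norm_num) fun s => norm_axisCompl_le hζ s

theorem opNorm_axisScale_le (h7 : 7 / 8 ≤ ‖ζ‖) (h9 : ‖ζ‖ ≤ 9 / 8) (hδ : 0 < δ) (hδ1 : δ ≤ 1) :
    ‖axisScale ζ δ‖ ≤ 8 := by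
  refine ContinuousLinearMap.opNorm_le_bound _ (by norm_num) fun s => ?_
  have hζ : ζ ≠ 0 := norm_pos_iff.mp (by linarith)
  rw [axisScale_apply]
  refine (norm_add_le _ _).trans ?_
  rw [norm_smul, norm_smul, Real.norm_of_nonneg hδ.le, Real.norm_eq_abs]
  have h1 := norm_axisCoord_le h7 s
  have h2 := norm_axisCompl_le hζ s
  calc |axisCoord ζ s| * ‖ζ‖ + δ * ‖axisCompl ζ s‖ ≤ (8 / 7 * ‖s‖) * (9 / 8) + 1 * (2 * ‖s‖) := by
        gcongr
    _ ≤ 8 * ‖s‖ := by have := norm_nonneg s; linarith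

theorem exists_derivBound_axisSlope (N : ℕ) : ∃ C, 0 ≤ C ∧ ∀ (V : Type) [NormedAddCommGroup V]
    [InnerProductSpace ℝ V] (ζ : V), 7 / 8 ≤ ‖ζ‖ → ‖ζ‖ ≤ 9 / 8 →
    DerivBound N (packetRegion ζ) C 4 (axisSlope ζ) := by
  obtain ⟨C, hC0, hC⟩ := DerivBound.of_compact (N := N) (O := {0}ᶜ) (f := fun t : ℝ => t⁻¹)
    (K := Set.Icc (1 / 4 : ℝ) 3) isOpen_compl_singleton
    (fun t ht => (contDiffAt_inv ℝ ht).contDiffWithinAt) isCompact_Icc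
    (fun t ht => by have := ht.1; simp only [Set.mem_compl_iff, Set.mem_singleton_iff]; linarith)
  refine ⟨N.factorial * C * 2, by positivity, fun V _ _ ζ h7 h9 => ?_⟩
  have hζ : ζ ≠ 0 := norm_pos_iff.mp (by linarith)
  have hU := isOpen_packetRegion ζ
  have h1 : DerivBound N (packetRegion ζ) 3 1 (fun s => axisCoord ζ s) :=
    DerivBound.clm _ hU (opNorm_axisCoord_le h7) fun s hs => by
      rw [Real.norm_of_nonneg (by linarith [hs.1.1])]; exact hs.1.2.le
  have h2 : DerivBound N (packetRegion ζ) 2 1 (fun s => axisCompl ζ s) :=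
    DerivBound.clm _ hU (opNorm_axisCompl_le hζ) fun s hs => by linarith [hs.2]
  have h3 := (hC _ isOpen_Ioo Set.Ioo_subset_Icc_self).comp isOpen_Ioo hU h1 zero_le_one hC0
    (fun s hs => hs.1)
  -- The scale `4` is `max 1 3` from composing the inverse with the coordinate, plus `1` from the
  -- factor `axisCompl`.
  refine ((h3.smul h2 hU).mono_scale (by positivity) (by positivity) ?_)
  norm_num

end

/-! ### Rescaled phase and rescaled direction -/

section

/-- The phase with its linear part removed, in rescaled projective coordinates. -/
noncomputable def slopePhase {V : Type*} [NormedAddCommGroup V] [NormedSpace ℝ V] (f : V → ℝ)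
    (ζ : V) (δ : ℝ) (w : V) : ℝ :=
  δ⁻¹ * (δ⁻¹ * (f (ζ + δ • w) - f ζ - fderiv ℝ f ζ (δ • w)))

/-- The gradient of `slopePhase` is `δ⁻¹ (Df(ζ + δ w) - Df(ζ))`, a rescaled increment of `Df`, so
only derivatives of `f` of order at least two are used. Second-order vanishing at `ζ` compensates
the factor `δ⁻²`. -/
theorem exists_derivBound_slopePhase (M : ℕ) (hM : 1 ≤ M) (A : ℝ) (hA : 0 ≤ A) :
    ∃ C, 0 ≤ C ∧ ∀ (V : Type) [NormedAddCommGroup V]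
    [InnerProductSpace ℝ V] (f : V → ℝ), HomogeneousPhase (M + 1) A f → ∀ (ζ : V) (δ : ℝ),
    7 / 8 ≤ ‖ζ‖ → ‖ζ‖ ≤ 9 / 8 → 0 < δ → δ ≤ 1 →
    DerivBound (M + 1) (slopeRegion ζ) C 1 (slopePhase f ζ δ) := by
  set C₁ : ℝ := M.factorial * (A * (1 / 5 : ℝ)⁻¹ ^ (M + 1) * 4) with hC₁
  refine ⟨C₁ * 4, by positivity, fun V _ _ f hf ζ δ h7 h9 hδ hδ1 => ?_⟩
  have hC₁0 : 0 ≤ C₁ := by positivity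
  have hζ : ζ ≠ 0 := norm_pos_iff.mp (by linarith)
  have hΩ0 := coneRegion_subset_compl_zero h9
  have hG := DerivBound.rescaled_increment (N := M) (h := fderiv ℝ f) (Ω := coneRegion ζ)
    (V := slopeRegion ζ) (A := A * (1 / 5 : ℝ)⁻¹ ^ (M + 1)) (R := 4) (δ := δ) (ζ := ζ)
    (isOpen_coneRegion ζ) (convex_coneRegion ζ)
    ((hf.contDiffOn_fderiv.mono hΩ0).of_le (by exact_mod_cast le_top)) hM
    (fun k hk1 hkM v hv => by
      rw [norm_iteratedFDeriv_fderiv]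
      exact hf.norm_iteratedFDeriv_le (by norm_num) (by norm_num)
        (norm_ge_of_mem_coneRegion h9 hv) (by omega) (by omega))
    (by positivity) hδ hδ1 (self_mem_coneRegion h7 h9) (isOpen_slopeRegion ζ)
    (fun w hw => mem_coneRegion_of_mem_slopeRegion h7 h9 hδ hδ1 hw)
    (fun w hw => hw.1.le) (by norm_num)
  have hdiff : ∀ w ∈ slopeRegion ζ, HasFDerivAt (slopePhase f ζ δ)
      (δ⁻¹ • (fderiv ℝ f (ζ + δ • w) - fderiv ℝ f ζ)) w := by
    intro w hw
    have hne := hΩ0 (mem_coneRegion_of_mem_slopeRegion h7 h9 hδ hδ1 hw)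
    have h1 : HasFDerivAt (fun w : V => ζ + δ • w) (δ • ContinuousLinearMap.id ℝ V) w :=
      ((hasFDerivAt_id w).const_smul δ).const_add ζ
    have h2 := (hf.differentiableAt hne).hasFDerivAt.comp w h1
    have h3 : HasFDerivAt (fun w : V => fderiv ℝ f ζ (δ • w)) (δ • fderiv ℝ f ζ) w := by
      have : (fun w : V => fderiv ℝ f ζ (δ • w)) = fun w => (δ • fderiv ℝ f ζ) w := by
        ext1 w; simp
      rw [this]; exact (δ • fderiv ℝ f ζ).hasFDerivAt
    have h4 := (((h2.sub_const (f ζ)).sub h3).const_mul δ⁻¹).const_mul δ⁻¹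
    refine h4.congr_fderiv ?_
    ext v
    simp only [smul_sub, sub_apply, smul_apply,
      ContinuousLinearMap.comp_apply, ContinuousLinearMap.id_apply, map_smul, smul_smul, smul_eq_mul]
    field_simp
  refine (DerivBound.succ_of_fderiv (isOpen_slopeRegion ζ) ?_ (fun w hw => ?_) ?_)
  · intro w hw
    have hne := hΩ0 (mem_coneRegion_of_mem_slopeRegion h7 h9 hδ hδ1 hw)
    have h1 : ContDiffAt ℝ ((M : ℕ) + 1 : ℕ) f (ζ + δ • w) :=
      (hf.contDiffAt hne).of_le (by exact_mod_cast le_top)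
    have h2 : ContDiffAt ℝ ((M : ℕ) + 1 : ℕ) (fun w : V => f (ζ + δ • w)) w :=
      h1.comp w (by fun_prop)
    have h3 : ContDiffAt ℝ ((M : ℕ) + 1 : ℕ) (fun w : V => fderiv ℝ f ζ (δ • w)) w :=
      (fderiv ℝ f ζ).contDiff.contDiffAt.comp w (by fun_prop)
    exact (contDiffAt_const.mul (contDiffAt_const.mul
      ((h2.sub contDiffAt_const).sub h3))).contDiffWithinAt
  -- The function vanishes at `w = 0`, so its gradient bound and `‖w‖ < 4` bound its values; this is
  -- the factor `4` in the constant.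
  · have h0 : (0 : V) ∈ slopeRegion ζ := by
      constructor <;> simp
    have hmv := (convex_slopeRegion ζ).norm_image_sub_le_of_norm_hasFDerivWithin_le
      (C := C₁) (fun x hx => (hdiff x hx).hasFDerivWithinAt)
      (fun x hx => hG.norm_le hx) h0 hw
    have hz : slopePhase f ζ δ 0 = 0 := by simp [slopePhase]
    rw [hz, sub_zero, sub_zero] at hmv
    refine hmv.trans ?_
    have := hw.1.le
    gcongr
  · refine (hG.congr fun w hw => (hdiff w hw).fderiv).mono_const zero_le_one ?_
    linarith

/-- Across a packet the unit direction moves by `O(δ)`, so an angular cutoff of width `δ` is smooth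
at unit scale in packet coordinates. -/
theorem exists_derivBound_normalized (M : ℕ) (hM : 1 ≤ M) (V : Type) [NormedAddCommGroup V]
    [InnerProductSpace ℝ V] [FiniteDimensional ℝ V] :
    ∃ C, 0 ≤ C ∧ ∀ (ζ : V) (δ : ℝ), 7 / 8 ≤ ‖ζ‖ → ‖ζ‖ ≤ 9 / 8 → 0 < δ → δ ≤ 1 →
    DerivBound M (slopeRegion ζ) C 1
      (fun w => δ⁻¹ • (‖ζ + δ • w‖⁻¹ • (ζ + δ • w) - ‖ζ‖⁻¹ • ζ)) := by
  have hcd : ContDiffOn ℝ M (fun v : V => ‖v‖⁻¹ • v) {0}ᶜ := fun v hv =>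
    (((contDiffAt_norm ℝ hv).inv (norm_ne_zero_iff.mpr hv)).smul contDiffAt_id).contDiffWithinAt
  obtain ⟨C, hC0, hC⟩ := DerivBound.of_compact (N := M) (O := {0}ᶜ) (f := fun v : V => ‖v‖⁻¹ • v)
    (K := Metric.closedBall 0 6 \ Metric.ball 0 (1 / 5)) isOpen_compl_singleton
    hcd ((isCompact_closedBall _ _).diff Metric.isOpen_ball)
    (fun v hv h => hv.2 (by rw [Set.mem_singleton_iff.mp h]; simp))
  refine ⟨M.factorial * (C * 4), by positivity, fun ζ δ h7 h9 hδ hδ1 => ?_⟩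
  have hdb := hC (coneRegion ζ) (isOpen_coneRegion ζ) fun v hv => by
    have := norm_ge_of_mem_coneRegion h9 hv
    have h6 := hv.2
    simp only [Set.mem_sdiff, mem_closedBall_zero_iff, mem_ball_zero_iff, not_lt]
    exact ⟨h6.le, this⟩
  exact DerivBound.rescaled_increment (N := M) (h := fun v : V => ‖v‖⁻¹ • v) (Ω := coneRegion ζ)
    (V := slopeRegion ζ) (A := C) (R := 4) (δ := δ) (ζ := ζ)
    (isOpen_coneRegion ζ) (convex_coneRegion ζ) hdb.1 hM
    (fun k _ hkM v hv => by
      simpa using hdb.norm_iteratedFDeriv_le (isOpen_coneRegion ζ) hkM hv)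
    hC0 hδ hδ1 (self_mem_coneRegion h7 h9) (isOpen_slopeRegion ζ)
    (fun w hw => mem_coneRegion_of_mem_slopeRegion h7 h9 hδ hδ1 hw)
    (fun w hw => hw.1.le) (by norm_num)

end

/-! ### High-frequency symbols -/

/-- Smooth functions with `⟨ξ⟩^{-m+ρk} ‖D^k α(ξ)‖ ≤ A` for `k ≤ N`. -/
structure SymbolBound {V : Type*} [NormedAddCommGroup V] [NormedSpace ℝ V]
    (N : ℕ) (m ρ A : ℝ) (α : V → ℂ) : Prop where
  contDiff : ContDiff ℝ ∞ α
  bound : ∀ k : ℕ, k ≤ N → ∀ ξ, Real.sqrt (1 + ‖ξ‖ ^ 2) ^ (-m + ρ * k) * ‖iteratedFDeriv ℝ k α ξ‖ ≤ A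

theorem rpow_le_six_rpow_abs {x : ℝ} (y : ℝ) (h1 : 1 / 6 ≤ x) (h2 : x ≤ 6) :
    x ^ y ≤ 6 ^ |y| := by
  have hx : 0 < x := by linarith
  rcases le_total 0 y with h | h
  · rw [abs_of_nonneg h]; exact Real.rpow_le_rpow hx.le h2 h
  · rw [abs_of_nonpos h, ← neg_neg y, Real.rpow_neg hx.le, ← Real.inv_rpow hx.le, neg_neg]
    refine Real.rpow_le_rpow (by positivity) ?_ (by linarith)
    rw [inv_le_comm₀ hx (by norm_num)]
    linarith

/-- On this annulus the bracket is comparable to `l` within a factor `6`, because `l ≥ 1`. Replacing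
it by `l` in the weight costs at most `6 ^ (|m| + N)`. -/
theorem SymbolBound.norm_iteratedFDeriv_le {V : Type*} [NormedAddCommGroup V] [NormedSpace ℝ V]
    {N : ℕ} {m ρ A : ℝ} (hρ0 : 0 ≤ ρ) (hρ1 : ρ ≤ 1) {α : V → ℂ} (hα : SymbolBound N m ρ A α)
    {l : ℝ} (hl : 1 ≤ l) {ξ : V} (h1 : l / 5 ≤ ‖ξ‖) (h2 : ‖ξ‖ ≤ 5 * l) {k : ℕ} (hk : k ≤ N) :
    ‖iteratedFDeriv ℝ k α ξ‖ ≤ A * 6 ^ (|m| + N) * l ^ m * (l ^ (-ρ)) ^ k := by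
  have hl0 : 0 < l := by linarith
  set b := Real.sqrt (1 + ‖ξ‖ ^ 2) with hb
  have hb1 : ‖ξ‖ ≤ b := Real.le_sqrt_of_sq_le (by linarith)
  have hb2 : b ≤ 6 * l := by
    rw [hb]
    refine Real.sqrt_le_iff.mpr ⟨by positivity, ?_⟩
    have := norm_nonneg ξ
    nlinarith
  have hb0 : 0 < b := Real.sqrt_pos.mpr (by positivity)
  have h := hα.bound k hk ξ
  rw [← hb] at h
  have hA : 0 ≤ A := le_trans (by positivity) h
  have h3 : ‖iteratedFDeriv ℝ k α ξ‖ ≤ A * b ^ (-(-m + ρ * k)) := by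
    rw [Real.rpow_neg hb0.le, ← div_eq_mul_inv, le_div_iff₀ (by positivity)]; linarith
  have h4 : b ^ (-(-m + ρ * k)) ≤ 6 ^ (|m| + N) * (l ^ m * (l ^ (-ρ)) ^ k) := by
    have h5 : b = l * (b / l) := by field_simp
    rw [h5, Real.mul_rpow hl0.le (by positivity)]
    have h6 : l ^ (-(-m + ρ * k)) = l ^ m * (l ^ (-ρ)) ^ k := by
      rw [← Real.rpow_natCast (l ^ (-ρ)), ← Real.rpow_mul hl0.le, ← Real.rpow_add hl0]
      congr 1; ring
    rw [h6, mul_comm]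
    gcongr
    refine (rpow_le_six_rpow_abs _ ?_ ?_).trans ?_
    · rw [le_div_iff₀ hl0]; linarith
    · rw [div_le_iff₀ hl0]; linarith
    · refine Real.rpow_le_rpow_of_exponent_le (by norm_num) ?_
      rw [abs_neg]
      refine (abs_add_le _ _).trans ?_
      rw [abs_neg, abs_mul, abs_of_nonneg hρ0, Nat.abs_cast]
      have : ρ * (k : ℝ) ≤ 1 * (N : ℝ) := by gcongr
      linarith
  calc _ ≤ A * b ^ (-(-m + ρ * k)) := h3
    _ ≤ A * (6 ^ (|m| + N) * (l ^ m * (l ^ (-ρ)) ^ k)) := by gcongr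
    _ = _ := by ring

/-- The symbol of a high-frequency wave packet in direction `ζ`. -/
noncomputable def highSymbol {V : Type*} [NormedAddCommGroup V] [NormedSpace ℝ V]
    (f : V → ℝ) (α ψ χ : V → ℂ) (ζ : V) (δ l : ℝ) (ξ : V) : ℂ :=
  Complex.exp (Complex.I * ((f ξ - fderiv ℝ f ζ ξ : ℝ) : ℂ)) *
    (α ξ * (ψ (l⁻¹ • ξ) * χ (δ⁻¹ • (‖ξ‖⁻¹ • ξ - ζ))))

/-- By homogeneity and Euler's identity the phase remainder is `l δ²` times the radial coordinate
times `slopePhase`, and `δ ^ 2 * l = 1`. The angular cutoff depends on the slope alone; its argument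
is recentred at `‖ζ‖⁻¹ • ζ` to become a rescaled increment plus a constant translation. -/
theorem highSymbol_axisScale {V : Type*} [NormedAddCommGroup V] [InnerProductSpace ℝ V]
    {N : ℕ} {A : ℝ} {f : V → ℝ} (hf : HomogeneousPhase N A f) (α ψ χ : V → ℂ) {ζ : V} {δ l : ℝ}
    (h7 : 7 / 8 ≤ ‖ζ‖) (h9 : ‖ζ‖ ≤ 9 / 8) (hδ : 0 < δ) (hδ1 : δ ≤ 1) (hl : 1 ≤ l)
    (hδl : δ ^ 2 * l = 1) {s : V} (hs : s ∈ packetRegion ζ) :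
    highSymbol f α ψ χ ζ δ l (l • axisScale ζ δ s) =
      Complex.exp (Complex.I * ((axisCoord ζ s * slopePhase f ζ δ (axisSlope ζ s) : ℝ) : ℂ)) *
      (α ((l • axisScale ζ δ) s) * (ψ (axisScale ζ δ s) *
        χ (δ⁻¹ • (‖ζ + δ • axisSlope ζ s‖⁻¹ • (ζ + δ • axisSlope ζ s) - ‖ζ‖⁻¹ • ζ)
          + δ⁻¹ • (‖ζ‖⁻¹ • ζ - ζ)))) := by
  have hζ : ζ ≠ 0 := norm_pos_iff.mp (by linarith)
  have hl0 : 0 < l := by linarith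
  have hσ : 0 < axisCoord ζ s := by have := hs.1.1; linarith
  set y := ζ + δ • axisSlope ζ s with hy
  have hy0 : y ≠ 0 := coneRegion_subset_compl_zero h9
    (mem_coneRegion_of_mem_slopeRegion h7 h9 hδ hδ1 (axisSlope_mem_slopeRegion hζ hs))
  have hv : l • axisScale ζ δ s = (l * axisCoord ζ s) • y := by
    rw [axisScale_eq_smul hs, smul_smul]
  have h1 : f (l • axisScale ζ δ s) - fderiv ℝ f ζ (l • axisScale ζ δ s) =
      axisCoord ζ s * slopePhase f ζ δ (axisSlope ζ s) := by
    rw [hv, hf.homogeneous y hy0 _ (by positivity), map_smul, hy, map_add, hf.fderiv_self hζ,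
      slopePhase, ← hy, smul_eq_mul]
    have hl' : l = δ⁻¹ * δ⁻¹ := by field_simp; linarith
    rw [hl']; ring
  have h2 : l⁻¹ • l • axisScale ζ δ s = axisScale ζ δ s := inv_smul_smul₀ hl0.ne' _
  have h3 : ‖l • axisScale ζ δ s‖⁻¹ • (l • axisScale ζ δ s) = ‖y‖⁻¹ • y := by
    rw [hv, norm_smul, Real.norm_of_nonneg (by positivity), smul_smul]
    congr 1
    have : l * axisCoord ζ s ≠ 0 := by positivity
    have hyn : ‖y‖ ≠ 0 := norm_ne_zero_iff.mpr hy0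
    rw [mul_inv]
    field_simp
  rw [highSymbol, h1, h2, h3, ← smul_add, sub_add_sub_cancel]
  rfl

/-- The closed set carrying a high-frequency packet. -/
def packetCore {V : Type*} [NormedAddCommGroup V] [InnerProductSpace ℝ V] (ζ : V) (δ : ℝ) : Set V :=
  {s | 1 / 2 ≤ ‖axisScale ζ δ s‖ ∧ ‖axisScale ζ δ s‖ ≤ 2 ∧
    ‖axisScale ζ δ s - ‖axisScale ζ δ s‖ • ζ‖ ≤ ‖axisScale ζ δ s‖ * (δ / 8)}

section

variable {V : Type*} [NormedAddCommGroup V] [InnerProductSpace ℝ V] {ζ : V} {δ : ℝ}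

theorem isClosed_packetCore : IsClosed (packetCore ζ δ) := by
  have h : Continuous (axisScale ζ δ) := (axisScale ζ δ).continuous
  refine IsClosed.inter (s₁ := {s | 1 / 2 ≤ ‖axisScale ζ δ s‖}) ?_ (IsClosed.inter
    (s₁ := {s | ‖axisScale ζ δ s‖ ≤ 2})
    (s₂ := {s | ‖axisScale ζ δ s - ‖axisScale ζ δ s‖ • ζ‖ ≤ ‖axisScale ζ δ s‖ * (δ / 8)}) ?_ ?_)
  · exact isClosed_le continuous_const h.norm
  · exact isClosed_le h.norm continuous_const
  · exact isClosed_le (by fun_prop) (by fun_prop)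

/-- Write `v = ‖v‖ ζ + r` with `‖r‖ ≤ ‖v‖ δ / 8`. The coordinate along `ζ` differs from `‖v‖ ∈ [1/2,
2]` by at most `‖v‖ / 7`, and `δ` times the transverse part of `s` is that of `r`, of size at most
`δ / 2`. -/
theorem packetCore_subset (h7 : 7 / 8 ≤ ‖ζ‖) (hδ : 0 < δ) (hδ1 : δ ≤ 1) :
    packetCore ζ δ ⊆ packetRegion ζ := by
  rintro s ⟨h1, h2, h3⟩
  have hζ : ζ ≠ 0 := norm_pos_iff.mp (by linarith)
  set v := axisScale ζ δ s with hv
  set r := v - ‖v‖ • ζ with hr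
  have hσv : axisCoord ζ v = axisCoord ζ s := by
    rw [hv, axisScale_apply, map_add, map_smul, map_smul, axisCoord_self hζ,
      axisCoord_axisCompl hζ]
    simp
  have hQv : axisCompl ζ v = δ • axisCompl ζ s := by
    rw [hv, axisScale_apply, map_add, map_smul, map_smul, axisCompl_self hζ,
      axisCompl_axisCompl hζ]
    simp
  have hvr : v = ‖v‖ • ζ + r := by rw [hr]; abel
  have hσr : axisCoord ζ s = ‖v‖ + axisCoord ζ r := by
    have : axisCoord ζ v = ‖v‖ + axisCoord ζ r := by
      conv_lhs => rw [hvr]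
      rw [map_add, map_smul, axisCoord_self hζ, smul_eq_mul, mul_one]
    rw [← hσv, this]
  have hQr : δ • axisCompl ζ s = axisCompl ζ r := by
    have : axisCompl ζ v = axisCompl ζ r := by
      conv_lhs => rw [hvr]
      rw [map_add, map_smul, axisCompl_self hζ, smul_zero, zero_add]
    rw [← hQv, this]
  have hr1 : ‖r‖ ≤ ‖v‖ * (1 / 8) := h3.trans (by gcongr)
  have hσb := abs_le.mp (norm_axisCoord_le h7 r)
  refine ⟨⟨?_, ?_⟩, ?_⟩
  · rw [hσr]; linarith [hσb.1]
  · rw [hσr]; linarith [hσb.2]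
  · have h5 : δ * ‖axisCompl ζ s‖ ≤ 2 * (‖v‖ * (δ / 8)) := by
      rw [← Real.norm_of_nonneg hδ.le, ← norm_smul, hQr, Real.norm_of_nonneg hδ.le]
      exact (norm_axisCompl_le hζ r).trans (by linarith)
    have h6 : δ * ‖axisCompl ζ s‖ ≤ δ * (1 / 2) := by
      have : ‖v‖ * (δ / 8) ≤ 2 * (δ / 8) := by gcongr
      linarith
    have := le_of_mul_le_mul_left h6 hδ
    linarith

theorem packetRegion_subset_closedBall (h9 : ‖ζ‖ ≤ 9 / 8) :
    packetRegion ζ ⊆ Metric.closedBall (0 : V) 5 := by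
  rintro s ⟨⟨h1, h2⟩, h3⟩
  rw [mem_closedBall_zero_iff]
  have : s = axisCoord ζ s • ζ + axisCompl ζ s := by rw [axisCompl_apply]; abel
  rw [this]
  refine (norm_add_le _ _).trans ?_
  rw [norm_smul, Real.norm_of_nonneg (by linarith)]
  nlinarith [norm_nonneg ζ]

theorem highSymbol_eq_zero {f : V → ℝ} {α ψ χ : V → ℂ} {l : ℝ} (hl : 0 < l) (hδ : 0 < δ)
    (hψ : ∀ v, ψ v ≠ 0 → 1 / 2 ≤ ‖v‖ ∧ ‖v‖ ≤ 2) (hχ : ∀ z, χ z ≠ 0 → ‖z‖ ≤ 1 / 8)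
    {s : V} (hs : s ∉ packetCore ζ δ) :
    highSymbol f α ψ χ ζ δ l (l • axisScale ζ δ s) = 0 := by
  by_contra hne
  rw [highSymbol] at hne
  have h1 := right_ne_zero_of_mul (right_ne_zero_of_mul hne)
  have h2 := hψ _ (left_ne_zero_of_mul h1)
  have h3 := hχ _ (right_ne_zero_of_mul h1)
  rw [inv_smul_smul₀ hl.ne'] at h2
  set v := axisScale ζ δ s with hv
  have hv0 : 0 < ‖v‖ := by linarith [h2.1]
  refine hs ⟨h2.1, h2.2, ?_⟩
  rw [← hv]
  have h4 : ‖l • v‖⁻¹ • (l • v) = ‖v‖⁻¹ • v := by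
    rw [norm_smul, Real.norm_of_nonneg hl.le, smul_smul]
    congr 1
    field_simp
  rw [h4, norm_smul, norm_inv, Real.norm_of_nonneg hδ.le, inv_mul_le_iff₀ hδ] at h3
  have h5 : v - ‖v‖ • ζ = ‖v‖ • (‖v‖⁻¹ • v - ζ) := by
    rw [smul_sub, smul_inv_smul₀ hv0.ne']
  rw [h5, norm_smul, norm_norm]
  gcongr
  linarith

end

/-- In packet coordinates the exponential and both cutoffs have derivatives bounded independently of
`l`. Only the amplitude loses: each derivative costs `l` by the chain rule and gains `l ^ (-ρ)`. -/
theorem exists_derivBound_highSymbol (V : Type) [NormedAddCommGroup V] [InnerProductSpace ℝ V]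
    [FiniteDimensional ℝ V] (M : ℕ) (hM : 1 ≤ M) (m ρ A A' : ℝ) (hρ0 : 0 ≤ ρ) (hρ1 : ρ ≤ 1)
    (hA : 0 ≤ A) (hA' : 0 ≤ A') (ψ χ : V → ℂ) {Cψ Cχ : ℝ}
    (hψ : DerivBound (M + 1) Set.univ Cψ 1 ψ) (hχ : DerivBound (M + 1) Set.univ Cχ 1 χ)
    (hψs : ∀ v, ψ v ≠ 0 → 1 / 2 ≤ ‖v‖ ∧ ‖v‖ ≤ 2) (hχs : ∀ z, χ z ≠ 0 → ‖z‖ ≤ 1 / 8) :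
    ∃ C₁ C₂ : ℝ, 0 ≤ C₁ ∧ 1 ≤ C₂ ∧ ∀ (f : V → ℝ) (α : V → ℂ), HomogeneousPhase (M + 1) A f →
      SymbolBound (M + 1) m ρ A' α → ∀ (ζ : V) (δ l : ℝ), 7 / 8 ≤ ‖ζ‖ → ‖ζ‖ ≤ 9 / 8 → 0 < δ →
      δ ≤ 1 → 1 ≤ l → δ ^ 2 * l = 1 →
      DerivBound (M + 1) Set.univ (C₁ * l ^ m) (C₂ * l ^ (1 - ρ))
        (fun s => highSymbol f α ψ χ ζ δ l (l • axisScale ζ δ s)) ∧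
      ∀ s ∉ Metric.closedBall (0 : V) 5, highSymbol f α ψ χ ζ δ l (l • axisScale ζ δ s) = 0 := by
  obtain ⟨Cw, hCw0, hCw⟩ := exists_derivBound_axisSlope (M + 1)
  obtain ⟨Cg, hCg0, hCg⟩ := exists_derivBound_slopePhase M hM A hA
  obtain ⟨Cn, hCn0, hCn⟩ := exists_derivBound_normalized (M + 1) (by omega) V
  have hCψ0 : 0 ≤ Cψ := (norm_nonneg _).trans (hψ.norm_le (Set.mem_univ 0))
  have hCχ0 : 0 ≤ Cχ := (norm_nonneg _).trans (hχ.norm_le (Set.mem_univ 0))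
  set Φ : ℝ := Nat.cast (M + 1).factorial with hΦ
  have hΦ0 : 0 ≤ Φ := by positivity
  set μw : ℝ := max 1 Cw * 4 with hμw
  have hμw0 : 0 ≤ μw := by positivity
  set μe : ℝ := max 1 (3 * (Φ * Cg)) * (1 + μw) with hμe
  have hμe0 : 0 ≤ μe := by positivity
  set μχ : ℝ := max 1 (Φ * Cn) * μw with hμχ
  have hμχ0 : 0 ≤ μχ := by positivity
  set K : ℝ := A' * 6 ^ (|m| + ((M + 1 : ℕ) : ℝ)) with hK
  have hK0 : 0 ≤ K := by positivity
  -- Constants multiply and scales add over the four factors: exponential `μe`, amplitude `8`,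
  -- radial cutoff `8`, angular cutoff `μχ`.
  refine ⟨Φ * 1 * (K * (Cψ * (Φ * Cχ))), μe + (8 + (8 + μχ)), by positivity, by linarith,
    fun f α hf hα ζ δ l h7 h9 hδ hδ1 hl hδl => ?_⟩
  have hζ : ζ ≠ 0 := norm_pos_iff.mp (by linarith)
  have hl0 : 0 < l := by linarith
  have hU := isOpen_packetRegion ζ
  have hlρ : 1 ≤ l ^ (1 - ρ) := Real.one_le_rpow hl (by linarith)
  have hw := hCw V ζ h7 h9
  have hwm : Set.MapsTo (axisSlope ζ) (packetRegion ζ) (slopeRegion ζ) :=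
    fun s hs => axisSlope_mem_slopeRegion hζ hs
  have hσ : DerivBound (M + 1) (packetRegion ζ) 3 1 (fun s => axisCoord ζ s) :=
    DerivBound.clm _ hU (opNorm_axisCoord_le h7) fun s hs => by
      rw [Real.norm_of_nonneg (by linarith [hs.1.1])]; exact hs.1.2.le
  have hg := (hCg V f hf ζ δ h7 h9 hδ hδ1).comp (isOpen_slopeRegion ζ) hU hw (by norm_num) hCg0 hwm
  have he := (derivBound_exp_I_mul (M + 1)).comp isOpen_univ hU (hσ.mul hg hU)
    (by positivity) zero_le_one (fun _ _ => Set.mem_univ _)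
  have hn := (hCn ζ δ h7 h9 hδ hδ1).comp (isOpen_slopeRegion ζ) hU hw (by norm_num) hCn0 hwm
  have hX := (hχ.comp_add_const (δ⁻¹ • (‖ζ‖⁻¹ • ζ - ζ))).comp isOpen_univ hU hn
    (by positivity) hCχ0 (fun _ _ => Set.mem_univ _)
  have hP := hψ.comp_clm isOpen_univ hU (axisScale ζ δ) (fun _ _ => Set.mem_univ _)
    (opNorm_axisScale_le h7 h9 hδ hδ1) zero_le_one hCψ0
  have hOann : IsOpen {ξ : V | l / 5 < ‖ξ‖ ∧ ‖ξ‖ < 5 * l} :=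
    IsOpen.inter (s := {ξ : V | l / 5 < ‖ξ‖}) (t := {ξ : V | ‖ξ‖ < 5 * l})
      (isOpen_lt continuous_const continuous_norm) (isOpen_lt continuous_norm continuous_const)
  have hα1 : DerivBound (M + 1) {ξ : V | l / 5 < ‖ξ‖ ∧ ‖ξ‖ < 5 * l} (K * l ^ m) (l ^ (-ρ)) α :=
    DerivBound.of_contDiffOn hOann (hα.contDiff.of_le (by exact_mod_cast le_top)).contDiffOn
      fun k hk ξ hξ => hα.norm_iteratedFDeriv_le hρ0 hρ1 hl hξ.1.le hξ.2.le hk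
  have ha := hα1.comp_clm hOann hU (l • axisScale ζ δ) (K := l * 8)
    (fun s hs => by
      have := axisScale_norm_bounds h7 h9 hδ hδ1 hs
      simp only [Set.mem_ofPred_eq, smul_apply, norm_smul,
        Real.norm_of_nonneg hl0.le]
      constructor <;> nlinarith)
    (by
      rw [norm_smul, Real.norm_of_nonneg hl0.le]
      have := opNorm_axisScale_le h7 h9 hδ hδ1
      gcongr) (by positivity) (by positivity)
  have hsc : l ^ (-ρ) * (l * 8) = 8 * l ^ (1 - ρ) := by
    rw [sub_eq_add_neg, Real.rpow_add hl0, Real.rpow_one]; ring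
  rw [hsc] at ha
  have hprod := he.mul (ha.mul (hP.mul hX hU) hU) hU
  have hfin : DerivBound (M + 1) (packetRegion ζ)
      (Φ * 1 * (K * (Cψ * (Φ * Cχ))) * l ^ m) ((μe + (8 + (8 + μχ))) * l ^ (1 - ρ))
      (fun s => highSymbol f α ψ χ ζ δ l (l • axisScale ζ δ s)) := by
    refine ((hprod.mono_scale (by positivity) (by positivity) ?_).mono_const (by positivity)
      (le_of_eq (by ring))).congr
      (fun s hs => highSymbol_axisScale hf α ψ χ h7 h9 hδ hδ1 hl hδl hs)
    have h1 : μe * 1 ≤ μe * l ^ (1 - ρ) := by gcongr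
    have h2 : (8 + μχ) * 1 ≤ (8 + μχ) * l ^ (1 - ρ) := by gcongr
    have h3 : max 1 (3 * (Φ * Cg)) * (1 + μw) = μe := rfl
    have h4 : max 1 (Φ * Cn) * μw = μχ := rfl
    rw [h3, h4]
    linarith
  -- The estimate lives on the open packet region; the symbol vanishes off a closed subset of it, so
  -- extension by zero is smooth.
  refine ⟨hfin.extend hU isClosed_packetCore (packetCore_subset h7 hδ hδ1)
    (fun s hs => highSymbol_eq_zero hl0 hδ hψs hχs hs) (by positivity) (by positivity),
    fun s hs => highSymbol_eq_zero hl0 hδ hψs hχs fun h => hs ?_⟩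
  exact packetRegion_subset_closedBall h9 (packetCore_subset h7 hδ hδ1 h)

/-! ### Low-frequency symbols -/

/-- Unit vectors at an angle of at most a right angle are joined by a segment of norm at least `1 /
2`, along which the Hessian bound integrates. -/
theorem HomogeneousPhase.norm_fderiv_sub_le_of_inner_nonneg {V : Type*} [NormedAddCommGroup V]
    [InnerProductSpace ℝ V] {N : ℕ} {A : ℝ} {f : V → ℝ} (hf : HomogeneousPhase N A f)
    (hN : 2 ≤ N) {u v : V} (hu : ‖u‖ = 1) (hv : ‖v‖ = 1) (huv : 0 ≤ inner ℝ u v) :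
    ‖fderiv ℝ f v - fderiv ℝ f u‖ ≤ A * (1 / 2 : ℝ)⁻¹ ^ N * 2 := by
  have hseg : ∀ y ∈ segment ℝ u v, 1 / 2 ≤ ‖y‖ := by
    rintro y ⟨a, b, ha, hb, hab, rfl⟩
    have h1 : ‖a • u + b • v‖ ^ 2 = a ^ 2 + 2 * (a * (b * inner ℝ u v)) + b ^ 2 := by
      rw [norm_add_sq_real, norm_smul, norm_smul, hu, hv, inner_smul_left, inner_smul_right]
      simp
    have h2 : 0 ≤ a * (b * inner ℝ u v) := by positivity
    have h3 : 1 / 4 ≤ ‖a • u + b • v‖ ^ 2 := by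
      rw [h1]
      have hb' : b = 1 - a := by linarith
      subst hb'
      nlinarith [sq_nonneg (2 * a - 1)]
    nlinarith [norm_nonneg (a • u + b • v)]
  have hmv := (convex_segment u v).norm_image_sub_le_of_norm_hasFDerivWithin_le
    (f := fderiv ℝ f) (f' := fun y => fderiv ℝ (fderiv ℝ f) y) (C := A * (1 / 2 : ℝ)⁻¹ ^ N)
    (fun y hy => by
      have hy0 : y ≠ 0 := norm_pos_iff.mp (by linarith [hseg y hy])
      have : ContDiffAt ℝ ∞ (fderiv ℝ f) y :=
        (hf.contDiffOn_fderiv y hy0).contDiffAt (isOpen_compl_singleton.mem_nhds hy0)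
      exact (this.differentiableAt (by simp)).hasFDerivAt.hasFDerivWithinAt)
    (fun y hy => by
      rw [← norm_iteratedFDeriv_one, norm_iteratedFDeriv_fderiv]
      exact hf.norm_iteratedFDeriv_le (by norm_num) (by norm_num) (hseg y hy) le_rfl hN)
    (left_mem_segment ℝ u v) (right_mem_segment ℝ u v)
  have hA : 0 ≤ A * (1 / 2 : ℝ)⁻¹ ^ N := (norm_nonneg _).trans
    (hf.norm_iteratedFDeriv_le (ξ := u) (by norm_num) (by norm_num) (by rw [hu]; norm_num) le_rfl hN)
  refine hmv.trans ?_
  gcongr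
  refine (norm_sub_le _ _).trans ?_
  rw [hu, hv]; norm_num

/-- The segment between nearly opposite directions may come close to the origin. In dimension at
least two there is a unit vector orthogonal to `u` and, up to sign, at no more than a right angle to
`v`; the increment is split there. -/
theorem HomogeneousPhase.norm_fderiv_sub_le {V : Type*} [NormedAddCommGroup V]
    [InnerProductSpace ℝ V] [FiniteDimensional ℝ V] {N : ℕ} {A : ℝ} {f : V → ℝ}
    (hf : HomogeneousPhase N A f) (hN : 2 ≤ N) (hdim : 2 ≤ Module.finrank ℝ V) {ξ ζ : V}
    (hξ : ξ ≠ 0) (hζ : ζ ≠ 0) :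
    ‖fderiv ℝ f ξ - fderiv ℝ f ζ‖ ≤ A * (1 / 2 : ℝ)⁻¹ ^ N * 4 := by
  have hu : ‖‖ξ‖⁻¹ • ξ‖ = 1 := norm_smul_inv_norm (𝕜 := ℝ) hξ
  have hv : ‖‖ζ‖⁻¹ • ζ‖ = 1 := norm_smul_inv_norm (𝕜 := ℝ) hζ
  rw [← hf.fderiv_smul hξ (inv_pos.mpr (norm_pos_iff.mpr hξ)),
    ← hf.fderiv_smul hζ (inv_pos.mpr (norm_pos_iff.mpr hζ))]
  set u := ‖ξ‖⁻¹ • ξ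
  set v := ‖ζ‖⁻¹ • ζ
  obtain ⟨w, hw1, hwu⟩ : ∃ w : V, ‖w‖ = 1 ∧ inner ℝ u w = 0 := by
    have hfr := Submodule.finrank_add_finrank_orthogonal (𝕜 := ℝ) (ℝ ∙ u)
    rw [finrank_span_singleton (norm_pos_iff.mp (by rw [hu]; norm_num))] at hfr
    have hpos : 0 < Module.finrank ℝ ((ℝ ∙ u)ᗮ : Submodule ℝ V) := by omega
    have : Nontrivial ((ℝ ∙ u)ᗮ : Submodule ℝ V) := Module.finrank_pos_iff.mp hpos
    obtain ⟨w, hw⟩ := exists_ne (0 : ((ℝ ∙ u)ᗮ : Submodule ℝ V))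
    have hw0 : (w : V) ≠ 0 := fun h => hw (Subtype.ext h)
    refine ⟨‖(w : V)‖⁻¹ • (w : V), norm_smul_inv_norm (𝕜 := ℝ) hw0, ?_⟩
    rw [inner_smul_right, Submodule.mem_orthogonal_singleton_iff_inner_right.mp w.2, mul_zero]
  obtain ⟨w', hw1', hwu', hwv'⟩ : ∃ w : V, ‖w‖ = 1 ∧ 0 ≤ inner ℝ u w ∧ 0 ≤ inner ℝ v w := by
    rcases le_total 0 (inner ℝ v w) with h | h
    · exact ⟨w, hw1, hwu.ge, h⟩
    · refine ⟨-w, by rwa [norm_neg], ?_, ?_⟩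
      · rw [inner_neg_right, hwu, neg_zero]
      · rw [inner_neg_right]; linarith
  have h1 := hf.norm_fderiv_sub_le_of_inner_nonneg hN hw1' hu (by rw [real_inner_comm]; exact hwu')
  have h2 := hf.norm_fderiv_sub_le_of_inner_nonneg hN hv hw1' hwv'
  calc _ = ‖(fderiv ℝ f u - fderiv ℝ f w') + (fderiv ℝ f w' - fderiv ℝ f v)‖ := by
        rw [sub_add_sub_cancel]
    _ ≤ _ := (norm_add_le _ _).trans (by linarith)

theorem SymbolBound.norm_iteratedFDeriv_le_of_norm_le {V : Type*} [NormedAddCommGroup V]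
    [NormedSpace ℝ V] {N : ℕ} {m ρ A : ℝ} (hρ0 : 0 ≤ ρ) (hρ1 : ρ ≤ 1) {α : V → ℂ}
    (hα : SymbolBound N m ρ A α) {ξ : V} (h : ‖ξ‖ ≤ 5) {k : ℕ} (hk : k ≤ N) :
    ‖iteratedFDeriv ℝ k α ξ‖ ≤ A * 6 ^ (|m| + N) := by
  set b := Real.sqrt (1 + ‖ξ‖ ^ 2) with hb
  have hb1 : 1 ≤ b := Real.one_le_sqrt.mpr (by nlinarith [norm_nonneg ξ])
  have hb2 : b ≤ 6 := by
    rw [hb]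
    refine Real.sqrt_le_iff.mpr ⟨by positivity, ?_⟩
    nlinarith [norm_nonneg ξ]
  have h := hα.bound k hk ξ
  rw [← hb] at h
  have hA : 0 ≤ A := le_trans (by positivity) h
  have h3 : ‖iteratedFDeriv ℝ k α ξ‖ ≤ A * b ^ (-(-m + ρ * k)) := by
    rw [Real.rpow_neg (by linarith), ← div_eq_mul_inv, le_div_iff₀ (by positivity)]; linarith
  refine h3.trans ?_
  gcongr
  refine (rpow_le_six_rpow_abs _ (by linarith) hb2).trans
    (Real.rpow_le_rpow_of_exponent_le (by norm_num) ?_)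
  rw [abs_neg]
  refine (abs_add_le _ _).trans ?_
  rw [abs_neg, abs_mul, abs_of_nonneg hρ0, Nat.abs_cast]
  have : ρ * (k : ℝ) ≤ 1 * (N : ℝ) := by gcongr
  linarith

theorem SymbolBound.derivBound_ball {V : Type*} [NormedAddCommGroup V]
    [NormedSpace ℝ V] {N : ℕ} {m ρ A : ℝ} (hρ0 : 0 ≤ ρ) (hρ1 : ρ ≤ 1) {α : V → ℂ}
    (hα : SymbolBound N m ρ A α) :
    DerivBound N (Metric.ball (0 : V) 5) (A * 6 ^ (|m| + N)) 1 α :=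
  DerivBound.of_contDiffOn Metric.isOpen_ball
    (hα.contDiff.of_le (by exact_mod_cast le_top)).contDiffOn fun k hk ξ hξ => by
      rw [one_pow, mul_one]
      exact hα.norm_iteratedFDeriv_le_of_norm_le hρ0 hρ1 (mem_ball_zero_iff.mp hξ).le hk

theorem SymbolBound.derivBound_mul_cutoff {V : Type*} [NormedAddCommGroup V]
    [NormedSpace ℝ V] {N : ℕ} {m ρ A C : ℝ} (hρ0 : 0 ≤ ρ) (hρ1 : ρ ≤ 1) {α ψ : V → ℂ}
    (hα : SymbolBound N m ρ A α) (hA : 0 ≤ A) (hψ : DerivBound N Set.univ C 1 ψ)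
    (hψs : ∀ v, ψ v ≠ 0 → ‖v‖ ≤ 2) :
    DerivBound N Set.univ (A * 6 ^ (|m| + N) * C) 2 (fun ξ => α ξ * ψ ξ) := by
  have hC : 0 ≤ C := (norm_nonneg _).trans (hψ.norm_le (Set.mem_univ 0))
  have h := (hα.derivBound_ball hρ0 hρ1).mul
    (hψ.mono_set isOpen_univ Metric.isOpen_ball (Set.subset_univ _)) Metric.isOpen_ball
  rw [one_add_one_eq_two] at h
  refine h.extend Metric.isOpen_ball (K := Metric.closedBall 0 2) Metric.isClosed_closedBall
    (Metric.closedBall_subset_ball (by norm_num)) (fun s hs => ?_) (by positivity) zero_le_two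
  by_contra hne
  exact hs (mem_closedBall_zero_iff.mpr (hψs s (right_ne_zero_of_mul hne)))

/-- The symbol of a low-frequency dyadic piece, with the linearised phase removed. -/
noncomputable def lowSymbol {V : Type*} [NormedAddCommGroup V] [NormedSpace ℝ V]
    (f : V → ℝ) (α ψ : V → ℂ) (ζ : V) (l : ℝ) (ξ : V) : ℂ :=
  (Complex.exp (Complex.I * ((f ξ - fderiv ℝ f ζ ξ : ℝ) : ℂ)) - 1) * (α ξ * ψ (l⁻¹ • ξ))

/-- The annulus carrying a dyadic piece. -/
def dyadicAnnulus (V : Type*) [NormedAddCommGroup V] : Set V := {s | 1 / 4 < ‖s‖ ∧ ‖s‖ < 4}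

theorem isOpen_dyadicAnnulus (V : Type*) [NormedAddCommGroup V] : IsOpen (dyadicAnnulus V) :=
  IsOpen.inter (s := {s : V | 1 / 4 < ‖s‖}) (t := {s : V | ‖s‖ < 4})
    (isOpen_lt continuous_const continuous_norm) (isOpen_lt continuous_norm continuous_const)

/-- The phase class does not control `f` or `Df`. Subtracting the linear part leaves `Df(s) - Df(ζ)`
at order one, and Euler's identity turns this into a bound on the values; higher orders are those of
`f`. -/
theorem HomogeneousPhase.derivBound_sub_linear {V : Type*} [NormedAddCommGroup V]
    [NormedSpace ℝ V] {M : ℕ} {A B : ℝ} {f : V → ℝ} (hf : HomogeneousPhase (M + 1) A f)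
    (hA : 0 ≤ A) {ζ : V} (hB : ∀ ξ, ξ ≠ 0 → ‖fderiv ℝ f ξ - fderiv ℝ f ζ‖ ≤ B) (hB0 : 0 ≤ B) :
    DerivBound (M + 1) (dyadicAnnulus V) (4 * B + A * (1 / 4 : ℝ)⁻¹ ^ (M + 1)) 1
      (fun s => f s - fderiv ℝ f ζ s) := by
  have hU := isOpen_dyadicAnnulus V
  have hne : ∀ s ∈ dyadicAnnulus V, s ≠ 0 := fun s hs => norm_pos_iff.mp (by linarith [hs.1])
  have hfd : ∀ s ∈ dyadicAnnulus V, fderiv ℝ (fun s => f s - fderiv ℝ f ζ s) s =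
      fderiv ℝ f s - fderiv ℝ f ζ := fun s hs =>
    ((hf.differentiableAt (hne s hs)).hasFDerivAt.sub (fderiv ℝ f ζ).hasFDerivAt).fderiv
  have hAK : 0 ≤ A * (1 / 4 : ℝ)⁻¹ ^ (M + 1) := by positivity
  refine DerivBound.succ_of_fderiv hU ?_ (fun s hs => ?_) ?_
  · exact ((hf.contDiffOn.mono hne).of_le (by exact_mod_cast le_top)).sub
      (fderiv ℝ f ζ).contDiff.contDiffOn
  · rw [← hf.fderiv_self (hne s hs), ← sub_apply]
    refine (ContinuousLinearMap.le_opNorm _ _).trans ?_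
    have h1 := hB s (hne s hs)
    have h2 := hs.2.le
    calc _ ≤ B * 4 := by gcongr
      _ ≤ _ := by linarith
  · refine DerivBound.congr ?_ hfd
    refine DerivBound.of_contDiffOn hU (((hf.contDiffOn_fderiv.mono hne).of_le
      (by exact_mod_cast le_top)).sub contDiffOn_const) fun k hk s hs => ?_
    rw [one_pow, mul_one]
    rcases Nat.eq_zero_or_pos k with rfl | hk0
    · rw [norm_iteratedFDeriv_zero]
      linarith [hB s (hne s hs)]
    · have hc : ContDiffAt ℝ k (fderiv ℝ f) s :=
        ((hf.contDiffOn_fderiv s (hne s hs)).contDiffAt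
          (isOpen_compl_singleton.mem_nhds (hne s hs))).of_le (by exact_mod_cast le_top)
      have h1 := fun_iteratedFDeriv_sub_apply (i := k) hc (contDiffAt_const (c := fderiv ℝ f ζ))
      rw [h1, iteratedFDeriv_const_of_ne hk0.ne']
      simp only [Pi.zero_apply, sub_zero]
      rw [norm_iteratedFDeriv_fderiv]
      have := hf.norm_iteratedFDeriv_le (r := 1 / 4) (by norm_num) (by norm_num) hs.1.le
        (j := k + 1) (by omega) (by omega)
      linarith

/-- The remainder `θ` satisfies `θ(l s) = l θ(s)`, so `e^{iθ(l s)} - 1` is `l` times a rescaled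
increment of `t ↦ e^{it}` at `0`. The factor `l` makes the low-frequency sum converge. -/
theorem exists_derivBound_lowSymbol (V : Type*) [NormedAddCommGroup V] [NormedSpace ℝ V]
    (M : ℕ) (m ρ A A' B : ℝ) (hρ0 : 0 ≤ ρ) (hρ1 : ρ ≤ 1)
    (hA : 0 ≤ A) (hA' : 0 ≤ A') (hB : 0 ≤ B) (ψ : V → ℂ) {Cψ : ℝ}
    (hψ : DerivBound (M + 1) Set.univ Cψ 1 ψ)
    (hψs : ∀ v, ψ v ≠ 0 → 1 / 2 ≤ ‖v‖ ∧ ‖v‖ ≤ 2) :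
    ∃ C₁ C₂ : ℝ, 0 ≤ C₁ ∧ 1 ≤ C₂ ∧ ∀ (f : V → ℝ) (α : V → ℂ), HomogeneousPhase (M + 1) A f →
      SymbolBound (M + 1) m ρ A' α → ∀ (ζ : V) (l : ℝ),
      (∀ ξ, ξ ≠ 0 → ‖fderiv ℝ f ξ - fderiv ℝ f ζ‖ ≤ B) → 0 < l → l ≤ 1 →
      DerivBound (M + 1) Set.univ (C₁ * l) C₂ (fun s => lowSymbol f α ψ ζ l (l • s)) ∧
      ∀ s ∉ Metric.closedBall (0 : V) 2, lowSymbol f α ψ ζ l (l • s) = 0 := by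
  have hCψ0 : 0 ≤ Cψ := (norm_nonneg _).trans (hψ.norm_le (Set.mem_univ 0))
  set D : ℝ := 4 * B + A * (1 / 4 : ℝ)⁻¹ ^ (M + 1) with hD
  have hD0 : 0 ≤ D := by positivity
  set R : ℝ := D + 1 with hR
  set Φ : ℝ := Nat.cast (M + 1).factorial with hΦ
  have hΦ0 : 0 ≤ Φ := by positivity
  set K : ℝ := A' * 6 ^ (|m| + ((M + 1 : ℕ) : ℝ)) with hK
  have hK0 : 0 ≤ K := by positivity
  refine ⟨Φ * (Φ * (1 * R)) * (K * Cψ), max 1 D + 2, by positivity,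
    by linarith [le_max_left 1 D], fun f α hf hα ζ l hζ hl hl1 => ?_⟩
  have hU := isOpen_dyadicAnnulus V
  have hθ := hf.derivBound_sub_linear hA hζ hB
  rw [← hD] at hθ
  have hE := DerivBound.rescaled_increment (N := M + 1)
    (h := fun t : ℝ => Complex.exp (Complex.I * (t : ℂ))) (Ω := Set.univ)
    (V := Metric.ball (0 : ℝ) R) (A := 1) (R := R) (δ := l) (ζ := (0 : ℝ))
    isOpen_univ convex_univ (derivBound_exp_I_mul _).1 (by omega)
    (fun k _ hk v _ => by
      simpa using (derivBound_exp_I_mul (M + 1)).norm_iteratedFDeriv_le isOpen_univ hk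
        (Set.mem_univ v))
    zero_le_one hl hl1 (Set.mem_univ _) Metric.isOpen_ball (fun _ _ => Set.mem_univ _)
    (fun w hw => (mem_ball_zero_iff.mp hw).le) (by linarith)
  have hEθ := hE.comp Metric.isOpen_ball hU hθ zero_le_one (by positivity)
    (fun s hs => mem_ball_zero_iff.mpr (by linarith [hθ.norm_le hs]))
  have hα1 := (hα.derivBound_ball hρ0 hρ1).comp_clm Metric.isOpen_ball hU
    (l • ContinuousLinearMap.id ℝ V) (K := 1) (fun s hs => by
      rw [mem_ball_zero_iff]
      simp only [smul_apply, ContinuousLinearMap.id_apply, norm_smul, Real.norm_of_nonneg hl.le]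
      have := hs.2
      nlinarith [norm_nonneg s])
    (by
      rw [norm_smul, Real.norm_of_nonneg hl.le]
      exact mul_le_one₀ hl1 (norm_nonneg _) ContinuousLinearMap.norm_id_le) zero_le_one
    (by positivity)
  have hψ1 := hψ.mono_set isOpen_univ hU (Set.subset_univ _)
  have hprod := hEθ.mul (hα1.mul hψ1 hU) hU
  have hsupp : ∀ s : V, s ∉ Metric.closedBall (0 : V) 2 \ Metric.ball (0 : V) (1 / 2) →
      lowSymbol f α ψ ζ l (l • s) = 0 := by
    intro s hs
    by_contra hne
    rw [lowSymbol] at hne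
    have h1 := hψs _ (right_ne_zero_of_mul (right_ne_zero_of_mul hne))
    rw [inv_smul_smul₀ hl.ne'] at h1
    exact hs ⟨mem_closedBall_zero_iff.mpr h1.2, fun h => by
      rw [mem_ball_zero_iff] at h; linarith [h1.1]⟩
  have hfin : DerivBound (M + 1) (dyadicAnnulus V) (Φ * (Φ * (1 * R)) * (K * Cψ) * l)
      (max 1 D + 2) (fun s => lowSymbol f α ψ ζ l (l • s)) := by
    -- The factor `l` is carried as a constant function of scale `0`, so that it leaves the scale of
    -- the product unchanged.
    have h2 := (DerivBound.const (N := M + 1) (μ := 0) (U := dyadicAnnulus V) (l : ℂ) le_rfl hU).mul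
      hprod hU
    refine ((h2.mono_scale ?_ ?_ ?_).mono_const ?_ (le_of_eq ?_)).congr (fun s hs => ?_)
    · positivity
    · positivity
    · linarith
    · positivity
    · rw [Complex.norm_real, Real.norm_of_nonneg hl.le]
      ring
    · have hs0 : s ≠ 0 := norm_pos_iff.mp (by linarith [hs.1])
      have hθl : f (l • s) - fderiv ℝ f ζ (l • s) = 0 + l • (f s - fderiv ℝ f ζ s) := by
        rw [hf.homogeneous s hs0 l hl, map_smul, smul_eq_mul, smul_eq_mul]; ring
      have hlc : (l : ℂ) ≠ 0 := by exact_mod_cast hl.ne'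
      simp only [lowSymbol, hθl, inv_smul_smul₀ hl.ne', smul_apply, ContinuousLinearMap.id_apply]
      rw [Complex.real_smul, Complex.ofReal_inv]
      simp only [Complex.ofReal_zero, mul_zero, Complex.exp_zero]
      field_simp
  refine ⟨hfin.extend hU (K := Metric.closedBall (0 : V) 2 \ Metric.ball (0 : V) (1 / 2))
    (Metric.isClosed_closedBall.sdiff Metric.isOpen_ball) (fun s hs => ?_) hsupp (by positivity)
    (by positivity), fun s hs => hsupp s fun h => hs h.1⟩
  have h1 := mem_closedBall_zero_iff.mp hs.1
  have h2 : 1 / 2 ≤ ‖s‖ := by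
    by_contra h
    exact hs.2 (mem_ball_zero_iff.mpr (not_le.mp h))
  constructor <;> linarith

/-! ### Upper integrals -/

/-- `F` has a measurable majorant with integral at most `Q`. -/
def UpperIntegralLE {X : Type*} [MeasurableSpace X] (P : Measure X) (F : X → ENNReal)
    (Q : ENNReal) : Prop :=
  ∃ D : X → ENNReal, AEMeasurable D P ∧ (∀ᵐ x ∂P, F x ≤ D x) ∧ ∫⁻ x, D x ∂P ≤ Q

namespace UpperIntegralLE

variable {X : Type*} [MeasurableSpace X] {P : Measure X} {F G : X → ENNReal} {Q Q' : ENNReal}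

theorem lintegral_le (h : UpperIntegralLE P F Q) : ∫⁻ x, F x ∂P ≤ Q := by
  obtain ⟨D, -, h2, h3⟩ := h
  exact (lintegral_mono_ae h2).trans h3

theorem mono (h : UpperIntegralLE P F Q) (hG : ∀ᵐ x ∂P, G x ≤ F x) (hQ : Q ≤ Q') :
    UpperIntegralLE P G Q' := by
  obtain ⟨D, h1, h2, h3⟩ := h
  refine ⟨D, h1, ?_, h3.trans hQ⟩
  filter_upwards [h2, hG] with x hx hx' using hx'.trans hx

theorem add (h : UpperIntegralLE P F Q) (h' : UpperIntegralLE P G Q') :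
    UpperIntegralLE P (fun x => F x + G x) (Q + Q') := by
  obtain ⟨D, h1, h2, h3⟩ := h
  obtain ⟨D', h1', h2', h3'⟩ := h'
  refine ⟨fun x => D x + D' x, h1.add h1', ?_, ?_⟩
  · filter_upwards [h2, h2'] with x hx hx' using add_le_add hx hx'
  · rw [lintegral_add_left' h1]; exact add_le_add h3 h3'

theorem const_mul (h : UpperIntegralLE P F Q) (c : ENNReal) :
    UpperIntegralLE P (fun x => c * F x) (c * Q) := by
  obtain ⟨D, h1, h2, h3⟩ := h
  refine ⟨fun x => c * D x, h1.const_mul c, ?_, ?_⟩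
  · filter_upwards [h2] with x hx using by gcongr
  · rw [lintegral_const_mul'' _ h1]; gcongr

/-- The reason for working with majorants: `∫⁻` is not subadditive without measurability, and the
functions `F j` are not assumed measurable. -/
theorem tsum {F : ℕ → X → ENNReal} {Q : ℕ → ENNReal} (h : ∀ j, UpperIntegralLE P (F j) (Q j)) :
    UpperIntegralLE P (fun x => ∑' j, F j x) (∑' j, Q j) := by
  choose D h1 h2 h3 using h
  refine ⟨fun x => ∑' j, D j x, AEMeasurable.tsum h1, ?_, ?_⟩
  · filter_upwards [ae_all_iff.mpr h2] with x hx using ENNReal.tsum_le_tsum hx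
  · rw [lintegral_tsum h1]; exact ENNReal.tsum_le_tsum h3

end UpperIntegralLE

/-! ### Kernel estimates for expanding maps -/

section

variable {n : ℕ}

local notation "𝔼" => EuclideanSpace ℝ (Fin n)

theorem upperIntegralLE_conv_expanding {A : NNReal} {p : 𝔼 → 𝔼} (hp : AEMeasurable p volume)
    (hA : ∀ f : 𝔼 → ENNReal, Measurable f → ∫⁻ x, f (p x) ≤ A * ∫⁻ z, f z)
    {g H : 𝔼 → ENNReal} (hg : Measurable g) (hH : Measurable H) {Q : ENNReal}
    (hQ : ∫⁻ z, H z ≤ Q) :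
    UpperIntegralLE volume (fun x => ∫⁻ y, g y * H (p x - y)) (A * (Q * ∫⁻ y, g y)) := by
  have hG : Measurable fun z : 𝔼 => ∫⁻ y, g y * H (z - y) :=
    Measurable.lintegral_prod_right' (f := fun z : 𝔼 × 𝔼 => g z.2 * H (z.1 - z.2)) (by fun_prop)
  refine ⟨_, hG.comp_aemeasurable hp, Filter.Eventually.of_forall fun x => le_rfl, ?_⟩
  refine (hA _ hG).trans ?_
  rw [lintegral_lintegral_conv_le hg hH]
  gcongr

/-- The integrals in `x` and `ζ` are exchanged and the expanding change of variables is applied for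
each fixed `ζ`. The exchange needs joint measurability of `(x, ζ) ↦ p x ζ`, supplied by a measurable
version. -/
theorem upperIntegralLE_family {A : NNReal} {p : 𝔼 → 𝔼 → 𝔼}
    (hpc : ∀ x, ContinuousOn (p x) {0}ᶜ)
    (hp : ∀ ζ, ζ ≠ 0 → AEMeasurable (fun x => p x ζ) volume)
    (hA : ∀ ζ, ζ ≠ 0 → ∀ f : 𝔼 → ENNReal, Measurable f → ∫⁻ x, f (p x ζ) ≤ A * ∫⁻ z, f z)
    {g : 𝔼 → ENNReal} {H : 𝔼 × 𝔼 → ENNReal} (hg : Measurable g) (hH : Measurable H)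
    {S : Set 𝔼} (hS : MeasurableSet S) (hS0 : ∀ ζ ∈ S, ζ ≠ 0) {Q : ENNReal}
    (hQ : ∀ ζ ∈ S, ∫⁻ z, H (ζ, z) ≤ Q) :
    UpperIntegralLE volume (fun x => ∫⁻ ζ in S, ∫⁻ y, g y * H (ζ, p x ζ - y))
      (A * (Q * ∫⁻ y, g y) * volume S) := by
  obtain ⟨p', hp'm, hp'⟩ := exists_measurable_version (P := (volume : Measure 𝔼))
    (isOpen_compl_singleton (x := (0 : 𝔼))) hpc (fun ζ hζ => hp ζ hζ)
  have hG : Measurable fun q : 𝔼 × 𝔼 => ∫⁻ y, g y * H (q.1, q.2 - y) :=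
    Measurable.lintegral_prod_right'
      (f := fun z : (𝔼 × 𝔼) × 𝔼 => g z.2 * H (z.1.1, z.1.2 - z.2)) (by fun_prop)
  have hGp : Measurable fun q : 𝔼 × 𝔼 => ∫⁻ y, g y * H (q.2, p' (q.2, q.1) - y) := by
    have h1 : Measurable fun q : 𝔼 × 𝔼 => (q.2, p' (q.2, q.1)) :=
      measurable_snd.prodMk (hp'm.comp (measurable_snd.prodMk measurable_fst))
    exact hG.comp h1
  refine ⟨fun x => ∫⁻ ζ in S, ∫⁻ y, g y * H (ζ, p' (ζ, x) - y),
    (Measurable.lintegral_prod_right hGp).aemeasurable, ?_, ?_⟩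
  · filter_upwards [hp'] with x hx
    refine le_of_eq (setLIntegral_congr_fun hS fun ζ hζ => ?_)
    rw [hx ζ (hS0 ζ hζ)]
  · rw [lintegral_lintegral_swap (f := fun x ζ => ∫⁻ y, g y * H (ζ, p' (ζ, x) - y))
      hGp.aemeasurable]
    rw [← setLIntegral_const]
    refine setLIntegral_mono' hS fun ζ hζ => ?_
    have h1 : ∫⁻ x, ∫⁻ y, g y * H (ζ, p' (ζ, x) - y) = ∫⁻ x, ∫⁻ y, g y * H (ζ, p x ζ - y) := by
      refine lintegral_congr_ae ?_
      filter_upwards [hp'] with x hx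
      rw [hx ζ (hS0 ζ hζ)]
    rw [h1]
    have hGζ : Measurable fun z : 𝔼 => ∫⁻ y, g y * H (ζ, z - y) :=
      hG.comp (measurable_const.prodMk measurable_id)
    refine (hA ζ (hS0 ζ hζ) _ hGζ).trans ?_
    have hHζ : Measurable fun z : 𝔼 => H (ζ, z) := hH.comp (measurable_const.prodMk measurable_id)
    rw [lintegral_lintegral_conv_le hg hHζ]
    gcongr
    exact hQ ζ hζ

/-- Used with `t = δ / 8`: the averaging runs over `n`-dimensional `ζ`, and the thinness of the
shell gives back one power of `δ`. -/
theorem exists_volume_shell_le (hn : 1 ≤ n) : ∃ C : ℝ, 0 ≤ C ∧ ∀ t : ℝ, 0 ≤ t → t ≤ 1 / 8 →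
    volume {ζ : 𝔼 | 1 - t ≤ ‖ζ‖ ∧ ‖ζ‖ ≤ 1 + t} ≤ ENNReal.ofReal (C * t) := by
  have : Nonempty (Fin n) := ⟨⟨0, hn⟩⟩
  set v := volume.real (Metric.ball (0 : 𝔼) 1) with hv
  have hv0 : 0 ≤ v := measureReal_nonneg
  refine ⟨2 * (n * 2 ^ (n - 1)) * v, by positivity, fun t ht0 ht1 => ?_⟩
  have hsub : {ζ : 𝔼 | 1 - t ≤ ‖ζ‖ ∧ ‖ζ‖ ≤ 1 + t} ⊆
      Metric.closedBall 0 (1 + t) \ Metric.ball 0 (1 - t) := fun ζ hζ =>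
    ⟨mem_closedBall_zero_iff.mpr hζ.2, fun h => by
      rw [mem_ball_zero_iff] at h; exact absurd hζ.1 (not_le.mpr h)⟩
  refine (measure_mono hsub).trans ?_
  rw [measure_sdiff ((Metric.ball_subset_ball (by linarith)).trans Metric.ball_subset_closedBall)
    Metric.isOpen_ball.measurableSet.nullMeasurableSet measure_ball_lt_top.ne]
  rw [Measure.addHaar_closedBall volume (0 : 𝔼) (r := 1 + t) (by linarith),
    Measure.addHaar_ball volume (0 : 𝔼) (r := 1 - t) (by linarith),
    finrank_euclideanSpace_fin]
  have hvE : volume (Metric.ball (0 : 𝔼) 1) = ENNReal.ofReal v := by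
    rw [hv, ofReal_measureReal measure_ball_lt_top.ne]
  rw [hvE, ← ENNReal.ofReal_mul (by positivity), ← ENNReal.ofReal_mul (pow_nonneg (by linarith) _),
    ← ENNReal.ofReal_sub _ (mul_nonneg (pow_nonneg (by linarith) _) hv0)]
  refine ENNReal.ofReal_le_ofReal ?_
  have h1 : (1 + t) ^ n - (1 - t) ^ n ≤ 2 * t * (n * 2 ^ (n - 1)) := by
    have h2 := abs_pow_sub_pow_le (1 + t) (1 - t) n
    have h3 : |1 + t - (1 - t)| = 2 * t := by
      rw [show 1 + t - (1 - t) = 2 * t by ring, abs_of_nonneg (by linarith)]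
    rw [h3] at h2
    refine (le_abs_self _).trans (h2.trans ?_)
    rw [mul_assoc]
    have : max |1 + t| |1 - t| ≤ 2 := by
      rw [abs_of_nonneg (by linarith), abs_of_nonneg (by linarith)]
      exact max_le (by linarith) (by linarith)
    gcongr
  calc _ = ((1 + t) ^ n - (1 - t) ^ n) * v := by ring
    _ ≤ 2 * t * (n * 2 ^ (n - 1)) * v := by gcongr
    _ = _ := by ring

theorem integrable_of_comp_linearMap {V : Type*} [NormedAddCommGroup V] [InnerProductSpace ℝ V]
    [FiniteDimensional ℝ V] [MeasurableSpace V] [BorelSpace V] {L : V →ₗ[ℝ] V}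
    (hL : LinearMap.det L ≠ 0) {b : V → ℂ} (hb : Integrable (fun s => b (L s))) :
    Integrable b := by
  have he : MeasurableEmbedding L := by
    have := (LinearMap.equivOfDetNeZero L hL).toContinuousLinearEquiv.toHomeomorph.measurableEmbedding
    exact this
  have h1 := (he.integrable_map_iff (μ := volume) (g := b)).mpr hb
  rw [Measure.map_linearMap_addHaar_eq_smul_addHaar volume hL] at h1
  refine (integrable_smul_measure ?_ ENNReal.ofReal_ne_top).mp h1
  have : 0 < |(LinearMap.det L)⁻¹| := abs_pos.mpr (inv_ne_zero hL)
  exact (ENNReal.ofReal_pos.mpr this).ne'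

/-- Pointwise bound for a wave packet whose symbol is controlled in linear coordinates. -/
theorem exists_enorm_packet_le (V : Type*) [NormedAddCommGroup V] [InnerProductSpace ℝ V]
    [FiniteDimensional ℝ V] [MeasurableSpace V] [BorelSpace V] (N : ℕ) (R : ℝ) :
    ∃ C : ℝ, 0 ≤ C ∧ ∀ (L : V →ₗ[ℝ] V) (b : V → ℂ) (K μ : ℝ) (u : V → ℂ), LinearMap.det L ≠ 0 →
      (∀ x y, inner ℝ (L x) y = inner ℝ x (L y)) → 0 ≤ K → 1 ≤ μ →
      DerivBound N Set.univ K μ (fun s => b (L s)) →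
      (∀ s ∉ Metric.closedBall (0 : V) R, b (L s) = 0) → Integrable u → ∀ p : V,
      ‖∫ ξ, Complex.exp (Complex.I * ((inner ℝ p ξ : ℝ) : ℂ)) * b ξ *
        ∫ y, Complex.exp (-(Complex.I * ((inner ℝ y ξ : ℝ) : ℂ))) * u y‖ₑ
      ≤ ∫⁻ y, ‖u y‖ₑ * packetKernel L N (C * K) μ (p - y) := by
  obtain ⟨C, hC0, hC⟩ := exists_fourier_decay V N R
  refine ⟨C, hC0, fun L b K μ u hL hsymm hK hμ hb hsupp hu p => ?_⟩
  have hcd : ContDiff ℝ N (fun s => b (L s)) := contDiffOn_univ.mp hb.1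
  have hint : Integrable (fun s => b (L s)) :=
    hcd.continuous.integrable_of_hasCompactSupport
      (HasCompactSupport.intro (isCompact_closedBall (0 : V) R) hsupp)
  exact enorm_packet_le hL hsymm (by linarith) (integrable_of_comp_linearMap hL hint)
    (fun w => hC _ K μ hK hμ hb hsupp w) hu p

/-! ### High-frequency pieces -/

theorem integral_direction_cutoff (χ : 𝔼 → ℝ) {δ : ℝ} (hδ : 0 < δ) (q : 𝔼) :
    ∫ ζ, χ (δ⁻¹ • (q - ζ)) = δ ^ n * ∫ z, χ z := by
  rw [integral_sub_left_eq_self (fun z => χ (δ⁻¹ • z)) volume q, Measure.integral_comp_smul,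
    finrank_euclideanSpace_fin, inv_pow, inv_inv, abs_of_pos (by positivity), smul_eq_mul]

/-- A continuous partition of unity: for each `ξ ≠ 0` the cutoff integrates over `ζ` to `c₀ δ ^ n`,
whatever the direction of `ξ`, and only `ζ` within `δ / 8` of the unit sphere contribute. It
replaces a choice of `δ`-separated directions. -/
theorem enorm_integral_le_of_direction_partition (hn : 1 ≤ n) {χ : 𝔼 → ℝ} (hχ : Continuous χ)
    (hχ1 : ∀ z, |χ z| ≤ 1) (hχs : ∀ z, χ z ≠ 0 → ‖z‖ ≤ 1 / 8) {c₀ : ℝ} (hc₀ : 0 < c₀)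
    (hχi : ∫ z, χ z = c₀) {δ : ℝ} (hδ : 0 < δ) (hδ1 : δ ≤ 1) {g : 𝔼 → ℂ} (hg : Integrable g) :
    ‖∫ ξ, g ξ‖ₑ ≤ ENNReal.ofReal (c₀ * δ ^ n)⁻¹ *
      ∫⁻ ζ in {ζ : 𝔼 | 1 - δ / 8 ≤ ‖ζ‖ ∧ ‖ζ‖ ≤ 1 + δ / 8},
        ‖∫ ξ, g ξ * (χ (δ⁻¹ • (‖ξ‖⁻¹ • ξ - ζ)) : ℂ)‖ₑ := by
  have : Nonempty (Fin n) := ⟨⟨0, hn⟩⟩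
  set S := {ζ : 𝔼 | 1 - δ / 8 ≤ ‖ζ‖ ∧ ‖ζ‖ ≤ 1 + δ / 8} with hS
  have hSm : MeasurableSet S :=
    (measurableSet_le measurable_const measurable_norm).inter
      (measurableSet_le measurable_norm measurable_const)
  have hne : ∀ᵐ ξ : 𝔼, ξ ≠ 0 := by
    rw [ae_iff]; simp
  have hsupp : ∀ ξ : 𝔼, ξ ≠ 0 → ∀ ζ, χ (δ⁻¹ • (‖ξ‖⁻¹ • ξ - ζ)) ≠ 0 → ζ ∈ S := by
    intro ξ hξ ζ h
    have h1 := hχs _ h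
    rw [norm_smul, norm_inv, Real.norm_of_nonneg hδ.le, inv_mul_le_iff₀ hδ] at h1
    have h2 : ‖‖ξ‖⁻¹ • ξ‖ = 1 := norm_smul_inv_norm (𝕜 := ℝ) hξ
    have h3 := norm_sub_norm_le (‖ξ‖⁻¹ • ξ) ζ
    have h4 := norm_sub_norm_le ζ (‖ξ‖⁻¹ • ξ)
    rw [norm_sub_rev] at h4
    rw [h2] at h3 h4
    constructor <;> linarith
  -- Fubini is justified by the majorant `‖g ξ‖` times the indicator of `‖ζ‖ ≤ 2`.
  have hI : Integrable (Function.uncurry fun (ξ ζ : 𝔼) =>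
      g ξ * (χ (δ⁻¹ • (‖ξ‖⁻¹ • ξ - ζ)) : ℂ)) (volume.prod volume) := by
    have h1 : Integrable ((Metric.closedBall (0 : 𝔼) 2).indicator fun _ => (1 : ℝ)) :=
      (integrable_indicator_iff measurableSet_closedBall).mpr
        (integrableOn_const measure_closedBall_lt_top.ne)
    refine (hg.norm.mul_prod h1).mono' ?_ ?_
    · refine hg.aestronglyMeasurable.comp_fst.mul (Measurable.aestronglyMeasurable ?_)
      exact Complex.measurable_ofReal.comp (hχ.measurable.comp (by fun_prop))
    · have h2 : ∀ᵐ z : 𝔼 × 𝔼 ∂(volume.prod volume), z.1 ≠ 0 :=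
        Measure.quasiMeasurePreserving_fst.ae hne
      filter_upwards [h2] with z hz
      simp only [Function.uncurry]
      rw [norm_mul, Complex.norm_real]
      by_cases h0 : χ (δ⁻¹ • (‖z.1‖⁻¹ • z.1 - z.2)) = 0
      · rw [h0, norm_zero, mul_zero]
        exact mul_nonneg (norm_nonneg _) (Set.indicator_nonneg (fun _ _ => zero_le_one) _)
      · have h3 := hsupp z.1 hz z.2 h0
        rw [Set.indicator_of_mem (mem_closedBall_zero_iff.mpr (by linarith [h3.2]))]
        gcongr
        exact hχ1 _
  have hcd : 0 < c₀ * δ ^ n := by positivity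
  have hrep : ∫ ξ, g ξ = (((c₀ * δ ^ n)⁻¹ : ℝ) : ℂ) *
      ∫ ζ, ∫ ξ, g ξ * (χ (δ⁻¹ • (‖ξ‖⁻¹ • ξ - ζ)) : ℂ) := by
    rw [← integral_integral_swap hI, ← integral_const_mul]
    refine integral_congr_ae (Filter.Eventually.of_forall fun ξ => ?_)
    simp only
    rw [integral_const_mul, integral_complex_ofReal, integral_direction_cutoff χ hδ, hχi]
    have h1 : (c₀ : ℂ) ≠ 0 := by exact_mod_cast hc₀.ne'
    have h2 : (δ : ℂ) ≠ 0 := by exact_mod_cast hδ.ne'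
    push_cast
    field_simp
  rw [hrep, enorm_mul]
  have h1 : ‖(((c₀ * δ ^ n)⁻¹ : ℝ) : ℂ)‖ₑ = ENNReal.ofReal (c₀ * δ ^ n)⁻¹ := by
    rw [← ofReal_norm, Complex.norm_real, Real.norm_of_nonneg (by positivity)]
  rw [h1]
  gcongr
  refine (enorm_integral_le_lintegral_enorm _).trans ?_
  rw [← lintegral_indicator hSm]
  refine lintegral_mono fun ζ => ?_
  by_cases hζ : ζ ∈ S
  · rw [Set.indicator_of_mem hζ]
  · rw [Set.indicator_of_notMem hζ]
    have : ∫ ξ, g ξ * (χ (δ⁻¹ • (‖ξ‖⁻¹ • ξ - ζ)) : ℂ) = 0 := by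
      refine integral_eq_zero_of_ae ?_
      filter_upwards [hne] with ξ hξ
      have : χ (δ⁻¹ • (‖ξ‖⁻¹ • ξ - ζ)) = 0 := by
        by_contra h
        exact hζ (hsupp ξ hξ ζ h)
      simp [this]
    rw [this, enorm_zero]

/-- The kernel majorant of a high-frequency packet, jointly in direction and position. -/
noncomputable def directionKernel (δ l K μ : ℝ) (q : 𝔼 × 𝔼) : ENNReal :=
  ENNReal.ofReal (|l ^ n * (δ ^ n * δ⁻¹)| * K *
    ((1 + ‖l • (δ • q.2 + ((1 - δ) * ((‖q.1‖ ^ 2)⁻¹ * inner ℝ q.1 q.2)) • q.1)‖ / μ) ^ (n + 1))⁻¹)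

theorem measurable_directionKernel (δ l K μ : ℝ) :
    Measurable (directionKernel (n := n) δ l K μ) := by
  unfold directionKernel
  fun_prop

theorem det_smul_axisScale {ζ : 𝔼} (hζ : ζ ≠ 0) {δ : ℝ} (hδ : δ ≠ 0) (l : ℝ) :
    LinearMap.det ((l • axisScale ζ δ : 𝔼 →L[ℝ] 𝔼) : 𝔼 →ₗ[ℝ] 𝔼) = l ^ n * (δ ^ n * δ⁻¹) := by
  rw [ContinuousLinearMap.toLinearMap_smul, LinearMap.det_smul, det_axisScale hζ hδ,
    finrank_euclideanSpace_fin]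

/-- The explicit formula makes measurability in `(ζ, z)` evident; for `ζ ≠ 0` it is the kernel of
the packet. -/
theorem directionKernel_eq {ζ : 𝔼} (hζ : ζ ≠ 0) {δ : ℝ} (hδ : δ ≠ 0) (l K μ : ℝ) (z : 𝔼) :
    directionKernel δ l K μ (ζ, z) =
      packetKernel ((l • axisScale ζ δ : 𝔼 →L[ℝ] 𝔼) : 𝔼 →ₗ[ℝ] 𝔼) (n + 1) K μ z := by
  rw [packetKernel, det_smul_axisScale hζ hδ, directionKernel, ContinuousLinearMap.coe_coe,
    smul_apply, axisScale_eq, axisCoord_apply]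

/-- Each packet contributes `l ^ m * μ ^ n` with `μ ~ l ^ (1 - ρ)`, and the average over directions
contributes `δ ^ (-n) * δ`. -/
theorem exists_high_piece_bound (hn : 1 ≤ n) {m ρ A A' c : ℝ} (hρ0 : 0 ≤ ρ) (hρ1 : ρ ≤ 1)
    (hA : 0 ≤ A) (hA' : 0 ≤ A') (hc : 0 < c) {a : 𝔼 → 𝔼 → ℂ} {φ : 𝔼 → 𝔼 → ℝ}
    (hφ : ∀ᵐ x, HomogeneousPhase (n + 1) A (φ x))
    (ha : ∀ᵐ x, SymbolBound (n + 1) m ρ A' (a x))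
    (hpc : ∀ x, ContinuousOn (gradient (φ x)) {0}ᶜ)
    (hp : ∀ ζ, ζ ≠ 0 → AEMeasurable (fun x => gradient (φ x) ζ) volume)
    (hexp : ∀ x y ζ, ζ ≠ 0 → c * ‖x - y‖ ≤ ‖gradient (φ x) ζ - gradient (φ y) ζ‖)
    {ψ : 𝔼 → ℂ} {Cψ : ℝ} (hψ : DerivBound (n + 1) Set.univ Cψ 1 ψ)
    (hψs : ∀ v, ψ v ≠ 0 → 1 / 2 ≤ ‖v‖ ∧ ‖v‖ ≤ 2) :
    ∃ C : ℝ, 0 ≤ C ∧ ∀ (u : 𝔼 → ℂ) (l : ℝ), Continuous u → Integrable u → 1 ≤ l →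
      (∀ᵐ x, Integrable (fioIntegrand a φ u x)) →
      UpperIntegralLE volume (fun x => ‖∫ ξ, fioIntegrand a φ u x ξ * ψ (l⁻¹ • ξ)‖ₑ)
        (ENNReal.ofReal (C * l ^ (m + ((n : ℝ) - 1) / 2 + n * (1 - ρ))) * ∫⁻ y, ‖u y‖ₑ) := by
  let χ : ContDiffBump (0 : 𝔼) := ⟨1 / 16, 1 / 8, by norm_num, by norm_num⟩
  have hχs : ∀ z, χ z ≠ 0 → ‖z‖ ≤ 1 / 8 := fun z hz => by
    have : z ∈ Function.support χ := hz
    rw [χ.support_eq, mem_ball_zero_iff] at this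
    exact this.le
  have hχcd : ContDiff ℝ (n + 1 : ℕ) (fun z => ((χ z : ℝ) : ℂ)) :=
    Complex.ofRealCLM.contDiff.comp χ.contDiff
  obtain ⟨Cχ, -, hχd⟩ := DerivBound.of_hasCompactSupport hχcd
    (χ.hasCompactSupport.comp_left (g := fun t : ℝ => (t : ℂ)) Complex.ofReal_zero)
  obtain ⟨C₁, C₂, hC₁, hC₂, hsym⟩ := exists_derivBound_highSymbol 𝔼 n hn m ρ A A' hρ0 hρ1 hA hA' ψ
    (fun z => ((χ z : ℝ) : ℂ)) hψ hχd hψs (fun z hz => hχs z (by exact_mod_cast hz))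
  obtain ⟨CF, hCF0, hCF⟩ := exists_enorm_packet_le 𝔼 (n + 1) 5
  obtain ⟨J, hJ0, hJ⟩ := exists_lintegral_packetKernel_le 𝔼
  rw [finrank_euclideanSpace_fin] at hJ
  obtain ⟨Aexp, hAexp⟩ := exists_lintegral_comp_le_of_expanding n c hc
  obtain ⟨Cs, hCs0, hCs⟩ := exists_volume_shell_le hn
  have hc₀ : 0 < ∫ z, χ z := χ.integral_pos
  set c₀ := ∫ z, χ z with hc₀def
  refine ⟨c₀⁻¹ * (Aexp * (J * (CF * C₁ * C₂ ^ n)) * (Cs * (1 / 8))), by positivity,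
    fun u l hu hui hl hint => ?_⟩
  have hl0 : 0 < l := by linarith
  -- The aperture with `δ ^ 2 * l = 1`: the largest, up to constants, for which the second-order
  -- phase remainder stays bounded.
  set δ : ℝ := l ^ (-(1 / 2) : ℝ) with hδdef
  have hδ : 0 < δ := by positivity
  have hδ1 : δ ≤ 1 := Real.rpow_le_one_of_one_le_of_nonpos hl (by norm_num)
  have hδl : δ ^ 2 * l = 1 := by
    rw [hδdef, ← Real.rpow_natCast, ← Real.rpow_mul hl0.le]
    norm_num
    rw [Real.rpow_neg_one, inv_mul_cancel₀ hl0.ne']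
  set K : ℝ := CF * (C₁ * l ^ m) with hK
  have hK0 : 0 ≤ K := by positivity
  set μ : ℝ := C₂ * l ^ (1 - ρ) with hμ
  have hμ1 : 1 ≤ μ := one_le_mul_of_one_le_of_one_le hC₂ (Real.one_le_rpow hl (by linarith))
  set S := {ζ : 𝔼 | 1 - δ / 8 ≤ ‖ζ‖ ∧ ‖ζ‖ ≤ 1 + δ / 8} with hS
  have hSm : MeasurableSet S :=
    (measurableSet_le measurable_const measurable_norm).inter
      (measurableSet_le measurable_norm measurable_const)
  have hS7 : ∀ ζ ∈ S, 7 / 8 ≤ ‖ζ‖ := fun ζ hζ => by linarith [hζ.1]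
  have hS9 : ∀ ζ ∈ S, ‖ζ‖ ≤ 9 / 8 := fun ζ hζ => by linarith [hζ.2]
  have hS0 : ∀ ζ ∈ S, ζ ≠ 0 := fun ζ hζ => norm_pos_iff.mp (by linarith [hS7 ζ hζ])
  have hdet : ∀ ζ ∈ S, LinearMap.det ((l • axisScale ζ δ : 𝔼 →L[ℝ] 𝔼) : 𝔼 →ₗ[ℝ] 𝔼) ≠ 0 :=
    fun ζ hζ => by rw [det_smul_axisScale (hS0 ζ hζ) hδ.ne']; positivity
  have hfam := upperIntegralLE_family (A := Aexp) (p := fun x => gradient (φ x)) hpc hp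
    (fun ζ hζ f hf => hAexp _ (hp ζ hζ) (fun x y => hexp x y ζ hζ) f hf)
    (g := fun y => ‖u y‖ₑ) (H := directionKernel δ l K μ) hu.measurable.enorm
    (measurable_directionKernel δ l K μ) hSm hS0 (Q := ENNReal.ofReal (J * (K * μ ^ n)))
    (fun ζ hζ => by
      simp_rw [directionKernel_eq (hS0 ζ hζ) hδ.ne']
      exact hJ _ K μ (hdet ζ hζ) hK0 (by linarith))
  refine (hfam.const_mul (ENNReal.ofReal (c₀ * δ ^ n)⁻¹)).mono ?_ ?_
  · filter_upwards [hφ, ha, hint] with x hφx hax hix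
    have hψb : ∀ v, ‖ψ v‖ ≤ Cψ := fun v => hψ.norm_le (Set.mem_univ v)
    have hψc : Continuous ψ := (contDiffOn_univ.mp hψ.1).continuous
    have hgi : Integrable (fun ξ => fioIntegrand a φ u x ξ * ψ (l⁻¹ • ξ)) :=
      hix.mul_bdd (c := Cψ) (by fun_prop)
        (Filter.Eventually.of_forall fun ξ => hψb _)
    refine (enorm_integral_le_of_direction_partition hn χ.continuous
      (fun z => by rw [abs_of_nonneg χ.nonneg]; exact χ.le_one) hχs hc₀ hc₀def.symm hδ hδ1 hgi).trans ?_
    refine mul_le_mul' le_rfl (setLIntegral_mono' hSm fun ζ hζ => ?_)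
    have hs := hsym (φ x) (a x) hφx hax ζ δ l (hS7 ζ hζ) (hS9 ζ hζ) hδ hδ1 hl hδl
    have hpk := hCF ((l • axisScale ζ δ : 𝔼 →L[ℝ] 𝔼) : 𝔼 →ₗ[ℝ] 𝔼)
      (highSymbol (φ x) (a x) ψ (fun z => ((χ z : ℝ) : ℂ)) ζ δ l) (C₁ * l ^ m) μ u (hdet ζ hζ)
      (fun y z => by
        simp only [ContinuousLinearMap.coe_coe, smul_apply, inner_smul_left, inner_smul_right,
          axisScale_symm, conj_trivial]) (by positivity) hμ1 hs.1 hs.2 hui (gradient (φ x) ζ)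
    simp_rw [directionKernel_eq (hS0 ζ hζ) hδ.ne']
    refine le_trans (le_of_eq ?_) hpk
    congr 2 with ξ
    rw [fioIntegrand, highSymbol, fourierHat, inner_gradient_eq_fderiv]
    -- The linear part of the phase becomes the base point `∇φ(x, ζ)` of the packet; the remainder
    -- goes into the symbol.
    have : Complex.exp (Complex.I * (φ x ξ : ℂ)) =
        Complex.exp (Complex.I * ((fderiv ℝ (φ x) ζ ξ : ℝ) : ℂ)) *
        Complex.exp (Complex.I * ((φ x ξ - fderiv ℝ (φ x) ζ ξ : ℝ) : ℂ)) := by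
      rw [← Complex.exp_add]; congr 1; push_cast; ring
    rw [this]; ring
  · have hvol := hCs (δ / 8) (by positivity) (by linarith)
    calc _ ≤ ENNReal.ofReal (c₀ * δ ^ n)⁻¹ * (Aexp * (ENNReal.ofReal (J * (K * μ ^ n)) *
          ∫⁻ y, ‖u y‖ₑ) * ENNReal.ofReal (Cs * (δ / 8))) := by gcongr
      _ = ENNReal.ofReal ((c₀ * δ ^ n)⁻¹ * (Aexp * (J * (K * μ ^ n)) * (Cs * (δ / 8)))) *
          ∫⁻ y, ‖u y‖ₑ := by
        rw [ENNReal.ofReal_mul (p := (c₀ * δ ^ n)⁻¹) (by positivity),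
          ENNReal.ofReal_mul (p := Aexp * (J * (K * μ ^ n))) (by positivity),
          ENNReal.ofReal_mul (p := (Aexp : ℝ)) (by positivity), ENNReal.ofReal_coe_nnreal]
        ring
      _ = _ := by
        congr 2
        -- Normalisation of the average against the thickness of the shell: the source of the loss
        -- `(n - 1) / 2`.
        have h1 : (δ ^ n)⁻¹ * δ = l ^ (((n : ℝ) - 1) / 2) := by
          rw [hδdef, ← Real.rpow_natCast, ← Real.rpow_mul hl0.le, ← Real.rpow_neg hl0.le,
            ← Real.rpow_add hl0]
          congr 1; ring
        have h2 : (l ^ (1 - ρ)) ^ n = l ^ ((n : ℝ) * (1 - ρ)) := by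
          rw [← Real.rpow_natCast, ← Real.rpow_mul hl0.le]
          congr 1; ring
        rw [Real.rpow_add hl0, Real.rpow_add hl0, ← h1, ← h2, hK, hμ, mul_pow, mul_inv]
        ring

/-! ### Packets with a fixed direction and dyadic sums -/

/-- With the direction fixed, the isotropic dilation by `l` serves as `L`, and its determinant
disappears from the `L¹` norm of the kernel. -/
theorem exists_fixed_direction_bound (n : ℕ) (c R : ℝ) (hc : 0 < c) :
    ∃ C : ℝ, 0 ≤ C ∧ ∀ (p : EuclideanSpace ℝ (Fin n) → EuclideanSpace ℝ (Fin n))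
      (b : EuclideanSpace ℝ (Fin n) → EuclideanSpace ℝ (Fin n) → ℂ)
      (u : EuclideanSpace ℝ (Fin n) → ℂ) (l K μ : ℝ), AEMeasurable p volume →
      (∀ x y, c * ‖x - y‖ ≤ ‖p x - p y‖) → Continuous u → Integrable u → 0 < l → 0 ≤ K → 1 ≤ μ →
      (∀ᵐ x, DerivBound (n + 1) Set.univ K μ (fun s => b x (l • s)) ∧
        ∀ s ∉ Metric.closedBall (0 : EuclideanSpace ℝ (Fin n)) R, b x (l • s) = 0) →
      UpperIntegralLE volume (fun x => ‖∫ ξ, Complex.exp (Complex.I * ((inner ℝ (p x) ξ : ℝ) : ℂ)) *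
          b x ξ * fourierHat u ξ‖ₑ)
        (ENNReal.ofReal (C * (K * μ ^ n)) * ∫⁻ y, ‖u y‖ₑ) := by
  obtain ⟨CF, hCF0, hCF⟩ := exists_enorm_packet_le (EuclideanSpace ℝ (Fin n)) (n + 1) R
  obtain ⟨J, hJ0, hJ⟩ := exists_lintegral_packetKernel_le (EuclideanSpace ℝ (Fin n))
  rw [finrank_euclideanSpace_fin] at hJ
  obtain ⟨A, hA⟩ := exists_lintegral_comp_le_of_expanding n c hc
  refine ⟨A * (J * CF), by positivity, fun p b u l K μ hp hexp hu hui hl hK hμ hb => ?_⟩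
  set L : EuclideanSpace ℝ (Fin n) →ₗ[ℝ] EuclideanSpace ℝ (Fin n) := l • LinearMap.id with hL
  have hdet : LinearMap.det L ≠ 0 := by
    rw [hL, LinearMap.det_smul, LinearMap.det_id]; positivity
  have h := upperIntegralLE_conv_expanding hp (hA p hp hexp) (g := fun y => ‖u y‖ₑ)
    hu.measurable.enorm (measurable_packetKernel L (n + 1) (CF * K) μ)
    (hJ L (CF * K) μ hdet (by positivity) (by linarith))
  refine h.mono ?_ (le_of_eq ?_)
  · filter_upwards [hb] with x hx
    exact hCF L (b x) K μ u hdet (fun y z => by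
      simp [hL, inner_smul_left, inner_smul_right]) hK hμ hx.1 hx.2 hui (p x)
  · rw [← mul_assoc, ← ENNReal.ofReal_coe_nnreal, ← ENNReal.ofReal_mul (NNReal.coe_nonneg A)]
    congr 2
    ring

/-- Dominated convergence for the partial sums, whose uniform bound `B` replaces absolute
convergence of the series. A single term is a difference of partial sums, hence bounded by `B + B`.
-/
theorem enorm_integral_mul_le_tsum {V : Type*} [NormedAddCommGroup V] [MeasurableSpace V]
    [BorelSpace V] {P : Measure V} {g : V → ℂ} (hg : Integrable g P) {κ : ℕ → V → ℂ} {k : V → ℂ}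
    (hκ : ∀ j, Continuous (κ j)) {B : ℝ} (hb : ∀ J ξ, ‖∑ j ∈ Finset.range J, κ j ξ‖ ≤ B)
    (hlim : ∀ᵐ ξ ∂P, Filter.Tendsto (fun J => ∑ j ∈ Finset.range J, κ j ξ) Filter.atTop
      (nhds (k ξ))) :
    ‖∫ ξ, g ξ * k ξ ∂P‖ₑ ≤ ∑' j, ‖∫ ξ, g ξ * κ j ξ ∂P‖ₑ := by
  have hκb : ∀ j ξ, ‖κ j ξ‖ ≤ B + B := fun j ξ => by
    have : κ j ξ = ∑ i ∈ Finset.range (j + 1), κ i ξ - ∑ i ∈ Finset.range j, κ i ξ := by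
      rw [Finset.sum_range_succ]; ring
    rw [this]
    exact (norm_sub_le _ _).trans (add_le_add (hb _ _) (hb _ _))
  have hint : ∀ j, Integrable (fun ξ => g ξ * κ j ξ) P := fun j =>
    hg.mul_bdd (c := B + B) (hκ j).aestronglyMeasurable
      (Filter.Eventually.of_forall fun ξ => hκb j ξ)
  have hT : Filter.Tendsto (fun J => ∫ ξ, g ξ * ∑ j ∈ Finset.range J, κ j ξ ∂P) Filter.atTop
      (nhds (∫ ξ, g ξ * k ξ ∂P)) := by
    refine tendsto_integral_of_dominated_convergence (fun ξ => ‖g ξ‖ * B) (fun J => ?_)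
      (hg.norm.mul_const B) (fun J => Filter.Eventually.of_forall fun ξ => ?_) ?_
    · exact hg.aestronglyMeasurable.mul
        (continuous_finsetSum _ fun j _ => hκ j).aestronglyMeasurable
    · rw [norm_mul]
      exact mul_le_mul_of_nonneg_left (hb J ξ) (norm_nonneg _)
    · filter_upwards [hlim] with ξ hξ using hξ.const_mul _
  refine le_of_tendsto hT.enorm (Filter.Eventually.of_forall fun J => ?_)
  simp_rw [Finset.mul_sum]
  rw [integral_finsetSum _ fun j _ => hint j]
  exact (enorm_sum_le _ _).trans (ENNReal.sum_le_tsum _)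

/-- The dyadic annular cutoff generated by a bump function. -/
noncomputable def dyadicCutoff {V : Type*} [NormedAddCommGroup V] [NormedSpace ℝ V]
    (Ψ : V → ℂ) (v : V) : ℂ := Ψ v - Ψ ((2 : ℝ) • v)

section

variable {V : Type*} [NormedAddCommGroup V] [NormedSpace ℝ V] {Ψ : V → ℂ}

theorem dyadicCutoff_support (h1 : ∀ v, ‖v‖ ≤ 1 → Ψ v = 1) (h2 : ∀ v, Ψ v ≠ 0 → ‖v‖ ≤ 2)
    {v : V} (hv : dyadicCutoff Ψ v ≠ 0) : 1 / 2 ≤ ‖v‖ ∧ ‖v‖ ≤ 2 := by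
  have hn : ‖(2 : ℝ) • v‖ = 2 * ‖v‖ := by rw [norm_smul]; norm_num
  rw [dyadicCutoff] at hv
  constructor
  · by_contra h
    refine hv ?_
    rw [h1 v (by linarith), h1 _ (by linarith), sub_self]
  · by_contra h
    refine hv ?_
    have hz : ∀ w : V, 2 < ‖w‖ → Ψ w = 0 := fun w hw => by
      by_contra hne; linarith [h2 w hne]
    rw [hz v (by linarith), hz _ (by linarith), sub_self]

theorem sum_dyadicCutoff_low (J : ℕ) (ξ : V) :
    ∑ j ∈ Finset.range J, dyadicCutoff Ψ (((1 / 2 : ℝ) ^ j)⁻¹ • ξ) =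
      Ψ ξ - Ψ (((1 / 2 : ℝ) ^ J)⁻¹ • ξ) := by
  induction J with
  | zero => simp
  | succ J ih =>
    rw [Finset.sum_range_succ, ih, dyadicCutoff, smul_smul]
    have : (2 : ℝ) * ((1 / 2 : ℝ) ^ J)⁻¹ = ((1 / 2 : ℝ) ^ (J + 1))⁻¹ := by
      rw [pow_succ]; field_simp
    rw [this]; ring

/-- The sum telescopes. With the shift to `j + 1` the first term is `Ψ(ξ/2) - Ψ(ξ)`, so the high
pieces start where the low-frequency cutoff ends. -/
theorem sum_dyadicCutoff_high (J : ℕ) (ξ : V) :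
    ∑ j ∈ Finset.range J, dyadicCutoff Ψ (((2 : ℝ) ^ (j + 1))⁻¹ • ξ) =
      Ψ (((2 : ℝ) ^ J)⁻¹ • ξ) - Ψ ξ := by
  induction J with
  | zero => simp
  | succ J ih =>
    rw [Finset.sum_range_succ, ih, dyadicCutoff, smul_smul]
    have : (2 : ℝ) * ((2 : ℝ) ^ (J + 1))⁻¹ = ((2 : ℝ) ^ J)⁻¹ := by
      rw [pow_succ]; field_simp
    rw [this]; ring

/-- The origin is excluded because every summand vanishes there. -/
theorem tendsto_sum_dyadicCutoff_low (h2 : ∀ v, Ψ v ≠ 0 → ‖v‖ ≤ 2) {ξ : V} (hξ : ξ ≠ 0) :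
    Filter.Tendsto (fun J => ∑ j ∈ Finset.range J, dyadicCutoff Ψ (((1 / 2 : ℝ) ^ j)⁻¹ • ξ))
      Filter.atTop (nhds (Ψ ξ)) := by
  simp_rw [sum_dyadicCutoff_low]
  have h3 : Filter.Tendsto (fun J : ℕ => (2 : ℝ) ^ J * ‖ξ‖) Filter.atTop Filter.atTop :=
    (tendsto_pow_atTop_atTop_of_one_lt one_lt_two).atTop_mul_const (norm_pos_iff.mpr hξ)
  refine tendsto_const_nhds.congr' ?_
  filter_upwards [h3.eventually_gt_atTop 2] with J hJ
  have : Ψ (((1 / 2 : ℝ) ^ J)⁻¹ • ξ) = 0 := by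
    by_contra hne
    have := h2 _ hne
    rw [norm_smul, norm_inv, norm_pow, one_div, norm_inv, Real.norm_ofNat, inv_pow, inv_inv] at this
    linarith
  rw [this, sub_zero]

theorem tendsto_sum_dyadicCutoff_high (h1 : ∀ v, ‖v‖ ≤ 1 → Ψ v = 1) (ξ : V) :
    Filter.Tendsto (fun J => ∑ j ∈ Finset.range J, dyadicCutoff Ψ (((2 : ℝ) ^ (j + 1))⁻¹ • ξ))
      Filter.atTop (nhds (1 - Ψ ξ)) := by
  simp_rw [sum_dyadicCutoff_high]
  have h3 : Filter.Tendsto (fun J : ℕ => (2 : ℝ) ^ J) Filter.atTop Filter.atTop :=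
    tendsto_pow_atTop_atTop_of_one_lt one_lt_two
  refine tendsto_const_nhds.congr' ?_
  filter_upwards [h3.eventually_ge_atTop ‖ξ‖] with J hJ
  rw [h1 (((2 : ℝ) ^ J)⁻¹ • ξ)]
  rw [norm_smul, norm_inv, norm_pow, Real.norm_ofNat, inv_mul_le_iff₀ (by positivity)]
  linarith

end

/-! ### The Fourier transform of a Schwartz function -/

theorem fourierHat_eq (u : 𝓢(𝔼, ℂ)) :
    ∃ g : 𝓢(𝔼, ℂ), ∀ ξ, fourierHat u ξ = g ξ := by
  have hpi : ((2 * Real.pi)⁻¹ : ℝ) ≠ 0 := by positivity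
  let e : 𝔼 ≃L[ℝ] 𝔼 := ContinuousLinearEquiv.smulLeft (Units.mk0 ((2 * Real.pi)⁻¹ : ℝ) hpi)
  refine ⟨SchwartzMap.compCLMOfContinuousLinearEquiv ℂ e (FourierTransform.fourier u),
    fun ξ => ?_⟩
  rw [SchwartzMap.compCLMOfContinuousLinearEquiv_apply, Function.comp_apply,
    SchwartzMap.fourier_coe, Real.fourier_eq', fourierHat]
  congr 1 with y
  rw [smul_eq_mul]
  congr 2
  have : e ξ = ((2 * Real.pi)⁻¹ : ℝ) • ξ := rfl
  rw [this, inner_smul_right]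
  have h2 : -2 * Real.pi * ((2 * Real.pi)⁻¹ * inner ℝ y ξ) = -inner ℝ y ξ := by field_simp
  rw [h2]
  push_cast; ring

theorem continuous_fourierHat (u : 𝓢(𝔼, ℂ)) : Continuous (fourierHat u) := by
  obtain ⟨g, hg⟩ := fourierHat_eq u
  have : fourierHat u = g := funext hg
  rw [this]; exact g.continuous

theorem integrable_bracket_mul_fourierHat (m : ℝ) (u : 𝓢(𝔼, ℂ)) :
    Integrable (fun ξ : 𝔼 => Real.sqrt (1 + ‖ξ‖ ^ 2) ^ m * ‖fourierHat u ξ‖) := by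
  obtain ⟨g, hg⟩ := fourierHat_eq u
  simp_rw [hg]
  obtain ⟨k, hk⟩ := exists_nat_ge m
  have h0 : Integrable (fun ξ => ‖ξ‖ ^ 0 * ‖g ξ‖) := g.integrable_pow_mul volume 0
  have h1 := ((h0.add (g.integrable_pow_mul volume k)).const_mul (2 ^ k))
  have hpos : ∀ ξ : 𝔼, 1 ≤ Real.sqrt (1 + ‖ξ‖ ^ 2) := fun ξ =>
    Real.one_le_sqrt.mpr (by nlinarith [norm_nonneg ξ])
  refine h1.mono' ?_ (Filter.Eventually.of_forall fun ξ => ?_)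
  · refine Continuous.aestronglyMeasurable (Continuous.mul ?_ g.continuous.norm)
    exact Continuous.rpow_const (by fun_prop) fun ξ => Or.inl (by linarith [hpos ξ])
  · have h2 : Real.sqrt (1 + ‖ξ‖ ^ 2) ≤ 1 + ‖ξ‖ :=
      Real.sqrt_le_iff.mpr ⟨by positivity, by nlinarith [norm_nonneg ξ]⟩
    have h3 : Real.sqrt (1 + ‖ξ‖ ^ 2) ^ m ≤ (1 + ‖ξ‖) ^ k := by
      calc _ ≤ Real.sqrt (1 + ‖ξ‖ ^ 2) ^ (k : ℝ) := Real.rpow_le_rpow_of_exponent_le (hpos ξ) hk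
        _ = Real.sqrt (1 + ‖ξ‖ ^ 2) ^ k := Real.rpow_natCast _ _
        _ ≤ _ := by gcongr
    have h4 := one_add_pow_le_two_pow_mul k (norm_nonneg ξ)
    rw [Real.norm_of_nonneg (by have := hpos ξ; positivity)]
    calc _ ≤ (2 ^ k * (1 + ‖ξ‖ ^ k)) * ‖g ξ‖ := by gcongr; exact h3.trans h4
      _ = _ := by simp only [Pi.add_apply, pow_zero]; ring

theorem ae_ne_zero (hn : 1 ≤ n) : ∀ᵐ ξ : 𝔼, ξ ≠ 0 := by
  have : Nonempty (Fin n) := ⟨⟨0, hn⟩⟩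
  rw [ae_iff]; simp

theorem integrable_fioIntegrand (hn : 1 ≤ n) {N : ℕ} {m ρ A : ℝ} {a : 𝔼 → 𝔼 → ℂ} {φ : 𝔼 → 𝔼 → ℝ}
    {x : 𝔼} (ha : SymbolBound N m ρ A (a x)) (hφ : ContinuousOn (φ x) {0}ᶜ) (u : 𝓢(𝔼, ℂ)) :
    Integrable (fioIntegrand a φ u x) := by
  have : Nonempty (Fin n) := ⟨⟨0, hn⟩⟩
  have hsm : AEStronglyMeasurable (fioIntegrand a φ u x) volume := by
    have hr : (volume : Measure 𝔼).restrict {0}ᶜ = volume :=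
      Measure.restrict_eq_self_of_ae_mem (ae_ne_zero hn)
    rw [← hr]
    refine ContinuousOn.aestronglyMeasurable ?_ isOpen_compl_singleton.measurableSet
    refine ContinuousOn.mul (ContinuousOn.mul ?_ ha.contDiff.continuous.continuousOn)
      (continuous_fourierHat u).continuousOn
    exact (continuousOn_const.mul (Complex.continuous_ofReal.comp_continuousOn hφ)).cexp
  refine ((integrable_bracket_mul_fourierHat m u).const_mul A).mono' hsm
    (Filter.Eventually.of_forall fun ξ => ?_)
  have h := ha.bound 0 (Nat.zero_le _) ξ
  have hpos : 0 < Real.sqrt (1 + ‖ξ‖ ^ 2) := Real.sqrt_pos.mpr (by positivity)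
  rw [norm_iteratedFDeriv_zero, Nat.cast_zero, mul_zero, add_zero, Real.rpow_neg hpos.le,
    inv_mul_le_iff₀ (by positivity)] at h
  rw [fioIntegrand, norm_mul, norm_mul, mul_comm Complex.I, Complex.norm_exp_ofReal_mul_I, one_mul]
  calc _ ≤ (Real.sqrt (1 + ‖ξ‖ ^ 2) ^ m * A) * ‖fourierHat u ξ‖ := by gcongr
    _ = _ := by ring

/-! ### Uniform constants -/

/-- One null set has to serve all `ξ` and all orders: continuity handles the former, countability
the latter. The sum of the constants dominates each of them. -/
theorem IsRoughPhase.exists_homogeneousPhase {φ : 𝔼 → 𝔼 → ℝ} (hφ : IsRoughPhase 2 φ) (N : ℕ) :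
    ∃ A : ℝ, 0 ≤ A ∧ ∀ᵐ x, HomogeneousPhase N A (φ x) := by
  have h : ∀ j : ℕ, ∃ C : ℝ, 0 ≤ C ∧ (2 ≤ j → ∀ᵐ x : 𝔼, ∀ ξ ∈ ({0}ᶜ : Set 𝔼),
      ‖ξ‖ ^ (-1 + (j : ℤ)) * ‖iteratedFDeriv ℝ j (φ x) ξ‖ ≤ C) := by
    intro j
    by_cases hj : 2 ≤ j
    · obtain ⟨C, hC⟩ := hφ.bound j hj
      have := ae_forall_le_of_continuousOn (P := (volume : Measure 𝔼)) (O := {0}ᶜ)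
        (h := fun x ξ => ‖ξ‖ ^ (-1 + (j : ℤ)) * ‖iteratedFDeriv ℝ j (φ x) ξ‖) (C := C)
        (fun x => by
          have h1 : ContinuousOn (iteratedFDeriv ℝ j (φ x)) {0}ᶜ :=
            ((hφ.contDiffOn x).continuousOn_iteratedFDerivWithin (m := j)
              (by exact_mod_cast le_top) isOpen_compl_singleton.uniqueDiffOn).congr
              fun s hs => (iteratedFDerivWithin_of_isOpen j isOpen_compl_singleton hs).symm
          exact (continuous_norm.continuousOn.zpow₀ _ fun ξ hξ =>
            Or.inl (norm_ne_zero_iff.mpr hξ)).mul h1.norm)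
        (fun ξ hξ => hC ξ hξ)
      refine ⟨max C 0, le_max_right _ _, fun _ => ?_⟩
      filter_upwards [this] with x hx ξ hξ using (hx ξ hξ).trans (le_max_left _ _)
    · exact ⟨0, le_rfl, fun h => absurd h hj⟩
  choose C hC0 hC using h
  refine ⟨∑ j ∈ Finset.range (N + 1), C j, Finset.sum_nonneg fun i _ => hC0 i, ?_⟩
  have h2 : ∀ᵐ x : 𝔼, ∀ j : ℕ, 2 ≤ j → ∀ ξ ∈ ({0}ᶜ : Set 𝔼),
      ‖ξ‖ ^ (-1 + (j : ℤ)) * ‖iteratedFDeriv ℝ j (φ x) ξ‖ ≤ C j :=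
    ae_all_iff.mpr fun j => by
      by_cases hj : 2 ≤ j
      · filter_upwards [hC j hj] with x hx _ using hx
      · exact Filter.Eventually.of_forall fun x h => absurd h hj
  filter_upwards [h2] with x hx
  refine ⟨hφ.homogeneous x, hφ.contDiffOn x, fun j hj hjN ξ hξ => (hx j hj ξ hξ).trans ?_⟩
  exact Finset.single_le_sum (f := C) (fun i _ => hC0 i) (Finset.mem_range.mpr (by omega))

theorem IsRoughAmplitude.exists_symbolBound {m ρ : ℝ} {a : 𝔼 → 𝔼 → ℂ}
    (ha : IsRoughAmplitude m ρ a) (N : ℕ) :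
    ∃ A : ℝ, 0 ≤ A ∧ ∀ᵐ x, SymbolBound N m ρ A (a x) := by
  have h : ∀ j : ℕ, ∃ C : ℝ, 0 ≤ C ∧ ∀ᵐ x : 𝔼, ∀ ξ ∈ (Set.univ : Set 𝔼),
      Real.sqrt (1 + ‖ξ‖ ^ 2) ^ (-m + ρ * j) * ‖iteratedFDeriv ℝ j (a x) ξ‖ ≤ C := by
    intro j
    obtain ⟨C, hC⟩ := ha.bound j
    have := ae_forall_le_of_continuousOn (P := (volume : Measure 𝔼)) (O := Set.univ)
      (h := fun x ξ => Real.sqrt (1 + ‖ξ‖ ^ 2) ^ (-m + ρ * j) * ‖iteratedFDeriv ℝ j (a x) ξ‖)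
      (C := C)
      (fun x => by
        have h1 : Continuous (iteratedFDeriv ℝ j (a x)) :=
          (ha.contDiff x).continuous_iteratedFDeriv (by exact_mod_cast le_top)
        refine (Continuous.mul ?_ h1.norm).continuousOn
        refine Continuous.rpow_const (by fun_prop) fun ξ => Or.inl ?_
        exact (Real.sqrt_pos.mpr (by positivity)).ne')
      (fun ξ _ => hC ξ)
    refine ⟨max C 0, le_max_right _ _, ?_⟩
    filter_upwards [this] with x hx ξ hξ using (hx ξ hξ).trans (le_max_left _ _)
  choose C hC0 hC using h
  refine ⟨∑ j ∈ Finset.range (N + 1), C j, Finset.sum_nonneg fun i _ => hC0 i, ?_⟩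
  filter_upwards [ae_all_iff.mpr hC] with x hx
  refine ⟨ha.contDiff x, fun j hjN ξ => (hx j ξ (Set.mem_univ _)).trans ?_⟩
  exact Finset.single_le_sum (f := C) (fun i _ => hC0 i) (Finset.mem_range.mpr (by omega))

theorem continuousOn_gradient {f : 𝔼 → ℝ} (hf : ContDiffOn ℝ ∞ f {0}ᶜ) :
    ContinuousOn (gradient f) {0}ᶜ := by
  have h := ((contDiffOn_infty_iff_fderiv_of_isOpen isOpen_compl_singleton).mp hf).2.continuousOn
  exact (LinearIsometryEquiv.continuous _).comp_continuousOn h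

/-- In dimension one, the increments of the gradient are controlled by `φ(ζ) + φ(-ζ)`. -/
theorem HomogeneousPhase.norm_fderiv_sub_le_of_dim_one {N : ℕ} {A B : ℝ} {f : 𝔼 → ℝ}
    (hf : HomogeneousPhase N A f) (hn : n = 1) {ζ : 𝔼} (hζ : ‖ζ‖ = 1)
    (hB : |f ζ + f (-ζ)| ≤ B) {ξ : 𝔼} (hξ : ξ ≠ 0) :
    ‖fderiv ℝ f ξ - fderiv ℝ f ζ‖ ≤ B := by
  have hB0 : 0 ≤ B := (abs_nonneg _).trans hB
  have hζ0 : ζ ≠ 0 := norm_pos_iff.mp (by rw [hζ]; norm_num)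
  have hspan : ∀ v : 𝔼, ∃ t : ℝ, t • ζ = v := fun v =>
    (finrank_eq_one_iff_of_nonzero' ζ hζ0).mp (by rw [finrank_euclideanSpace_fin, hn]) v
  obtain ⟨t, rfl⟩ := hspan ξ
  have ht : t ≠ 0 := fun h => hξ (by rw [h, zero_smul])
  -- On the ray of `ζ` the derivative is constant. On the opposite ray Euler's identity gives its
  -- value on `ζ` as `-f (-ζ)`, so the difference is `-(f ζ + f (-ζ))`.
  rcases lt_or_gt_of_ne ht with h | h
  · have h1 : t • ζ = (-t) • (-ζ) := by rw [smul_neg, neg_smul, neg_neg]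
    rw [h1, hf.fderiv_smul (neg_ne_zero.mpr hζ0) (by linarith)]
    refine ContinuousLinearMap.opNorm_le_bound _ hB0 fun v => ?_
    obtain ⟨s, rfl⟩ := hspan v
    have h2 : fderiv ℝ f (-ζ) ζ = - f (-ζ) := by
      rw [← hf.fderiv_self (neg_ne_zero.mpr hζ0), map_neg, neg_neg]
    rw [sub_apply, map_smul, map_smul, hf.fderiv_self hζ0, h2, norm_smul, hζ, mul_one,
      ← smul_sub, norm_smul, mul_comm]
    gcongr
    have h3 : -f (-ζ) - f ζ = -(f ζ + f (-ζ)) := by ring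
    rw [Real.norm_eq_abs, h3, abs_neg]
    exact hB
  · rw [hf.fderiv_smul hζ0 h, sub_self, norm_zero]; exact hB0

/-! ### The main estimate -/

theorem aestronglyMeasurable_fourierIntegralOperator (hn : 1 ≤ n) {a : 𝔼 → 𝔼 → ℂ}
    {φ : 𝔼 → 𝔼 → ℝ} (hac : ∀ x, Continuous (a x)) (ham : ∀ ξ, AEMeasurable (fun x => a x ξ) volume)
    (hφc : ∀ x, ContinuousOn (φ x) {0}ᶜ)
    (hφm : ∀ ξ, ξ ≠ 0 → AEMeasurable (fun x => φ x ξ) volume) (u : 𝓢(𝔼, ℂ)) :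
    AEStronglyMeasurable (fourierIntegralOperator a φ u) volume := by
  obtain ⟨a', ha'm, ha'⟩ := exists_measurable_version (P := (volume : Measure 𝔼)) isOpen_univ
    (fun x => (hac x).continuousOn) (fun ξ _ => ham ξ)
  obtain ⟨φ', hφ'm, hφ'⟩ := exists_measurable_version (P := (volume : Measure 𝔼))
    (isOpen_compl_singleton (x := (0 : 𝔼))) hφc (fun ξ hξ => hφm ξ hξ)
  have hF : Measurable fun q : 𝔼 × 𝔼 => Complex.exp (Complex.I * (φ' (q.2, q.1) : ℂ)) *
      a' (q.2, q.1) * fourierHat u q.2 := by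
    have h1 : Measurable fun q : 𝔼 × 𝔼 => (q.2, q.1) := measurable_snd.prodMk measurable_fst
    have h2 := hφ'm.comp h1
    have h3 := ha'm.comp h1
    have h4 : Measurable fun q : 𝔼 × 𝔼 => fourierHat u q.2 :=
      (continuous_fourierHat u).measurable.comp measurable_snd
    exact ((measurable_const.mul (Complex.measurable_ofReal.comp h2)).cexp.mul h3).mul h4
  have hI := hF.stronglyMeasurable.integral_prod_right' (ν := (volume : Measure 𝔼))
  refine AEStronglyMeasurable.const_mul ?_ _
  refine ⟨_, hI, ?_⟩
  filter_upwards [ha', hφ'] with x hax hφx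
  refine integral_congr_ae ?_
  filter_upwards [ae_ne_zero hn] with ξ hξ
  simp only [fioIntegrand]
  rw [hax ξ (Set.mem_univ _), hφx ξ hξ]

theorem exists_upperIntegralLE_fioIntegrand (hn : 1 ≤ n) {m ρ A A' B c : ℝ} (hρ0 : 0 ≤ ρ)
    (hρ1 : ρ ≤ 1) (hm : m < -((n : ℝ) - 1) / 2 + n * (ρ - 1))
    (hA : 0 ≤ A) (hA' : 0 ≤ A') (hB : 0 ≤ B) (hc : 0 < c) {a : 𝔼 → 𝔼 → ℂ} {φ : 𝔼 → 𝔼 → ℝ}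
    (hφ : ∀ᵐ x, HomogeneousPhase (n + 1) A (φ x))
    (ha : ∀ᵐ x, SymbolBound (n + 1) m ρ A' (a x))
    (hφc : ∀ x, ContDiffOn ℝ ∞ (φ x) {0}ᶜ)
    (hp : ∀ ζ, ζ ≠ 0 → AEMeasurable (fun x => gradient (φ x) ζ) volume)
    (hexp : ∀ x y ζ, ζ ≠ 0 → c * ‖x - y‖ ≤ ‖gradient (φ x) ζ - gradient (φ y) ζ‖)
    {ζ : 𝔼} (hζ : ζ ≠ 0)
    (hBx : ∀ᵐ x, ∀ ξ, ξ ≠ 0 → ‖fderiv ℝ (φ x) ξ - fderiv ℝ (φ x) ζ‖ ≤ B) :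
    ∃ C : ℝ, 0 ≤ C ∧ ∀ u : 𝓢(𝔼, ℂ),
      UpperIntegralLE volume (fun x => ‖∫ ξ, fioIntegrand a φ u x ξ‖ₑ)
        (ENNReal.ofReal C * ∫⁻ y, ‖u y‖ₑ) := by
  let Ψ₀ : ContDiffBump (0 : 𝔼) := ⟨1, 2, by norm_num, by norm_num⟩
  set Ψ : 𝔼 → ℂ := fun v => ((Ψ₀ v : ℝ) : ℂ) with hΨ
  have hΨ1 : ∀ v, ‖v‖ ≤ 1 → Ψ v = 1 := fun v hv => by
    have : Ψ₀ v = 1 := Ψ₀.one_of_mem_closedBall (mem_closedBall_zero_iff.mpr hv)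
    simp [hΨ, this]
  have hΨ2 : ∀ v, Ψ v ≠ 0 → ‖v‖ ≤ 2 := fun v hv => by
    have : v ∈ Function.support Ψ₀ := by
      intro h; exact hv (by simp [hΨ, h])
    rw [Ψ₀.support_eq, mem_ball_zero_iff] at this
    exact this.le
  have hΨb : ∀ v, ‖Ψ v‖ ≤ 1 := fun v => by
    rw [hΨ, Complex.norm_real, Real.norm_of_nonneg Ψ₀.nonneg]; exact Ψ₀.le_one
  have hΨcd : ContDiff ℝ (n + 1 : ℕ) Ψ := Complex.ofRealCLM.contDiff.comp Ψ₀.contDiff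
  have hΨc : Continuous Ψ := hΨcd.continuous
  have hΨs : HasCompactSupport Ψ :=
    HasCompactSupport.intro (isCompact_closedBall (0 : 𝔼) 2) fun v hv => by
      by_contra h; exact hv (mem_closedBall_zero_iff.mpr (hΨ2 v h))
  obtain ⟨CΨ, hCΨ0, hΨd⟩ := DerivBound.of_hasCompactSupport hΨcd hΨs
  set ψ : 𝔼 → ℂ := dyadicCutoff Ψ with hψ
  have hψs : ∀ v, ψ v ≠ 0 → 1 / 2 ≤ ‖v‖ ∧ ‖v‖ ≤ 2 := fun v hv =>
    dyadicCutoff_support hΨ1 hΨ2 hv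
  have hψcd : ContDiff ℝ (n + 1 : ℕ) ψ :=
    hΨcd.sub (hΨcd.comp (contDiff_const_smul (2 : ℝ)))
  have hψc : Continuous ψ := hψcd.continuous
  obtain ⟨Cψ, hCψ0, hψd⟩ := DerivBound.of_hasCompactSupport hψcd
    (HasCompactSupport.intro (isCompact_closedBall (0 : 𝔼) 2) fun v hv => by
      by_contra h; exact hv (mem_closedBall_zero_iff.mpr (hψs v h).2))
  have hpc : ∀ x, ContinuousOn (gradient (φ x)) {0}ᶜ := fun x => continuousOn_gradient (hφc x)
  obtain ⟨CH, hCH0, hH⟩ := exists_high_piece_bound hn hρ0 hρ1 hA hA' hc hφ ha hpc hp hexp hψd hψs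
  obtain ⟨C₁, C₂, hC₁, hC₂, hlow⟩ := exists_derivBound_lowSymbol 𝔼 n m ρ A A' B hρ0 hρ1 hA hA' hB ψ
    hψd hψs
  obtain ⟨CD, hCD0, hD⟩ := exists_fixed_direction_bound n c 2 hc
  set K₀ : ℝ := A' * 6 ^ (|m| + ((n + 1 : ℕ) : ℝ)) * CΨ with hK₀
  have hK₀0 : 0 ≤ K₀ := by positivity
  -- The exponent of a high piece; the hypothesis on `m` says exactly that it is negative.
  set e : ℝ := m + ((n : ℝ) - 1) / 2 + n * (1 - ρ) with he
  have he0 : e < 0 := by rw [he]; linarith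
  set q : ℝ := (2 : ℝ) ^ e with hq
  have hq0 : 0 < q := by positivity
  have hq1 : q < 1 := Real.rpow_lt_one_of_one_lt_of_neg one_lt_two he0
  have hS1 : Summable fun j : ℕ => CD * (C₁ * C₂ ^ n) * (1 / 2 : ℝ) ^ j :=
    (summable_geometric_of_lt_one (by norm_num) (by norm_num)).mul_left _
  have hS2 : Summable fun j : ℕ => CH * q * q ^ j :=
    (summable_geometric_of_lt_one hq0.le hq1).mul_left _
  refine ⟨CD * (K₀ * 2 ^ n) + (∑' j : ℕ, CD * (C₁ * C₂ ^ n) * (1 / 2 : ℝ) ^ j) +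
    ∑' j : ℕ, CH * q * q ^ j, by positivity, fun u => ?_⟩
  set p : 𝔼 → 𝔼 := fun x => gradient (φ x) ζ with hpdef
  have hint : ∀ᵐ x, Integrable (fioIntegrand a φ u x) := by
    filter_upwards [ha] with x hax using integrable_fioIntegrand hn hax (hφc x).continuousOn u
  -- The linearised low-frequency operator is one packet with `l = 1`; its scale `2` is the sum of
  -- the unit scales of amplitude and cutoff.
  have hbase := hD p (fun x ξ => a x ξ * Ψ ξ) u 1 K₀ 2 (hp ζ hζ) (fun x y => hexp x y ζ hζ)
    u.continuous u.integrable one_pos hK₀0 (by norm_num) (by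
      filter_upwards [ha] with x hax
      simp only [one_smul]
      refine ⟨hax.derivBound_mul_cutoff hρ0 hρ1 hA' hΨd hΨ2, fun s hs => ?_⟩
      by_contra h
      exact hs (mem_closedBall_zero_iff.mpr (hΨ2 s (right_ne_zero_of_mul h))))
  have hlowj := fun j : ℕ => hD p (fun x ξ => lowSymbol (φ x) (a x) ψ ζ ((1 / 2 : ℝ) ^ j) ξ) u
    ((1 / 2 : ℝ) ^ j) (C₁ * (1 / 2 : ℝ) ^ j) C₂ (hp ζ hζ) (fun x y => hexp x y ζ hζ)
    u.continuous u.integrable (by positivity) (by positivity) hC₂ (by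
      filter_upwards [hφ, ha, hBx] with x hφx hax hBx
      exact hlow (φ x) (a x) hφx hax ζ _ hBx (by positivity)
        (pow_le_one₀ (by norm_num) (by norm_num)))
  have hhigh := fun j : ℕ => hH u ((2 : ℝ) ^ (j + 1)) u.continuous u.integrable
    (one_le_pow₀ one_le_two) hint
  refine ((hbase.add (UpperIntegralLE.tsum hlowj)).add (UpperIntegralLE.tsum hhigh)).mono ?_
    (le_of_eq ?_)
  · filter_upwards [ha, hint] with x hax hix
    set G : 𝔼 → ℂ := fun ξ => Complex.exp (Complex.I * ((inner ℝ (p x) ξ : ℝ) : ℂ)) *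
      a x ξ * fourierHat u ξ with hG
    have hGi : Integrable G :=
      integrable_fioIntegrand (a := a) (φ := fun _ ξ => inner ℝ (p x) ξ) hn hax
        (by fun_prop) u
    have hne := ae_ne_zero hn
    have hm1 : Integrable (fun ξ => fioIntegrand a φ u x ξ * (1 - Ψ ξ)) :=
      hix.mul_bdd (c := 2) (by fun_prop) (Filter.Eventually.of_forall fun ξ =>
        (norm_sub_le _ _).trans (by rw [norm_one]; linarith [hΨb ξ]))
    have hm2 : Integrable (fun ξ => G ξ * Ψ ξ) :=
      hGi.mul_bdd (c := 1) (by fun_prop) (Filter.Eventually.of_forall fun ξ => hΨb ξ)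
    have hm3 : Integrable (fun ξ => (fioIntegrand a φ u x ξ - G ξ) * Ψ ξ) :=
      (hix.sub hGi).mul_bdd (c := 1) (by fun_prop)
        (Filter.Eventually.of_forall fun ξ => hΨb ξ)
    -- Here `G` has the linearised phase. Only the middle term is decomposed dyadically towards the
    -- origin, where `φ` need not be smooth.
    have hsplit : ∫ ξ, fioIntegrand a φ u x ξ = (∫ ξ, G ξ * Ψ ξ) +
        (∫ ξ, (fioIntegrand a φ u x ξ - G ξ) * Ψ ξ) + ∫ ξ, fioIntegrand a φ u x ξ * (1 - Ψ ξ) := by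
      have hm4 : Integrable fun ξ => G ξ * Ψ ξ + (fioIntegrand a φ u x ξ - G ξ) * Ψ ξ :=
        hm2.add hm3
      rw [← integral_add hm2 hm3, ← integral_add hm4 hm1]
      congr 1 with ξ
      ring
    have hl := enorm_integral_mul_le_tsum (hix.sub hGi)
      (κ := fun j ξ => ψ (((1 / 2 : ℝ) ^ j)⁻¹ • ξ)) (k := Ψ) (fun j => by fun_prop) (B := 2)
      (fun J ξ => by
        rw [hψ, sum_dyadicCutoff_low]
        exact (norm_sub_le _ _).trans (by linarith [hΨb ξ, hΨb (((1 / 2 : ℝ) ^ J)⁻¹ • ξ)]))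
      (by filter_upwards [hne] with ξ hξ using tendsto_sum_dyadicCutoff_low hΨ2 hξ)
    have hh := enorm_integral_mul_le_tsum hix
      (κ := fun j ξ => ψ (((2 : ℝ) ^ (j + 1))⁻¹ • ξ)) (k := fun ξ => 1 - Ψ ξ)
      (fun j => by fun_prop) (B := 2)
      (fun J ξ => by
        rw [hψ, sum_dyadicCutoff_high]
        exact (norm_sub_le _ _).trans (by linarith [hΨb ξ, hΨb (((2 : ℝ) ^ J)⁻¹ • ξ)]))
      (Filter.Eventually.of_forall fun ξ => tendsto_sum_dyadicCutoff_high hΨ1 ξ)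
    have hl2 : ∀ j : ℕ, ∫ ξ, (fioIntegrand a φ u x - G) ξ * ψ (((1 / 2 : ℝ) ^ j)⁻¹ • ξ) =
        ∫ ξ, Complex.exp (Complex.I * ((inner ℝ (p x) ξ : ℝ) : ℂ)) *
          lowSymbol (φ x) (a x) ψ ζ ((1 / 2 : ℝ) ^ j) ξ * fourierHat u ξ := by
      intro j
      congr 1 with ξ
      simp only [Pi.sub_apply, hG, fioIntegrand, lowSymbol, hpdef, inner_gradient_eq_fderiv]
      have : Complex.exp (Complex.I * (φ x ξ : ℂ)) =
          Complex.exp (Complex.I * ((fderiv ℝ (φ x) ζ ξ : ℝ) : ℂ)) *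
          Complex.exp (Complex.I * ((φ x ξ - fderiv ℝ (φ x) ζ ξ : ℝ) : ℂ)) := by
        rw [← Complex.exp_add]; congr 1; push_cast; ring
      rw [this]; ring
    simp_rw [hl2] at hl
    rw [hsplit]
    refine (enorm_add_le _ _).trans (add_le_add ((enorm_add_le _ _).trans
      (add_le_add (le_of_eq ?_) hl)) hh)
    congr 2 with ξ
    rw [hG]; ring
  · rw [ENNReal.tsum_mul_right, ENNReal.tsum_mul_right, ← add_mul, ← add_mul]
    congr 1
    rw [ENNReal.ofReal_add (by positivity) (by positivity), ENNReal.ofReal_add (by positivity)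
      (by positivity), ENNReal.ofReal_tsum_of_nonneg (fun j => by positivity) hS1,
      ENNReal.ofReal_tsum_of_nonneg (fun j => by positivity) hS2]
    congr 1
    · congr 2
      ext j
      congr 1
      ring
    · congr 1
      ext j
      congr 1
      rw [hq, ← Real.rpow_natCast, ← Real.rpow_natCast, ← Real.rpow_mul zero_le_two,
        ← Real.rpow_mul zero_le_two, mul_assoc, ← Real.rpow_add two_pos]
      congr 2
      push_cast; ring

end

/-! ### Dimension zero and the conclusion -/

theorem fourierIntegralOperator_bound_of_subsingleton
    (a : EuclideanSpace ℝ (Fin 0) → EuclideanSpace ℝ (Fin 0) → ℂ)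
    (φ : EuclideanSpace ℝ (Fin 0) → EuclideanSpace ℝ (Fin 0) → ℝ) :
    ∃ C : ℝ, 0 < C ∧ ∀ u : 𝓢(EuclideanSpace ℝ (Fin 0), ℂ),
      (∀ᵐ x, Integrable (fioIntegrand a φ u x) volume) ∧
      Integrable (fourierIntegralOperator a φ u) volume ∧
      ∫ x, ‖fourierIntegralOperator a φ u x‖ ≤ C * ∫ x, ‖u x‖ := by
  have hc : ∀ {W : Type} (f : EuclideanSpace ℝ (Fin 0) → W), f = fun _ => f 0 := fun f => by
    ext1 x; rw [Subsingleton.elim x 0]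
  have : CompactSpace (EuclideanSpace ℝ (Fin 0)) := Finite.compactSpace
  have hi : ∀ f : EuclideanSpace ℝ (Fin 0) → ℂ, Integrable f volume := fun f => by
    rw [hc f]; exact integrable_const _
  set v := (volume : Measure (EuclideanSpace ℝ (Fin 0))).real Set.univ with hv
  have hv0 : 0 ≤ v := measureReal_nonneg
  refine ⟨v * v * ‖a 0 0‖ + 1, by positivity, fun u =>
    ⟨Filter.Eventually.of_forall fun x => hi _, hi _, ?_⟩⟩
  have hI : ∀ f : EuclideanSpace ℝ (Fin 0) → ℂ, ∫ x, f x = v • f 0 := fun f => by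
    rw [hc f]; simp [hv]
  have hIr : ∀ f : EuclideanSpace ℝ (Fin 0) → ℝ, ∫ x, f x = v * f 0 := fun f => by
    rw [hc f]; simp [hv]
  rw [hIr, hIr]
  have h1 : ‖fourierIntegralOperator a φ u 0‖ = v * (‖a 0 0‖ * (v * ‖u 0‖)) := by
    rw [fourierIntegralOperator, hI, fioIntegrand, fourierHat, hI]
    simp only [pow_zero, Complex.ofReal_one, inv_one, one_mul, norm_smul, norm_mul,
      Real.norm_of_nonneg hv0]
    rw [mul_comm Complex.I, Complex.norm_exp_ofReal_mul_I]
    simp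
  rw [h1]
  have h2 : 0 ≤ v * ‖u 0‖ := by positivity
  nlinarith

theorem mainTheorem8 (n : ℕ) (m ρ : ℝ) (hρ0 : 0 ≤ ρ) (hρ1 : ρ ≤ 1)
    (hm : m < -((n : ℝ) - 1) / 2 + n * (ρ - 1))
    (a : EuclideanSpace ℝ (Fin n) → EuclideanSpace ℝ (Fin n) → ℂ)
    (φ : EuclideanSpace ℝ (Fin n) → EuclideanSpace ℝ (Fin n) → ℝ)
    (ha : IsRoughAmplitude m ρ a)
    (hφ : IsRoughPhase 2 φ)
    (hnd : RoughNondegenerate φ)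
    (hdim : n = 1 → ∃ B : ℝ, ∀ ξ : EuclideanSpace ℝ (Fin n), ‖ξ‖ = 1 →
      ∀ᵐ x ∂(volume : Measure (EuclideanSpace ℝ (Fin n))), |φ x ξ + φ x (-ξ)| ≤ B) :
    ∃ C : ℝ, 0 < C ∧ ∀ u : 𝓢(EuclideanSpace ℝ (Fin n), ℂ),
      (∀ᵐ x ∂(volume : Measure (EuclideanSpace ℝ (Fin n))),
        Integrable (fioIntegrand a φ u x) volume) ∧
      Integrable (fourierIntegralOperator a φ u) volume ∧
      ∫ x, ‖fourierIntegralOperator a φ u x‖ ≤ C * ∫ x, ‖u x‖ := by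
  rcases Nat.eq_zero_or_pos n with rfl | hn
  · exact fourierIntegralOperator_bound_of_subsingleton a φ
  obtain ⟨A, hA, hAx⟩ := hφ.exists_homogeneousPhase (n + 1)
  obtain ⟨A', hA', hAx'⟩ := ha.exists_symbolBound (n + 1)
  obtain ⟨c, hc, hexp⟩ := hnd.lower_bound
  -- The reference direction for low frequencies; any unit vector would do.
  set ζ : EuclideanSpace ℝ (Fin n) := EuclideanSpace.single ⟨0, hn⟩ 1 with hζdef
  have hζ1 : ‖ζ‖ = 1 := by rw [hζdef]; simp
  have hζ : ζ ≠ 0 := norm_pos_iff.mp (by rw [hζ1]; norm_num)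
  obtain ⟨B, hB, hBx⟩ : ∃ B : ℝ, 0 ≤ B ∧ ∀ᵐ x, ∀ ξ, ξ ≠ 0 →
      ‖fderiv ℝ (φ x) ξ - fderiv ℝ (φ x) ζ‖ ≤ B := by
    rcases Nat.lt_or_ge n 2 with h | h
    · have hn1 : n = 1 := by omega
      obtain ⟨B, hB⟩ := hdim hn1
      refine ⟨max B 0, le_max_right _ _, ?_⟩
      filter_upwards [hAx, hB ζ hζ1] with x hx hBx ξ hξ
      exact hx.norm_fderiv_sub_le_of_dim_one hn1 hζ1 (hBx.trans (le_max_left _ _)) hξ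
    · refine ⟨A * (1 / 2 : ℝ)⁻¹ ^ (n + 1) * 4, by positivity, ?_⟩
      filter_upwards [hAx] with x hx ξ hξ
      exact hx.norm_fderiv_sub_le (by omega) (by rwa [finrank_euclideanSpace_fin]) hξ hζ
  have hp : ∀ ζ : EuclideanSpace ℝ (Fin n), ζ ≠ 0 →
      AEMeasurable (fun x => gradient (φ x) ζ) volume := fun ζ hζ =>
    aemeasurable_gradient (fun x ξ hξ => ((hφ.contDiffOn x ξ hξ).contDiffAt
      (isOpen_compl_singleton.mem_nhds hξ)).differentiableAt (by simp)) hφ.aemeasurable hζ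
  obtain ⟨C, hC0, hC⟩ := exists_upperIntegralLE_fioIntegrand hn hρ0 hρ1 hm hA hA' hB hc hAx hAx'
    hφ.contDiffOn hp hexp hζ hBx
  -- The summand `1` only makes the constant strictly positive.
  refine ⟨((2 * Real.pi) ^ n)⁻¹ * C + 1, by positivity, fun u => ?_⟩
  have hmeas := aestronglyMeasurable_fourierIntegralOperator hn (fun x => (ha.contDiff x).continuous)
    ha.aemeasurable (fun x => (hφ.contDiffOn x).continuousOn) hφ.aemeasurable u
  have hu : ∫⁻ y, ‖u y‖ₑ = ENNReal.ofReal (∫ y, ‖u y‖) := by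
    rw [ofReal_integral_norm_eq_lintegral_enorm u.integrable]
  have hU0 : 0 ≤ ∫ y, ‖u y‖ := integral_nonneg fun y => norm_nonneg _
  have hle : ∫⁻ x, ‖fourierIntegralOperator a φ u x‖ₑ ≤
      ENNReal.ofReal (((2 * Real.pi) ^ n)⁻¹ * C * ∫ y, ‖u y‖) := by
    have h1 := ((hC u).const_mul (ENNReal.ofReal ((2 * Real.pi) ^ n)⁻¹)).lintegral_le
    rw [hu, ← ENNReal.ofReal_mul hC0, ← ENNReal.ofReal_mul (by positivity), ← mul_assoc] at h1
    refine le_trans (le_of_eq (lintegral_congr fun x => ?_)) h1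
    rw [fourierIntegralOperator, enorm_mul, ← Complex.ofReal_inv, ← ofReal_norm,
      Complex.norm_real, Real.norm_of_nonneg (by positivity)]
  refine ⟨?_, ⟨hmeas, hle.trans_lt ENNReal.ofReal_lt_top⟩, ?_⟩
  · filter_upwards [hAx'] with x hx
    exact integrable_fioIntegrand hn hx (hφ.contDiffOn x).continuousOn u
  · rw [integral_norm_eq_lintegral_enorm hmeas]
    refine (ENNReal.toReal_mono ENNReal.ofReal_ne_top hle).trans ?_
    rw [ENNReal.toReal_ofReal (by positivity)]
    have : 0 ≤ 1 * ∫ y, ‖u y‖ := by linarith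
    linarith
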